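/- Setting. Let $\mathbb H,\mathbb U$ be real separable Hilbert spaces, $A$ the generator of a $C_0$-semigroup $(U(t))_{t\ge 0}$ on $\mathbb H$ that is exponentially stable: $\|U(t)\|\le Ne^{-\alpha t}$ for $t\ge 0$, with $N,\alpha>0$. Let $Q$ be a non-negative self-adjoint bounded operator on $\mathbb U$ with $Qe_n=\sigma_n e_n$ for an orthonormal basis $(e_n)$, let $\frac12<H<1$, let $(\beta^H_n)$ be independent two-sided real fractional Brownian motions with Hurst index $H$ on a probability space $(\Omega,\mathcal F,\mathbb P)$, and let $B^H_Q=\sum_n\beta^H_nQ^{1/2}e_n$ (a formal series) and $\mathcal F_t=\sigma\{B^H_Q(s):s\le t\}$ $(t\in\mathbb R)$, that is, $\mathcal F_t=\sigma\{\sqrt{\sigma_n}\,\beta^H_n(s):s\le t,\ n\}$. Stochastic integrals are $\int_a^b\Phi\,dB^H_Q=\sum_n\int_a^b\Phi(s)Q^{1/2}e_n\,d\beta^H_n(s)$ (Wiener integrals, series in $L^2(\mathbb P,\mathbb H)$). Let $L^0_Q(\mathbb U,\mathbb H)$ be the space of bounded operators $\xi:\mathbb U\to\mathbb H$ with $\xi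 Q^{1/2}$ Hilbert–Schmidt and norm $|\xi Q^{1/2}|_{HS}$. Let $f\in C_b(\mathbb R,L^2(\mathbb P,\mathbb H))$ be adapted to $(\mathcal F_t)$ (up to null sets), and let $g\in C_b(\mathbb R,L^0_Q(\mathbb U,\mathbb H))$. Consider $$dX(t)=(AX(t)+f(t))\,dt+g(t)\,dB^H_Q(t).\qquad(*)$$ A solution of $(*)$ on $\mathbb R$ is an adapted process $x$ with, for all $t_0\le t$, $x(t)=U(t-t_0)x(t_0)+\int_{t_0}^tU(t-s)f(s)\,ds+\int_{t_0}^tU(t-s)g(s)\,dB^H_Q(s)$. Recurrence classes. For a metric space $(\mathbb X,\rho)$ let $C(\mathbb R,\mathbb X)$ carry the metric $d(\varphi,\psi)=\sup_{T>0}\min\{\max_{|t|\le T}\rho(\varphi(t),\psi(t)),1/T\}$, and let $\varphi^\tau(t)=\varphi(t+\tau)$. Let $\mathcal T(\varphi,\epsilon)=\{\tau:\rho(\varphi(t+\tau),\varphi(t))<\epsilon\ \forall t\in\mathbb R\}$ and $\mathcal S(\varphi,\epsilon)=\{\tau: d(\varphi^\tau,\varphi)<\epsilon\}$. A set $D\subseteq\mathbb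 R$ is relatively dense if for some $l>0$ it meets every $[a,a+l]$. A function $\varphi\in C(\mathbb R,\mathbb X)$ is: stationary if $\varphi(t)=\varphi(0)$ for all $t$; $\tau$-periodic if $\varphi(t+\tau)=\varphi(t)$ for all $t$; quasi-periodic with frequencies $\nu_1,\dots,\nu_k$ if these are rationally independent and $\varphi(t)=\Phi(\nu_1t,\dots,\nu_kt)$ for a continuous $\Phi:\mathbb R^k\to\mathbb X$ that is $2\pi$-periodic in each argument; Bohr almost periodic if every $\mathcal T(\varphi,\epsilon)$, $\epsilon>0$, is relatively dense; almost recurrent if every $\mathcal S(\varphi,\epsilon)$, $\epsilon>0$, is relatively dense; Lagrange stable if $\{\varphi^h:h\in\mathbb R\}$ is relatively compact in $C(\mathbb R,\mathbb X)$; Birkhoff recurrent if almost recurrent and Lagrange stable; Levitan almost periodic if there is a Bohr almost periodic $\psi$, with values in some complete metric space, such that for every $\epsilon>0$ some $\delta>0$ has $\mathcal T(\psi,\delta)\subseteq\mathcal S(\varphi,\epsilon)$; Bohr almost automorphic if Levitan almost periodic and Lagrange stable; Poisson stable (respectively pseudo-periodic) if for all $\epsilon,l>0$ the set $\mathcal S(\varphi,\epsilon)$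 (respectively $\mathcal T(\varphi,\epsilon)$) contains numbers $\tau>l$ and numbers $\tau<-l$; pseudo-recurrent if for all $\epsilon>0$, $l\in\mathbb R$ there is $L\ge l$ such that for every $\tau_0\in\mathbb R$ some $\tau\in[l,L]$ satisfies $\sup_{t\le 1/\epsilon}\rho(\varphi(t+\tau_0+\tau),\varphi(t+\tau_0))\le\epsilon$. Window pseudo-recurrence is the same condition with $\sup_{|t|\le1/\epsilon}$ in place of $\sup_{t\le 1/\epsilon}$. $f,g$ have a property jointly if $t\mapsto(f(t),g(t))$ has it, where $g(t)$ is identified with the Hilbert–Schmidt operator $g(t)Q^{1/2}$, an element of the complete space of Hilbert–Schmidt operators. A process $\varphi\in C_b(\mathbb R,L^2(\mathbb P,\mathbb H))$ has a property in distribution if the curve $t\mapsto\mathrm{Law}(\varphi(t))$ has it, in the space of Borel probability measures on $\mathbb H$ with the metric $\mathcal D(\mu,\nu)=\sup\{|\int u\,d\mu-\int u\,d\nu|:\mathrm{Lip}(u)+\|u\|_\infty\le1\}$. Statement. Equation $(*)$ has a unique solution $\varphi\in C_b(\mathbb R,L^2(\mathbb P,\mathbb H))$, and: 1. If $f$ and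 $g$ are jointly stationary (respectively $\tau$-periodic, quasi-periodic with frequencies $\nu_1,\dots,\nu_k$, Bohr almost periodic, Bohr almost automorphic, Birkhoff recurrent, Lagrange stable, Levitan almost periodic, almost recurrent, Poisson stable), then $\varphi$ has the same property in distribution (with the same $\tau$, respectively the same frequencies). 2. If $f$ and $g$ are jointly Lagrange stable and jointly pseudo-periodic (respectively pseudo-recurrent), then $\varphi$ is pseudo-periodic (respectively pseudo-recurrent) in distribution. The same holds for window pseudo-recurrence if, in addition, $f$ is non-random or $f,g$ are jointly Poisson stable. -/

import Mathlib

open MeasureTheory ProbabilityTheory Filter Topology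
open scoped NNReal ENNReal BoundedContinuousFunction

noncomputable section

/-! ## Recurrence classes of continuous functions on the real line -/

namespace Recur

variable {X : Type*} [PseudoMetricSpace X]

/-- The translate `t ↦ φ (h + t)`. -/
def translate (φ : C(ℝ, X)) (h : ℝ) : C(ℝ, X) :=
  φ.comp ⟨fun t => h + t, by fun_prop⟩

/-- The metric `d(φ, ψ) = sup_{T > 0} min {max_{|t| ≤ T} ρ(φ t, ψ t), 1/T}` on `C(ℝ, X)`;
it induces the compact-open topology, which is Mathlib's topology on `C(ℝ, X)`. -/
def cdist (φ ψ : C(ℝ, X)) : ℝ :=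
  ⨆ T : Set.Ioi (0 : ℝ),
    min (⨆ t : Set.Icc (-(T : ℝ)) (T : ℝ), dist (φ t) (ψ t)) (1 / (T : ℝ))

/-- A set of reals meeting every interval of some fixed length. -/
def RelativelyDense (A : Set ℝ) : Prop :=
  ∃ l : ℝ, 0 < l ∧ ∀ a : ℝ, (A ∩ Set.Icc a (a + l)).Nonempty

/-- The set of `ε`-almost periods of `φ`. -/
def almostPeriods (φ : C(ℝ, X)) (ε : ℝ) : Set ℝ :=
  {τ | ∀ t : ℝ, dist (φ (t + τ)) (φ t) < ε}

/-- The set of `ε`-shifts of `φ`. -/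
def shifts (φ : C(ℝ, X)) (ε : ℝ) : Set ℝ :=
  {τ | cdist (translate φ τ) φ < ε}

def IsStationary (φ : C(ℝ, X)) : Prop :=
  ∀ t : ℝ, φ t = φ 0

def IsPeriodic (τ : ℝ) (φ : C(ℝ, X)) : Prop :=
  ∀ t : ℝ, φ (t + τ) = φ t

/-- Quasi-periodic with the spectrum of frequencies `ν 0, …, ν (k - 1)`. -/
def IsQuasiPeriodic {k : ℕ} (ν : Fin k → ℝ) (φ : C(ℝ, X)) : Prop :=
  LinearIndependent ℚ ν ∧
    ∃ Φ : C(Fin k → ℝ, X),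
      (∀ (θ : Fin k → ℝ) (i : Fin k), Φ (θ + Pi.single i (2 * Real.pi)) = Φ θ) ∧
      ∀ t : ℝ, φ t = Φ (fun i => ν i * t)

def IsBohrAlmostPeriodic (φ : C(ℝ, X)) : Prop :=
  ∀ ε : ℝ, 0 < ε → RelativelyDense (almostPeriods φ ε)

/-- Almost recurrent in the sense of Bebutov. -/
def IsAlmostRecurrent (φ : C(ℝ, X)) : Prop :=
  ∀ ε : ℝ, 0 < ε → RelativelyDense (shifts φ ε)

def IsLagrangeStable (φ : C(ℝ, X)) : Prop :=
  IsCompact (closure (Set.range (translate φ)))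

def IsBirkhoffRecurrent (φ : C(ℝ, X)) : Prop :=
  IsAlmostRecurrent φ ∧ IsLagrangeStable φ

/-- Levitan almost periodic. The image of a continuous `ψ : ℝ → Y` is separable, so it is no
restriction to let `Y` range over the complete metric spaces in `Type`. -/
def IsLevitanAlmostPeriodic (φ : C(ℝ, X)) : Prop :=
  ∃ (Y : Type) (_ : MetricSpace Y) (_ : CompleteSpace Y) (ψ : C(ℝ, Y)),
    IsBohrAlmostPeriodic ψ ∧
      ∀ ε : ℝ, 0 < ε → ∃ δ : ℝ, 0 < δ ∧ almostPeriods ψ δ ⊆ shifts φ ε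

def IsBohrAlmostAutomorphic (φ : C(ℝ, X)) : Prop :=
  IsLevitanAlmostPeriodic φ ∧ IsLagrangeStable φ

/-- Poisson stable, in both directions. -/
def IsPoissonStable (φ : C(ℝ, X)) : Prop :=
  ∀ ε l : ℝ, 0 < ε → 0 < l →
    (∃ τ ∈ shifts φ ε, l < τ) ∧ (∃ τ ∈ shifts φ ε, τ < -l)

/-- Pseudo-periodic, in both directions. -/
def IsPseudoPeriodic (φ : C(ℝ, X)) : Prop :=
  ∀ ε l : ℝ, 0 < ε → 0 < l →
    (∃ τ ∈ almostPeriods φ ε, l < τ) ∧ (∃ τ ∈ almostPeriods φ ε, τ < -l)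

/-- Pseudo-recurrent, the supremum being taken over the half-line `t ≤ 1 / ε`. -/
def IsPseudoRecurrent (φ : C(ℝ, X)) : Prop :=
  ∀ ε l : ℝ, 0 < ε → ∃ L : ℝ, l ≤ L ∧ ∀ τ₀ : ℝ, ∃ τ ∈ Set.Icc l L,
    ∀ t : ℝ, t ≤ 1 / ε → dist (φ (t + τ₀ + τ)) (φ (t + τ₀)) ≤ ε

/-- The variant of pseudo-recurrence with the supremum over the window `|t| ≤ 1 / ε`. -/
def IsWindowPseudoRecurrent (φ : C(ℝ, X)) : Prop :=
  ∀ ε l : ℝ, 0 < ε → ∃ L : ℝ, l ≤ L ∧ ∀ τ₀ : ℝ, ∃ τ ∈ Set.Icc l L,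
    ∀ t : ℝ, |t| ≤ 1 / ε → dist (φ (t + τ₀ + τ)) (φ (t + τ₀)) ≤ ε

end Recur

/-! ## Borel probability measures with the bounded Lipschitz metric -/

namespace BL

/-- The real functions with `Lip f + ‖f‖_∞ ≤ 1`. -/
def unitBall (E : Type*) [NormedAddCommGroup E] : Set (E → ℝ) :=
  {f | ∃ L M : ℝ≥0, L + M ≤ 1 ∧ LipschitzWith L f ∧ ∀ x, |f x| ≤ M}

/-- The Borel probability measures on `E`. -/
structure Prob (E : Type*) [MeasurableSpace E] where
  meas : Measure E
  isProb : IsProbabilityMeasure meas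

instance {E : Type*} [MeasurableSpace E] (μ : Prob E) : IsProbabilityMeasure μ.meas := μ.isProb

theorem unitBall.abs_integral_le {E : Type*} [NormedAddCommGroup E] [MeasurableSpace E]
    {f : E → ℝ} (hf : f ∈ unitBall E) (μ : Measure E)
    [IsProbabilityMeasure μ] : |∫ x, f x ∂μ| ≤ 1 := by
  obtain ⟨L, M, hLM, hL, hM⟩ := hf
  have h1 := norm_integral_le_of_norm_le_const (μ := μ) (f := f) (C := M)
    (Eventually.of_forall hM)
  have h2 : (M : ℝ) ≤ 1 := by
    have : (L : ℝ) + M ≤ 1 := by exact_mod_cast hLM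
    have := L.coe_nonneg
    linarith
  simp only [Real.norm_eq_abs, probReal_univ, mul_one] at h1
  exact h1.trans h2

variable {E : Type*} [NormedAddCommGroup E] [MeasurableSpace E]

/-- `𝒟(μ, ν) = sup {|∫ f dμ - ∫ f dν| : ‖f‖_BL ≤ 1}`. -/
def bdist (μ ν : Prob E) : ℝ :=
  ⨆ f : unitBall E, |∫ x, f.1 x ∂μ.meas - ∫ x, f.1 x ∂ν.meas|

theorem bddAbove_bdist (μ ν : Prob E) :
    BddAbove (Set.range fun f : unitBall E => |∫ x, f.1 x ∂μ.meas - ∫ x, f.1 x ∂ν.meas|) := by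
  refine ⟨2, ?_⟩
  rintro _ ⟨f, rfl⟩
  have h1 := unitBall.abs_integral_le f.2 μ.meas
  have h2 := unitBall.abs_integral_le f.2 ν.meas
  have h3 := abs_sub (∫ x, f.1 x ∂μ.meas) (∫ x, f.1 x ∂ν.meas)
  simp only
  linarith

instance : Nonempty (unitBall E) :=
  ⟨⟨fun _ => 0, 0, 0, by simp, LipschitzWith.const 0, by simp⟩⟩

instance : PseudoMetricSpace (Prob E) where
  dist := bdist
  dist_self μ := by simp [bdist]
  dist_comm μ ν := by simp only [bdist, abs_sub_comm]
  dist_triangle μ ν κ := by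
    refine ciSup_le fun f => ?_
    have h1 := le_ciSup (bddAbove_bdist μ ν) f
    have h2 := le_ciSup (bddAbove_bdist ν κ) f
    have h3 := abs_sub_le (∫ x, f.1 x ∂μ.meas) (∫ x, f.1 x ∂ν.meas) (∫ x, f.1 x ∂κ.meas)
    simp only [bdist]
    linarith

variable [BorelSpace E] {Ω : Type*} [MeasurableSpace Ω] {P : Measure Ω} [IsProbabilityMeasure P]

/-- The law of a random variable in `L²(P, E)`. -/
def law (x : Lp E 2 P) : Prob E :=
  ⟨P.map x, Measure.isProbabilityMeasure_map (Lp.aestronglyMeasurable x).aemeasurable⟩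

theorem dist_law_le (x y : Lp E 2 P) : dist (law x) (law y) ≤ dist x y := by
  refine ciSup_le fun f => ?_
  obtain ⟨L, M, hLM, hL, hM⟩ := f.2
  have key : ∀ z : Lp E 2 P, ∫ a, f.1 a ∂(law z).meas = ∫ ω, f.1 (z ω) ∂P := fun z =>
    integral_map (Lp.aestronglyMeasurable z).aemeasurable
      hL.continuous.measurable.aestronglyMeasurable
  have hint : ∀ z : Lp E 2 P, Integrable (fun ω => f.1 (z ω)) P := fun z =>
    Integrable.of_bound
      (hL.continuous.comp_aestronglyMeasurable (Lp.aestronglyMeasurable z)) (M : ℝ)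
      (Eventually.of_forall fun ω => hM _)
  have hL1 : (L : ℝ) ≤ 1 := by
    have : (L : ℝ) + M ≤ 1 := by exact_mod_cast hLM
    have := M.coe_nonneg
    linarith
  have hmem : MemLp (fun ω => x ω - y ω) 2 P := (Lp.memLp x).sub (Lp.memLp y)
  have hi : Integrable (fun ω => x ω - y ω) P := hmem.integrable (by norm_num)
  rw [key, key, ← integral_sub (hint x) (hint y)]
  calc |∫ ω, (f.1 (x ω) - f.1 (y ω)) ∂P|
      ≤ ∫ ω, |f.1 (x ω) - f.1 (y ω)| ∂P := abs_integral_le_integral_abs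
    _ ≤ ∫ ω, ‖x ω - y ω‖ ∂P := by
        refine integral_mono ((hint x).sub (hint y)).abs hi.norm fun ω => ?_
        have h := hL.dist_le_mul (x ω) (y ω)
        rw [Real.dist_eq, dist_eq_norm] at h
        exact h.trans (mul_le_of_le_one_left (norm_nonneg _) hL1)
    _ = (eLpNorm (fun ω => x ω - y ω) 1 P).toReal := by
        rw [integral_norm_eq_lintegral_enorm hi.aestronglyMeasurable, eLpNorm_one_eq_lintegral_enorm]
    _ ≤ (eLpNorm (fun ω => x ω - y ω) 2 P).toReal :=
        ENNReal.toReal_mono hmem.eLpNorm_ne_top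
          (eLpNorm_le_eLpNorm_of_exponent_le (by norm_num) hmem.aestronglyMeasurable)
    _ = dist x y := by
        rw [Lp.dist_def]
        rfl

/-- The curve `t ↦ law of φ t` in the space of probability measures. A property of `φ`
in distribution is that property of this curve. -/
def lawCurve (φ : ℝ →ᵇ Lp E 2 P) : C(ℝ, Prob E) where
  toFun t := law (φ t)
  continuous_toFun := by
    have h : LipschitzWith 1 (law : Lp E 2 P → Prob E) :=
      LipschitzWith.of_dist_le_mul fun x y => by simpa using dist_law_le x y
    exact h.continuous.comp φ.continuous

end BL

/-! ## Fractional Brownian motion and the Wiener integral -/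

namespace FBM

variable {Ω : Type*} [MeasurableSpace Ω]

/-- A two-sided one-dimensional fractional Brownian motion with Hurst parameter `h`. -/
structure IsFBM (P : Measure Ω) (h : ℝ) (β : ℝ → Ω → ℝ) : Prop where
  measurable : ∀ t, Measurable (β t)
  continuous_paths : ∀ᵐ ω ∂P, Continuous fun t => β t ω
  gaussian : IsGaussianProcess β P
  centered : ∀ t, ∫ ω, β t ω ∂P = 0
  covariance : ∀ t s, ∫ ω, β t ω * β s ω ∂P =
    1 / 2 * (|t| ^ (2 * h) + |s| ^ (2 * h) - |t - s| ^ (2 * h))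

/-- An `E`-valued step function on `[a, b]`: partition points `a = t 0 ≤ ⋯ ≤ t n = b` and the
value `x i` on `(t i, t (i + 1)]`. -/
structure Step (E : Type*) (a b : ℝ) where
  n : ℕ
  t : ℕ → ℝ
  mono : Monotone t
  left : t 0 = a
  right : t n = b
  x : ℕ → E

variable {E : Type*} [NormedAddCommGroup E] [NormedSpace ℝ E] {a b : ℝ}

/-- The step function as a function. -/
def Step.toFun (ψ : Step E a b) (s : ℝ) : E :=
  ∑ i ∈ Finset.range ψ.n, (Set.Ioc (ψ.t i) (ψ.t (i + 1))).indicator (fun _ => ψ.x i) s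

/-- The Wiener integral `∑ (β (t (i + 1)) - β (t i)) • x i` of a step function. -/
def Step.integral (ψ : Step E a b) (β : ℝ → Ω → ℝ) (ω : Ω) : E :=
  ∑ i ∈ Finset.range ψ.n, (β (ψ.t (i + 1)) ω - β (ψ.t i) ω) • ψ.x i

/-- `y` is the Wiener integral `∫_a^b φ dβ` of `φ ∈ L^{1/h}([a, b]; E)` against the fractional
Brownian motion `β` with Hurst parameter `h > 1/2`: the `L²(P, E)`-limit of the integrals of step
functions that approximate `φ` in `L^{1/h}([a, b]; E)`. -/
def IsWienerIntegral (P : Measure Ω) (h : ℝ) (β : ℝ → Ω → ℝ) (φ : ℝ → E) (a b : ℝ)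
    (y : Lp E 2 P) : Prop :=
  ∃ ψ : ℕ → Step E a b,
    Tendsto (fun k => eLpNorm (fun s => (ψ k).toFun s - φ s) (ENNReal.ofReal (1 / h))
      (volume.restrict (Set.Icc a b))) atTop (𝓝 0) ∧
    Tendsto (fun k => eLpNorm (fun ω => (ψ k).integral β ω - y ω) 2 P) atTop (𝓝 0)

variable {ι U : Type*} [NormedAddCommGroup U] [InnerProductSpace ℝ U]

/-- The vector `Q^{1/2} e_n`, where `Q e_n = σ n • e_n` for the orthonormal basis `e`. -/
def sqrtQ (e : HilbertBasis ι ℝ U) (σ : ι → ℝ) (n : ι) : U := √(σ n) • e n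

/-- The space `L⁰_Q(U, E)` of the bounded operators `ξ` for which `ξ Q^{1/2}` is
Hilbert–Schmidt. -/
structure LQ0 (e : HilbertBasis ι ℝ U) (σ : ι → ℝ) (E : Type*) [NormedAddCommGroup E]
    [NormedSpace ℝ E] where
  op : U →L[ℝ] E
  mem : Memℓp (fun n => op (sqrtQ e σ n)) 2

/-- The family `(ξ Q^{1/2} e_n)_n`. It represents the Hilbert–Schmidt operator `ξ Q^{1/2}`, whose
Hilbert–Schmidt norm is its `ℓ²` norm. -/
def LQ0.hs {e : HilbertBasis ι ℝ U} {σ : ι → ℝ} (ξ : LQ0 e σ E) : lp (fun _ : ι => E) 2 :=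
  ⟨fun n => ξ.op (sqrtQ e σ n), ξ.mem⟩

/-- The distance `|ξ - η|_{L⁰_Q} = ‖(ξ - η) Q^{1/2}‖_HS`. -/
instance (e : HilbertBasis ι ℝ U) (σ : ι → ℝ) : PseudoMetricSpace (LQ0 e σ E) :=
  PseudoMetricSpace.induced LQ0.hs inferInstance

/-- The pair `(f, g)` as one continuous function. The values of `g` are regarded as elements of
the Hilbert space of Hilbert–Schmidt operators, in which `L⁰_Q(U, E)` lies isometrically. -/
def joint {P : Measure Ω} {e : HilbertBasis ι ℝ U} {σ : ι → ℝ}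
    (f : ℝ →ᵇ Lp E 2 P) (g : ℝ →ᵇ LQ0 e σ E) : C(ℝ, Lp E 2 P × lp (fun _ : ι => E) 2) where
  toFun t := (f t, (g t).hs)
  continuous_toFun :=
    f.continuous.prodMk (continuous_induced_dom.comp g.continuous)

/-- `ℱ_t = σ {B_Q(s) : s ≤ t}`, generated by the coordinates `√(σ n) β_n(s)`, `s ≤ t`, of `B_Q`,
for every real `t`. -/
@[reducible] def filt (σ : ι → ℝ) (β : ι → ℝ → Ω → ℝ) (t : ℝ) : MeasurableSpace Ω :=
  ⨆ (n : ι) (s : ℝ) (_ : s ≤ t),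
    MeasurableSpace.comap (fun ω => √(σ n) * β n s ω) inferInstance

/-- `x t` is, up to a null set, `ℱ_t`-measurable for every `t`. -/
def IsAdapted {P : Measure Ω} (σ : ι → ℝ) (β : ι → ℝ → Ω → ℝ) (x : ℝ → Lp E 2 P) : Prop :=
  ∀ t, AEStronglyMeasurable[filt σ β t] (x t) P

/-- `y = ∫_a^b Φ(s) dB_Q(s) = ∑_n ∫_a^b Φ(s) Q^{1/2} e_n dβ_n(s)`, the series converging in
`L²(P, E)`. -/
def IsStochIntegral (P : Measure Ω) (h : ℝ) (e : HilbertBasis ι ℝ U) (σ : ι → ℝ)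
    (β : ι → ℝ → Ω → ℝ) (Φ : ℝ → U →L[ℝ] E) (a b : ℝ) (y : Lp E 2 P) : Prop :=
  ∃ I : ι → Lp E 2 P,
    (∀ n, IsWienerIntegral P h (β n) (fun s => Φ s (sqrtQ e σ n)) a b (I n)) ∧ HasSum I y

end FBM

/-! ## Semigroups and mild solutions -/

namespace Evol

variable {E : Type*} [NormedAddCommGroup E] [NormedSpace ℝ E]

/-- `(S t)_{t ≥ 0}` is a `C₀`-semigroup; the values `S t` for `t < 0` are irrelevant. -/
structure IsC0Semigroup (S : ℝ → E →L[ℝ] E) : Prop where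
  zero : S 0 = ContinuousLinearMap.id ℝ E
  add : ∀ s t : ℝ, 0 ≤ s → 0 ≤ t → S (s + t) = (S s).comp (S t)
  strong : ∀ x : E, Tendsto (fun t => S t x) (𝓝[>] 0) (𝓝 x)

/-- The (unbounded) operator `A` is the infinitesimal generator of `S`. -/
def IsGenerator (A : E →ₗ.[ℝ] E) (S : ℝ → E →L[ℝ] E) : Prop :=
  ∀ x y : E, (x, y) ∈ A.graph ↔
    Tendsto (fun t : ℝ => t⁻¹ • (S t x - x)) (𝓝[>] 0) (𝓝 y)

def IsExponentiallyStable (S : ℝ → E →L[ℝ] E) : Prop :=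
  ∃ N α : ℝ, 0 < N ∧ 0 < α ∧ ∀ t : ℝ, 0 ≤ t → ‖S t‖ ≤ N * Real.exp (-α * t)

variable {Ω : Type*} [MeasurableSpace Ω] {P : Measure Ω}
  {ι U : Type*} [NormedAddCommGroup U] [InnerProductSpace ℝ U]

/-- `x` is a mild solution on `ℝ` of `dX = (A X + f(t)) dt + g(t) dB_Q(t)`, `A` generating `S`.
The operators `S t` act on `L²(P, E)` pointwise in `ω`; the `dt` integral is a Bochner integral
in `L²(P, E)`. -/
def IsMildSolution (h : ℝ) (e : HilbertBasis ι ℝ U) (σ : ι → ℝ) (β : ι → ℝ → Ω → ℝ)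
    (S : ℝ → E →L[ℝ] E) (f : ℝ →ᵇ Lp E 2 P) (g : ℝ →ᵇ FBM.LQ0 e σ E)
    (x : ℝ → Lp E 2 P) : Prop :=
  FBM.IsAdapted σ β x ∧
    ∀ t₀ t : ℝ, t₀ ≤ t → ∃ y : Lp E 2 P,
      FBM.IsStochIntegral P h e σ β (fun s => (S (t - s)).comp (g s).op) t₀ t y ∧
      x t = (S (t - t₀)).compLp (x t₀) + (∫ s in t₀..t, (S (t - s)).compLp (f s)) + y

end Evol

end

/-! Existence, uniqueness and stability are Hilbert space facts that use only the covariance. A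
noise is a family of operators `B t` with `⟪B s x, B t y⟫ = cov h s t * ⟪x, y⟫` (`FBM.IsNoise`). For
`h > 1/2` its increments are non-negatively correlated (`FBM.incCov_nonneg`), so the increments over
a partition of `[a, b]`, applied to vectors of norm at most `M`, sum to a vector of norm at most `(b
- a) ^ h * M` (`FBM.IsNoise.norm_sum_le`). Hence Riemann sums of continuous integrands converge.
Exponential stability then gives the bounded solution as a series over the unit intervals of the
past (`Evol.sol`), shows that it is the only bounded one, and makes its value at `t` depend, up to
`ε`, only on the coefficients in a window `[t - K, t]` (`Evol.IsSystem.exists_window`).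

Non-random drift. Translating time by `τ` translates the coefficients and replaces the noise by its
increments from `τ` on (`Evol.sol_shift`). If `f` is non-random, the solution is a constant plus a
Gaussian vector, whose law is fixed by the variances of its coordinates; as the increments are
stationary, restarting the noise does not change the law (`FBM.IsCylindrical.law_sol_shift`). So the
translated and the original coefficients may be compared under one and the same noise, and the law
curve is `Recur.Dominated` by `(f, g)`. Domination transfers every property that is expressed
through periods, almost periods or shifts. For quasi-periodicity the torus function is the law at
time `0` as a function of the phase.

Random drift. In general `f` is only adapted, and restarting the noise changes its joint law with
`f`. But apart from Lagrange stability, window pseudo-recurrence and the trivial period `0`, each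
property makes `f t` a limit of values `f (t + τ)` with `τ → -∞` (`Recur.ReturnsInPast`), so `f t`
is measurable with respect to the remote past of the noise. The Mandelbrot–van Ness kernel shows
that the remote past is almost orthogonal to every value of the noise (`FBM.exists_abs_inner_le`).
In a Gaussian space orthogonality is independence, so a variable of the remote past is independent
of the noise, hence of itself, hence constant (`FBM.IsFamily.exists_ae_eq_const`). Thus `f` is
non-random after all.

Lagrange stability does not exclude a random drift and needs its own argument. Along shifts `τ → ±∞`
with coefficients converging to `q`, the solution is close to `F t + V τ (Z t)`: here `F` comes from
the drift of `q`, and `V τ` maps the noise to its restart at `τ`. Correlations with far increments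
vanish because `2 * h < 2`, so the two summands become independent and the laws converge
(`FBM.IsCylindrical.tendsto_dist_law`). -/

open scoped RealInnerProductSpace

set_option linter.unusedSectionVars false

/-! ## Integration of continuous functions against an operator-valued fractional noise -/

namespace FBM

/-- The covariance of the fractional Brownian motion. -/
noncomputable def cov (h s t : ℝ) : ℝ :=
  1 / 2 * (|s| ^ (2 * h) + |t| ^ (2 * h) - |s - t| ^ (2 * h))

/-- The covariance of the increments over `[c, d]` and `[c', d']`. -/
noncomputable def incCov (h c d c' d' : ℝ) : ℝ :=
  cov h d d' - cov h d c' - cov h c d' + cov h c c'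

theorem incCov_eq (h c d c' d' : ℝ) :
    incCov h c d c' d' = 1 / 2 * (|d - c'| ^ (2 * h) + |c - d'| ^ (2 * h)
      - |d - d'| ^ (2 * h) - |c - c'| ^ (2 * h)) := by
  simp only [incCov, cov]
  ring

theorem incCov_self {h a b : ℝ} (hh : 1 / 2 < h) (hab : a ≤ b) :
    incCov h a b a b = (b - a) ^ (2 * h) := by
  rw [incCov_eq, sub_self, sub_self, abs_zero, Real.zero_rpow (by linarith), abs_sub_comm a b,
    abs_of_nonneg (sub_nonneg.2 hab)]
  ring

theorem convexOn_abs_rpow {p : ℝ} (hp : 1 ≤ p) : ConvexOn ℝ Set.univ fun x : ℝ => |x| ^ p := by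
  have h1 : ConvexOn ℝ Set.univ fun x : ℝ => |x| := convexOn_norm convex_univ
  refine ⟨convex_univ, fun x _ y _ a b ha hb hab => ?_⟩
  have h2 := h1.2 (Set.mem_univ x) (Set.mem_univ y) ha hb hab
  have h3 := (convexOn_rpow hp).2 (abs_nonneg x) (abs_nonneg y) ha hb hab
  exact (Real.rpow_le_rpow (abs_nonneg _) h2 (by linarith)).trans h3

/-- Convexity of `|x| ^ (2 * h)`: the numbers `d - d'` and `c - c'` lie between `c - d'` and `d -
c'` and have the same sum as these two. This is where `h > 1/2` makes the noise tractable. -/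
theorem incCov_nonneg {h c d c' d' : ℝ} (hh : 1 / 2 < h) (h1 : c ≤ d) (h2 : c' ≤ d') :
    0 ≤ incCov h c d c' d' := by
  have hconv := convexOn_abs_rpow (p := 2 * h) (by linarith)
  rw [incCov_eq]
  set p := d - c'
  set q := c - d'
  rcases eq_or_lt_of_le (show q ≤ p by simp only [p, q]; linarith) with hpq | hpq
  · have e1 : d - d' = p := by simp only [p, q] at *; linarith
    have e2 : c - c' = q := by simp only [p, q] at *; linarith
    rw [e1, e2, hpq]
    simp
  -- The weight that writes `d - d'` as a convex combination of `p` and `q`; by equality of the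
  -- sums, `c - c'` has the mirrored weights.
  · set l := (d - d' - q) / (p - q)
    have hl0 : 0 ≤ l := div_nonneg (by simp only [q]; linarith) (by linarith)
    have hl1 : l ≤ 1 := by
      rw [div_le_one (by linarith)]
      simp only [p]
      linarith
    have hlq : l * (p - q) = d - d' - q := div_mul_cancel₀ _ (by linarith)
    have e1 : d - d' = l * p + (1 - l) * q := by linarith
    have e2 : c - c' = (1 - l) * p + l * q := by
      have : c - c' = p + q - (d - d') := by simp only [p, q]; ring
      rw [this, e1]
      ring
    have i1 := hconv.2 (Set.mem_univ p) (Set.mem_univ q) hl0 (sub_nonneg.2 hl1) (by ring)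
    have i2 := hconv.2 (Set.mem_univ p) (Set.mem_univ q) (sub_nonneg.2 hl1) hl0 (by ring)
    simp only [smul_eq_mul] at i1 i2
    rw [← e1] at i1
    rw [← e2] at i2
    linarith

variable {𝓗 𝓛 : Type*} [NormedAddCommGroup 𝓗] [InnerProductSpace ℝ 𝓗]
  [NormedAddCommGroup 𝓛] [InnerProductSpace ℝ 𝓛]

/-- An operator-valued process with the covariance structure of a fractional Brownian motion. -/
def IsNoise (h : ℝ) (B : ℝ → 𝓗 →L[ℝ] 𝓛) : Prop :=
  ∀ s t x y, ⟪B s x, B t y⟫ = cov h s t * ⟪x, y⟫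

theorem IsNoise.inner_inc {h : ℝ} {B : ℝ → 𝓗 →L[ℝ] 𝓛} (hB : IsNoise h B) (c d c' d' : ℝ)
    (x y : 𝓗) : ⟪(B d - B c) x, (B d' - B c') y⟫ = incCov h c d c' d' * ⟪x, y⟫ := by
  simp only [sub_apply, inner_sub_left, inner_sub_right]
  rw [hB, hB, hB, hB, incCov]
  ring

/-- The noise seen from time `τ` on. -/
def shiftNoise (B : ℝ → 𝓗 →L[ℝ] 𝓛) (τ t : ℝ) : 𝓗 →L[ℝ] 𝓛 := B (t + τ) - B τ

theorem IsNoise.shift {h : ℝ} (hh : 1 / 2 < h) {B : ℝ → 𝓗 →L[ℝ] 𝓛} (hB : IsNoise h B) (τ : ℝ) :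
    IsNoise h (shiftNoise B τ) := by
  intro s t x y
  rw [shiftNoise, shiftNoise, hB.inner_inc, incCov_eq, cov]
  have : |τ - τ| ^ (2 * h) = 0 := by
    rw [sub_self, abs_zero, Real.zero_rpow (by linarith)]
  rw [this, show τ - (t + τ) = -t by ring, abs_neg]
  simp only [add_sub_cancel_right, add_sub_add_right_eq_sub, sub_zero]

/-- Expand the square: covariances of increments are non-negative, so each `⟪z k, z l⟫` may be
replaced by `M ^ 2`, and the covariances add up to the variance of the increment over `[a, b]`. The
tiling enters only through telescoping (`htile`), so that the common refinement of two partitions,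
indexed by pairs, also qualifies. Degenerate cells carry no condition on `z`, since their increment
vanishes. -/
theorem IsNoise.norm_sum_le {h : ℝ} (hh : 1 / 2 < h) {B : ℝ → 𝓗 →L[ℝ] 𝓛} (hB : IsNoise h B)
    {a b : ℝ} (hab : a ≤ b) {κ : Type*} (K : Finset κ) (c d : κ → ℝ) (hcd : ∀ k ∈ K, c k ≤ d k)
    (htile : ∀ φ : ℝ → ℝ, ∑ k ∈ K, (φ (d k) - φ (c k)) = φ b - φ a) (z : κ → 𝓗) {M : ℝ}
    (hM0 : 0 ≤ M) (hM : ∀ k ∈ K, c k < d k → ‖z k‖ ≤ M) :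
    ‖∑ k ∈ K, (B (d k) - B (c k)) (z k)‖ ≤ (b - a) ^ h * M := by
  have hsq : ‖∑ k ∈ K, (B (d k) - B (c k)) (z k)‖ ^ 2 ≤ ((b - a) ^ h * M) ^ 2 := by
    -- Telescope twice, once in each argument of the covariance.
    have htot : ∑ k ∈ K, ∑ l ∈ K, incCov h (c k) (d k) (c l) (d l) = (b - a) ^ (2 * h) := by
      rw [← incCov_self hh hab]
      have h1 : ∀ k, ∑ l ∈ K, incCov h (c k) (d k) (c l) (d l)
          = incCov h (c k) (d k) a b := by
        intro k
        have e1 := htile (fun t => cov h (d k) t - cov h (c k) t)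
        have e2 : ∀ l, incCov h (c k) (d k) (c l) (d l) = (cov h (d k) (d l) - cov h (c k) (d l))
            - (cov h (d k) (c l) - cov h (c k) (c l)) := fun l => by rw [incCov]; ring
        simp only [e2, e1]
        rw [incCov]; ring
      have e1 := htile (fun t => cov h t b - cov h t a)
      have e2 : ∀ k, incCov h (c k) (d k) a b = (cov h (d k) b - cov h (d k) a)
          - (cov h (c k) b - cov h (c k) a) := fun k => by rw [incCov]; ring
      simp only [h1, e2, e1]
      rw [incCov]; ring
    have hpow : ((b - a) ^ h * M) ^ 2 = (b - a) ^ (2 * h) * M ^ 2 := by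
      rw [mul_pow, ← Real.rpow_natCast ((b - a) ^ h), ← Real.rpow_mul (sub_nonneg.2 hab)]
      push_cast
      rw [mul_comm h 2]
    rw [hpow, ← htot, ← real_inner_self_eq_norm_sq, sum_inner, Finset.sum_mul]
    refine Finset.sum_le_sum fun k hk => ?_
    rw [inner_sum, Finset.sum_mul]
    refine Finset.sum_le_sum fun l hl => ?_
    rw [hB.inner_inc]
    rcases (hcd k hk).eq_or_lt with e | e
    · rw [← e]
      simp [incCov]
    rcases (hcd l hl).eq_or_lt with e' | e'
    · rw [← e']
      simp [incCov]
    refine mul_le_mul_of_nonneg_left ?_ (incCov_nonneg hh e.le e'.le)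
    calc ⟪z k, z l⟫ ≤ ‖z k‖ * ‖z l‖ := real_inner_le_norm _ _
      _ ≤ M * M := mul_le_mul (hM k hk e) (hM l hl e') (norm_nonneg _) hM0
      _ = M ^ 2 := by ring
  exact le_of_sq_le_sq hsq (mul_nonneg (Real.rpow_nonneg (sub_nonneg.2 hab) _) hM0)

/-- A partition of `[a, b]` into `n` intervals. -/
structure IsPart (a b : ℝ) (n : ℕ) (s : ℕ → ℝ) : Prop where
  mono : Monotone s
  left : s 0 = a
  right : s n = b

theorem IsPart.le {a b : ℝ} {n : ℕ} {s : ℕ → ℝ} (hs : IsPart a b n s) : a ≤ b := by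
  rw [← hs.left, ← hs.right]
  exact hs.mono (Nat.zero_le _)

theorem IsPart.mem {a b : ℝ} {n : ℕ} {s : ℕ → ℝ} (hs : IsPart a b n s) {i : ℕ} (hi : i ≤ n) :
    s i ∈ Set.Icc a b := by
  rw [← hs.left, ← hs.right]
  exact ⟨hs.mono (Nat.zero_le _), hs.mono hi⟩

/-- The left Riemann sum `∑ (B (s (i + 1)) - B (s i)) (Φ (s i))`. -/
def rsum (B : ℝ → 𝓗 →L[ℝ] 𝓛) (Φ : ℝ → 𝓗) (s : ℕ → ℝ) (n : ℕ) : 𝓛 :=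
  ∑ i ∈ Finset.range n, (B (s (i + 1)) - B (s i)) (Φ (s i))

theorem IsPart.sum_eq {G : Type*} [AddCommGroup G] {a b : ℝ} {n : ℕ} {s : ℕ → ℝ}
    (hs : IsPart a b n s) (φ : ℝ → G) :
    ∑ i ∈ Finset.range n, (φ (s (i + 1)) - φ (s i)) = φ b - φ a := by
  rw [Finset.sum_range_sub (fun i => φ (s i)), hs.left, hs.right]

/-- The point of `[lo, hi]` nearest to `x`. -/
noncomputable def clamp (lo hi x : ℝ) : ℝ := max lo (min x hi)

/-- The clamped points `clamp lo hi (t j)` form the trace of the partition `t` on `[lo, hi]`. -/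
theorem sum_clamp_right {G : Type*} [AddCommGroup G] {a b : ℝ} {m : ℕ} {t : ℕ → ℝ}
    (ht : IsPart a b m t) {lo hi : ℝ} (h1 : a ≤ lo) (h2 : lo ≤ hi) (h3 : hi ≤ b) (φ : ℝ → G) :
    ∑ j ∈ Finset.range m, (φ (clamp lo hi (t (j + 1))) - φ (clamp lo hi (t j)))
      = φ hi - φ lo := by
  rw [Finset.sum_range_sub (fun j => φ (clamp lo hi (t j))), ht.left, ht.right, clamp, clamp,
    min_eq_right h3, max_eq_right h2, max_eq_left ((min_le_left _ _).trans h1)]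

/-- In this form the dependence on `x` is a difference between the two ends `hi` and `lo`, so that
sums over consecutive intervals `[lo, hi]` telescope. -/
theorem apply_clamp {G : Type*} [AddCommGroup G] {lo hi : ℝ} (h : lo ≤ hi) (x : ℝ) (φ : ℝ → G) :
    φ (clamp lo hi x) = φ (min x hi) - φ (min x lo) + φ lo := by
  rcases le_total x lo with h1 | h1
  · rw [clamp, min_eq_left (h1.trans h), max_eq_left h1, min_eq_left h1]
    abel
  · rw [clamp, min_eq_right h1, max_eq_right (le_min h1 h)]
    abel

theorem sum_clamp_left {G : Type*} [AddCommGroup G] {a b : ℝ} {n : ℕ} {s : ℕ → ℝ}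
    (hs : IsPart a b n s) {x y : ℝ} (hx : x ∈ Set.Icc a b) (hy : y ∈ Set.Icc a b) (φ : ℝ → G) :
    ∑ i ∈ Finset.range n, (φ (clamp (s i) (s (i + 1)) y) - φ (clamp (s i) (s (i + 1)) x))
      = φ y - φ x := by
  have key : ∀ i, φ (clamp (s i) (s (i + 1)) y) - φ (clamp (s i) (s (i + 1)) x)
      = (φ (min y (s (i + 1))) - φ (min y (s i))) - (φ (min x (s (i + 1))) - φ (min x (s i))) := by
    intro i
    rw [apply_clamp (hs.mono (Nat.le_succ i)) y φ, apply_clamp (hs.mono (Nat.le_succ i)) x φ]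
    abel
  simp only [key, Finset.sum_sub_distrib]
  rw [← Finset.sum_sub_distrib, ← Finset.sum_sub_distrib,
    hs.sum_eq (fun z => φ (min y z)), hs.sum_eq (fun z => φ (min x z)), min_eq_left hy.2,
    min_eq_left hx.2, min_eq_right hy.1, min_eq_right hx.1]
  abel

theorem IsNoise.norm_rsum_le {h : ℝ} (hh : 1 / 2 < h) {B : ℝ → 𝓗 →L[ℝ] 𝓛} (hB : IsNoise h B)
    {a b : ℝ} {n : ℕ} {s : ℕ → ℝ} (hs : IsPart a b n s) {Φ : ℝ → 𝓗} {M : ℝ} (hM0 : 0 ≤ M)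
    (hM : ∀ x ∈ Set.Icc a b, ‖Φ x‖ ≤ M) : ‖rsum B Φ s n‖ ≤ (b - a) ^ h * M :=
  hB.norm_sum_le hh hs.le (Finset.range n) (fun i => s i) (fun i => s (i + 1))
    (fun i _ => hs.mono (Nat.le_succ i)) (fun φ => hs.sum_eq φ) (fun i => Φ (s i)) hM0
    fun _ hi _ => hM _ (hs.mem (Finset.mem_range.1 hi).le)

/-- Both sums are rewritten over the cells `[s i, s (i + 1)] ∩ [t j, t (j + 1)]` of the common
refinement, disjoint pairs giving degenerate cells. Then they differ only in the points at which `Φ`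
is evaluated, and on a non-degenerate cell these points are within `δ` of each other. -/
theorem IsNoise.norm_rsum_sub_le {h : ℝ} (hh : 1 / 2 < h) {B : ℝ → 𝓗 →L[ℝ] 𝓛} (hB : IsNoise h B)
    {a b : ℝ} {n m : ℕ} {s t : ℕ → ℝ} (hs : IsPart a b n s) (ht : IsPart a b m t) {Φ : ℝ → 𝓗}
    {δ ε : ℝ} (hε : 0 ≤ ε) (hsδ : ∀ i < n, s (i + 1) - s i ≤ δ) (htδ : ∀ j < m, t (j + 1) - t j ≤ δ)
    (hΦ : ∀ x ∈ Set.Icc a b, ∀ y ∈ Set.Icc a b, |x - y| ≤ δ → ‖Φ x - Φ y‖ ≤ ε) :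
    ‖rsum B Φ s n - rsum B Φ t m‖ ≤ (b - a) ^ h * ε := by
  set K := Finset.range n ×ˢ Finset.range m
  set c : ℕ × ℕ → ℝ := fun k => clamp (s k.1) (s (k.1 + 1)) (t k.2)
  set d : ℕ × ℕ → ℝ := fun k => clamp (s k.1) (s (k.1 + 1)) (t (k.2 + 1))
  have e1 : ∀ φ : ℝ → 𝓗 →L[ℝ] 𝓛, ∀ x : ℕ × ℕ → 𝓗, ∑ k ∈ K, (φ (d k) - φ (c k)) (x k) =
      ∑ i ∈ Finset.range n, ∑ j ∈ Finset.range m, (φ (d (i, j)) - φ (c (i, j))) (x (i, j)) :=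
    fun φ x => Finset.sum_product _ _ _
  have hS : ∑ k ∈ K, (B (d k) - B (c k)) (Φ (s k.1)) = rsum B Φ s n := by
    rw [e1, rsum]
    refine Finset.sum_congr rfl fun i hi => ?_
    have hi := Finset.mem_range.1 hi
    rw [← sum_clamp_right ht (hs.mem hi.le).1 (hs.mono (Nat.le_succ i)) (hs.mem hi).2 B,
      sum_apply]
  have hT : ∑ k ∈ K, (B (d k) - B (c k)) (Φ (t k.2)) = rsum B Φ t m := by
    rw [e1, rsum, Finset.sum_comm]
    refine Finset.sum_congr rfl fun j hj => ?_
    have hj := Finset.mem_range.1 hj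
    rw [← sum_clamp_left hs (ht.mem hj.le) (ht.mem hj) B, sum_apply]
  rw [← hS, ← hT, ← Finset.sum_sub_distrib]
  simp only [← map_sub]
  refine hB.norm_sum_le hh hs.le K c d ?_ ?_ _ hε ?_
  · intro k _
    exact max_le_max le_rfl (min_le_min_right _ (ht.mono (Nat.le_succ _)))
  · intro φ
    rw [Finset.sum_product]
    refine Eq.trans (Finset.sum_congr rfl fun i hi => ?_) (hs.sum_eq φ)
    have hi := Finset.mem_range.1 hi
    exact sum_clamp_right ht (hs.mem hi.le).1 (hs.mono (Nat.le_succ i)) (hs.mem hi).2 φ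
  · intro k hk hcd
    have hk := Finset.mem_product.1 hk
    have hi := Finset.mem_range.1 hk.1
    have hj := Finset.mem_range.1 hk.2
    refine hΦ _ (hs.mem hi.le) _ (ht.mem hj.le) ?_
    -- A non-degenerate cell forces the two intervals to overlap; otherwise both clamped ends
    -- coincide.
    have i1 : t k.2 < s (k.1 + 1) := by
      by_contra! hcon
      have h2 : s (k.1 + 1) ≤ t (k.2 + 1) := hcon.trans (ht.mono (Nat.le_succ _))
      simp only [c, d, clamp, min_eq_right hcon, min_eq_right h2] at hcd
      exact lt_irrefl _ hcd
    have i2 : s k.1 < t (k.2 + 1) := by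
      by_contra! hcon
      have h2 : t k.2 ≤ s k.1 := (ht.mono (Nat.le_succ _)).trans hcon
      simp only [c, d, clamp, max_eq_left ((min_le_left _ _).trans hcon),
        max_eq_left ((min_le_left _ _).trans h2)] at hcd
      exact lt_irrefl _ hcd
    have i3 := hsδ _ hi
    have i4 := htδ _ hj
    rw [abs_le]
    constructor <;> linarith

/-- The partition of `[a, b]` into `n` intervals of equal length. -/
noncomputable def upart (a b : ℝ) (n i : ℕ) : ℝ := a + (min i n : ℕ) * ((b - a) / n)

theorem isPart_upart {a b : ℝ} (hab : a ≤ b) {n : ℕ} (hn : n ≠ 0) : IsPart a b n (upart a b n) where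
  mono i j hij := by
    have : (min i n : ℕ) ≤ (min j n : ℕ) := min_le_min_right n hij
    have h2 : ((min i n : ℕ) : ℝ) ≤ (min j n : ℕ) := by exact_mod_cast this
    have h3 : 0 ≤ (b - a) / n := div_nonneg (sub_nonneg.2 hab) (Nat.cast_nonneg n)
    simp only [upart]
    have := mul_le_mul_of_nonneg_right h2 h3
    linarith
  left := by simp [upart]
  right := by
    have : (n : ℝ) ≠ 0 := by exact_mod_cast hn
    simp only [upart, min_self]
    field_simp
    ring

theorem upart_mesh {a b : ℝ} (hab : a ≤ b) (n i : ℕ) :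
    upart a b n (i + 1) - upart a b n i ≤ (b - a) / n := by
  have h3 : 0 ≤ (b - a) / n := div_nonneg (sub_nonneg.2 hab) (Nat.cast_nonneg n)
  have h2 : ((min (i + 1) n : ℕ) : ℝ) - (min i n : ℕ) ≤ 1 := by
    have : min (i + 1) n ≤ min i n + 1 := by omega
    have : ((min (i + 1) n : ℕ) : ℝ) ≤ (min i n : ℕ) + 1 := by exact_mod_cast this
    linarith
  have := mul_le_mul_of_nonneg_right h2 h3
  simp only [upart]
  linarith

theorem upart_shift (a b τ : ℝ) (n i : ℕ) : upart (a + τ) (b + τ) n i = upart a b n i + τ := by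
  simp only [upart, add_sub_add_right_eq_sub]
  ring

/-- The integral `∫_a^b Φ dB`. -/
noncomputable def integral (B : ℝ → 𝓗 →L[ℝ] 𝓛) (Φ : ℝ → 𝓗) (a b : ℝ) : 𝓛 :=
  limUnder atTop fun n : ℕ => rsum B Φ (upart a b (n + 1)) (n + 1)

theorem eventually_mesh_le (a b : ℝ) {δ : ℝ} (hδ : 0 < δ) :
    ∀ᶠ n : ℕ in atTop, (b - a) / ((n + 1 : ℕ) : ℝ) ≤ δ := by
  have : Tendsto (fun n : ℕ => (b - a) / ((n + 1 : ℕ) : ℝ)) atTop (𝓝 0) :=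
    (tendsto_const_div_atTop_nhds_zero_nat (b - a)).comp (tendsto_add_atTop_nat 1)
  exact (this.eventually (gt_mem_nhds hδ)).mono fun _ => le_of_lt

theorem exists_modulus {E : Type*} [SeminormedAddCommGroup E] {Φ : ℝ → E} {a b : ℝ}
    (hΦ : ContinuousOn Φ (Set.Icc a b)) {ε : ℝ} (hε : 0 < ε) :
    ∃ δ > 0, ∀ x ∈ Set.Icc a b, ∀ y ∈ Set.Icc a b, |x - y| ≤ δ → ‖Φ x - Φ y‖ ≤ ε := by
  have hu := isCompact_Icc.uniformContinuousOn_of_continuous hΦ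
  obtain ⟨δ, hδ, H⟩ := Metric.uniformContinuousOn_iff.1 hu ε hε
  refine ⟨δ / 2, by linarith, fun x hx y hy hxy => ?_⟩
  rw [← dist_eq_norm]
  exact (H x hx y hy (by rw [Real.dist_eq]; linarith)).le

variable {h : ℝ} {B : ℝ → 𝓗 →L[ℝ] 𝓛} {Φ : ℝ → 𝓗} {a b : ℝ}

theorem IsNoise.tendsto_integral [CompleteSpace 𝓛] (hh : 1 / 2 < h) (hB : IsNoise h B)
    (hab : a ≤ b) (hΦ : ContinuousOn Φ (Set.Icc a b)) :
    Tendsto (fun n : ℕ => rsum B Φ (upart a b (n + 1)) (n + 1)) atTop (𝓝 (integral B Φ a b)) := by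
  refine tendsto_nhds_limUnder ?_
  refine cauchySeq_tendsto_of_complete (Metric.cauchySeq_iff.2 fun ε hε => ?_)
  have hC : 0 ≤ (b - a) ^ h := Real.rpow_nonneg (sub_nonneg.2 hab) _
  have hε' : 0 < ε / ((b - a) ^ h + 1) := by positivity
  obtain ⟨δ, hδ, H⟩ := exists_modulus hΦ hε'
  obtain ⟨N, hN⟩ := eventually_atTop.1 (eventually_mesh_le a b hδ)
  refine ⟨N, fun m hm n hn => ?_⟩
  rw [dist_eq_norm]
  refine (hB.norm_rsum_sub_le hh (isPart_upart hab (by omega)) (isPart_upart hab (by omega))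
    hε'.le (fun i _ => (upart_mesh hab _ i).trans (hN m hm))
    (fun i _ => (upart_mesh hab _ i).trans (hN n hn)) H).trans_lt ?_
  rw [mul_div_assoc', div_lt_iff₀ (by linarith)]
  linarith [mul_comm ε ((b - a) ^ h)]

theorem IsNoise.norm_rsum_sub_integral_le [CompleteSpace 𝓛] (hh : 1 / 2 < h) (hB : IsNoise h B)
    (hΦ : ContinuousOn Φ (Set.Icc a b)) {n : ℕ} {s : ℕ → ℝ} (hs : IsPart a b n s)
    {δ ε : ℝ} (hδ : 0 < δ) (hε : 0 ≤ ε) (hsδ : ∀ i < n, s (i + 1) - s i ≤ δ)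
    (H : ∀ x ∈ Set.Icc a b, ∀ y ∈ Set.Icc a b, |x - y| ≤ δ → ‖Φ x - Φ y‖ ≤ ε) :
    ‖rsum B Φ s n - integral B Φ a b‖ ≤ (b - a) ^ h * ε := by
  refine le_of_tendsto (((hB.tendsto_integral hh hs.le hΦ).const_sub _).norm) ?_
  filter_upwards [eventually_mesh_le a b hδ] with m hm
  exact hB.norm_rsum_sub_le hh hs (isPart_upart hs.le (by omega)) hε hsδ
    (fun i _ => (upart_mesh hs.le _ i).trans hm) H

theorem IsNoise.norm_integral_le [CompleteSpace 𝓛] (hh : 1 / 2 < h) (hB : IsNoise h B)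
    (hab : a ≤ b) (hΦ : ContinuousOn Φ (Set.Icc a b)) {M : ℝ} (hM0 : 0 ≤ M)
    (hM : ∀ x ∈ Set.Icc a b, ‖Φ x‖ ≤ M) : ‖integral B Φ a b‖ ≤ (b - a) ^ h * M :=
  le_of_tendsto (hB.tendsto_integral hh hab hΦ).norm
    (Eventually.of_forall fun _ => hB.norm_rsum_le hh (isPart_upart hab (by omega)) hM0 hM)

theorem rsum_congr {Ψ : ℝ → 𝓗} {n : ℕ} {s : ℕ → ℝ} (hs : IsPart a b n s)
    (hΦ : Set.EqOn Φ Ψ (Set.Icc a b)) : rsum B Φ s n = rsum B Ψ s n :=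
  Finset.sum_congr rfl fun i hi => by rw [hΦ (hs.mem (Finset.mem_range.1 hi).le)]

theorem integral_congr {Ψ : ℝ → 𝓗} (hab : a ≤ b) (hΦ : Set.EqOn Φ Ψ (Set.Icc a b)) :
    integral B Φ a b = integral B Ψ a b := by
  have : ∀ n : ℕ, rsum B Φ (upart a b (n + 1)) (n + 1) = rsum B Ψ (upart a b (n + 1)) (n + 1) :=
    fun n => rsum_congr (isPart_upart hab (by omega)) hΦ
  simp only [integral, this]

theorem IsNoise.integral_add [CompleteSpace 𝓛] (hh : 1 / 2 < h) (hB : IsNoise h B) (hab : a ≤ b)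
    (hΦ : ContinuousOn Φ (Set.Icc a b)) {Ψ : ℝ → 𝓗} (hΨ : ContinuousOn Ψ (Set.Icc a b)) :
    integral B (fun s => Φ s + Ψ s) a b = integral B Φ a b + integral B Ψ a b := by
  refine tendsto_nhds_unique (hB.tendsto_integral hh hab (hΦ.add hΨ)) ?_
  have := (hB.tendsto_integral hh hab hΦ).add (hB.tendsto_integral hh hab hΨ)
  refine this.congr fun n => ?_
  simp only [rsum, ← Finset.sum_add_distrib, map_add]

/-- Integration commutes with a pair of operators intertwining two noises. -/
theorem IsNoise.map_integral {𝓗' 𝓛' : Type*} [NormedAddCommGroup 𝓗'] [InnerProductSpace ℝ 𝓗']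
    [NormedAddCommGroup 𝓛'] [InnerProductSpace ℝ 𝓛'] [CompleteSpace 𝓛] [CompleteSpace 𝓛']
    (hh : 1 / 2 < h) (hB : IsNoise h B) {B' : ℝ → 𝓗' →L[ℝ] 𝓛'} (hB' : IsNoise h B')
    (V : 𝓗 →L[ℝ] 𝓗') (W : 𝓛 →L[ℝ] 𝓛') (hVW : ∀ t x, W (B t x) = B' t (V x)) (hab : a ≤ b)
    (hΦ : ContinuousOn Φ (Set.Icc a b)) :
    W (integral B Φ a b) = integral B' (fun s => V (Φ s)) a b := by
  refine tendsto_nhds_unique ((W.continuous.tendsto _).comp (hB.tendsto_integral hh hab hΦ)) ?_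
  refine (hB'.tendsto_integral hh hab (V.continuous.comp_continuousOn hΦ)).congr fun n => ?_
  simp only [rsum, Function.comp_apply, map_sum, sub_apply, map_sub, hVW]

theorem IsNoise.integral_mem [CompleteSpace 𝓛] (hh : 1 / 2 < h) (hB : IsNoise h B) (hab : a ≤ b)
    (hΦ : ContinuousOn Φ (Set.Icc a b)) {W : Submodule ℝ 𝓛} (hW : IsClosed (W : Set 𝓛))
    (hmem : ∀ s ∈ Set.Icc a b, ∀ r ∈ Set.Icc a b, B s (Φ r) ∈ W) : integral B Φ a b ∈ W := by
  refine hW.mem_of_tendsto (hB.tendsto_integral hh hab hΦ) (Eventually.of_forall fun n => ?_)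
  have hp := isPart_upart hab (n := n + 1) (by omega)
  refine W.sum_mem fun i hi => ?_
  have hi := Finset.mem_range.1 hi
  rw [sub_apply]
  exact W.sub_mem (hmem _ (hp.mem hi) _ (hp.mem hi.le)) (hmem _ (hp.mem hi.le) _ (hp.mem hi.le))

theorem integral_shift (τ : ℝ) : integral B Φ (a + τ) (b + τ)
    = integral (shiftNoise B τ) (fun s => Φ (s + τ)) a b := by
  have : ∀ n : ℕ, rsum B Φ (upart (a + τ) (b + τ) (n + 1)) (n + 1)
      = rsum (shiftNoise B τ) (fun s => Φ (s + τ)) (upart a b (n + 1)) (n + 1) := fun n => by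
    simp only [rsum, upart_shift, shiftNoise, sub_sub_sub_cancel_right]
  simp only [integral, this]

/-- The uniform partitions of `[a, b]` and `[b, c]`, put one after the other, form a partition of
`[a, c]` that is not uniform; its Riemann sums still converge to the integral because their error
depends only on the mesh. -/
theorem IsNoise.integral_add_adjacent [CompleteSpace 𝓛] (hh : 1 / 2 < h) (hB : IsNoise h B)
    {c : ℝ} (hab : a ≤ b) (hbc : b ≤ c) (hΦ : ContinuousOn Φ (Set.Icc a c)) :
    integral B Φ a b + integral B Φ b c = integral B Φ a c := by
  have hac := hab.trans hbc
  have h1 : ContinuousOn Φ (Set.Icc a b) := hΦ.mono (Set.Icc_subset_Icc_right hbc)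
  have h2 : ContinuousOn Φ (Set.Icc b c) := hΦ.mono (Set.Icc_subset_Icc_left hab)
  set s : ℕ → ℕ → ℝ := fun n i =>
    if i ≤ n + 1 then upart a b (n + 1) i else upart b c (n + 1) (i - (n + 1)) with hs
  have hp1 : ∀ n, IsPart a b (n + 1) (upart a b (n + 1)) := fun n => isPart_upart hab (by omega)
  have hp2 : ∀ n, IsPart b c (n + 1) (upart b c (n + 1)) := fun n => isPart_upart hbc (by omega)
  have hs2 : ∀ n i, s n (n + 1 + i) = upart b c (n + 1) i := by
    intro n i
    rcases Nat.eq_zero_or_pos i with rfl | hi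
    · simp only [hs, add_zero, le_refl, if_true, (hp1 n).right, (hp2 n).left]
    · simp only [hs]
      rw [if_neg (by omega), Nat.add_sub_cancel_left]
  have hs1 : ∀ n i, i ≤ n + 1 → s n i = upart a b (n + 1) i := fun n i hi => by
    simp only [hs, if_pos hi]
  have hpart : ∀ n, IsPart a c (n + 1 + (n + 1)) (s n) := by
    intro n
    refine ⟨monotone_nat_of_le_succ fun i => ?_, ?_, ?_⟩
    · rcases Nat.lt_or_ge i (n + 1) with hi | hi
      · rw [hs1 n i hi.le, hs1 n (i + 1) hi]
        exact (hp1 n).mono (Nat.le_succ i)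
      · obtain ⟨j, rfl⟩ := Nat.exists_eq_add_of_le hi
        rw [hs2, add_assoc (n + 1), hs2]
        exact (hp2 n).mono (Nat.le_succ j)
    · rw [hs1 n 0 (Nat.zero_le _), (hp1 n).left]
    · rw [hs2, (hp2 n).right]
  have hsum : ∀ n, rsum B Φ (s n) (n + 1 + (n + 1)) =
      rsum B Φ (upart a b (n + 1)) (n + 1) + rsum B Φ (upart b c (n + 1)) (n + 1) := by
    intro n
    simp only [rsum]
    rw [Finset.sum_range_add _ (n + 1) (n + 1)]
    congr 1
    · refine Finset.sum_congr rfl fun i hi => ?_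
      have hi := Finset.mem_range.1 hi
      rw [hs1 n i hi.le, hs1 n (i + 1) hi]
    · refine Finset.sum_congr rfl fun i _ => ?_
      rw [hs2, add_assoc (n + 1), hs2]
  refine tendsto_nhds_unique (f := fun n => rsum B Φ (s n) (n + 1 + (n + 1))) (l := atTop) ?_ ?_
  · simp only [hsum]
    exact (hB.tendsto_integral hh hab h1).add (hB.tendsto_integral hh hbc h2)
  · rw [Metric.tendsto_nhds]
    intro ε hε
    have hC : 0 ≤ (c - a) ^ h := Real.rpow_nonneg (sub_nonneg.2 hac) _
    have hε' : 0 < ε / ((c - a) ^ h + 1) := by positivity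
    obtain ⟨δ, hδ, H⟩ := exists_modulus hΦ hε'
    filter_upwards [eventually_mesh_le a b hδ, eventually_mesh_le b c hδ] with n hn1 hn2
    rw [dist_eq_norm]
    refine (hB.norm_rsum_sub_integral_le hh hΦ (hpart n) hδ hε'.le ?_ H).trans_lt ?_
    · intro i _
      rcases Nat.lt_or_ge i (n + 1) with hi | hi
      · rw [hs1 n i hi.le, hs1 n (i + 1) hi]
        exact (upart_mesh hab _ i).trans hn1
      · obtain ⟨j, rfl⟩ := Nat.exists_eq_add_of_le hi
        rw [hs2, add_assoc (n + 1), hs2]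
        exact (upart_mesh hbc _ j).trans hn2
    · rw [mul_div_assoc', div_lt_iff₀ (by linarith)]
      linarith [mul_comm ε ((c - a) ^ h)]

end FBM

/-! ## Exponentially stable semigroups and bounded mild solutions -/

namespace Evol

/-! ### Strong continuity of stable semigroups. -/

section Semigroup

variable {E : Type*} [NormedAddCommGroup E] [NormedSpace ℝ E]

/-- A `C₀`-semigroup with the bound `‖T t‖ ≤ N exp (-α t)`. -/
structure IsStable (N α : ℝ) (T : ℝ → E →L[ℝ] E) : Prop extends IsC0Semigroup T where
  N_pos : 0 < N
  α_pos : 0 < α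
  bound : ∀ t : ℝ, 0 ≤ t → ‖T t‖ ≤ N * Real.exp (-α * t)

variable {N α : ℝ} {T : ℝ → E →L[ℝ] E}

theorem IsStable.norm_le (hT : IsStable N α T) {t : ℝ} (ht : 0 ≤ t) : ‖T t‖ ≤ N := by
  refine (hT.bound t ht).trans (mul_le_of_le_one_right hT.N_pos.le (Real.exp_le_one_iff.2 ?_))
  have := mul_nonneg hT.α_pos.le ht
  linarith

theorem IsStable.norm_apply_le (hT : IsStable N α T) {t : ℝ} (ht : 0 ≤ t) (x : E) :
    ‖T t x‖ ≤ N * ‖x‖ :=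
  (T t).le_of_opNorm_le (hT.norm_le ht) x

theorem IsStable.norm_apply_le' (hT : IsStable N α T) {t : ℝ} (ht : 0 ≤ t) (x : E) :
    ‖T t x‖ ≤ N * Real.exp (-α * t) * ‖x‖ :=
  (T t).le_of_opNorm_le (hT.bound t ht) x

theorem IsStable.add_apply (hT : IsStable N α T) {s t : ℝ} (hs : 0 ≤ s) (ht : 0 ≤ t) (x : E) :
    T (s + t) x = T s (T t x) := by
  rw [hT.add s t hs ht]
  rfl

theorem IsStable.norm_apply_sub_le (hT : IsStable N α T) {s t : ℝ} (hs : 0 ≤ s) (ht : 0 ≤ t)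
    (x : E) : ‖T s x - T t x‖ ≤ N * ‖T |s - t| x - x‖ := by
  wlog hst : t ≤ s generalizing s t
  · rw [norm_sub_rev, abs_sub_comm]
    exact this ht hs (le_of_not_ge hst)
  rw [abs_of_nonneg (sub_nonneg.2 hst)]
  have : T s x = T t (T (s - t) x) := by
    rw [← hT.add_apply ht (sub_nonneg.2 hst), add_sub_cancel]
  rw [this, ← map_sub]
  exact hT.norm_apply_le ht _

/-- The absolute value reduces continuity at `t` from both sides to right continuity at `0`. -/
theorem IsStable.tendsto_abs (hT : IsStable N α T) (x : E) (t : ℝ) :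
    Tendsto (fun s => T |s - t| x) (𝓝 t) (𝓝 x) := by
  have h0 : Tendsto (fun u : ℝ => T u x) (𝓝[≥] 0) (𝓝 x) := by
    rw [← Set.Ioi_union_left, nhdsWithin_union]
    refine (hT.strong x).sup ?_
    rw [nhdsWithin_singleton, tendsto_pure_left]
    intro s hs
    rw [hT.zero]
    exact mem_of_mem_nhds hs
  refine h0.comp (tendsto_nhdsWithin_iff.2 ⟨?_, Eventually.of_forall fun s => Set.mem_Ici.2 (abs_nonneg _)⟩)
  have : Tendsto (fun s : ℝ => |s - t|) (𝓝 t) (𝓝 |t - t|) :=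
    ((continuous_id.sub continuous_const).abs).tendsto t
  simpa using this

/-- Joint continuity follows from strong continuity and the uniform bound `N`: vary the vector
first, at the moving time, and then the time, at the fixed vector. -/
theorem IsStable.continuousOn (hT : IsStable N α T) {Y : Type*} [TopologicalSpace Y]
    {r : Y → ℝ} {x : Y → E} {A : Set Y} (hr : ContinuousOn r A) (hx : ContinuousOn x A)
    (hr0 : ∀ y ∈ A, 0 ≤ r y) : ContinuousOn (fun y => T (r y) (x y)) A := by
  intro y hy
  have h1 : Tendsto (fun z => N * ‖x z - x y‖ + N * ‖T |r z - r y| (x y) - x y‖)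
      (𝓝[A] y) (𝓝 (N * 0 + N * 0)) := by
    refine Tendsto.add ?_ ?_ <;> refine Tendsto.const_mul _ ?_
    · exact tendsto_iff_norm_sub_tendsto_zero.1 (hx y hy)
    · exact tendsto_iff_norm_sub_tendsto_zero.1 ((hT.tendsto_abs (x y) (r y)).comp (hr y hy))
  rw [mul_zero, add_zero] at h1
  refine tendsto_iff_norm_sub_tendsto_zero.2 ?_
  refine squeeze_zero' (Eventually.of_forall fun _ => norm_nonneg _) ?_ h1
  filter_upwards [self_mem_nhdsWithin] with z hz
  calc ‖T (r z) (x z) - T (r y) (x y)‖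
      = ‖T (r z) (x z - x y) + (T (r z) (x y) - T (r y) (x y))‖ := by
        rw [map_sub]; congr 1; abel
    _ ≤ _ := (norm_add_le _ _).trans (add_le_add (hT.norm_apply_le (hr0 z hz) _)
        (hT.norm_apply_sub_le (hr0 z hz) (hr0 y hy) _))

/-- The vectors on which a bounded family of operators is strongly continuous at `0`. -/
def strongSubmodule (T : ℝ → E →L[ℝ] E) : Submodule ℝ E where
  carrier := {x | Tendsto (fun t => T t x) (𝓝[>] 0) (𝓝 x)}
  add_mem' {x y} hx hy := by
    simp only [Set.mem_ofPred_eq, map_add] at *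
    exact hx.add hy
  zero_mem' := by simp
  smul_mem' c x hx := by
    simp only [Set.mem_ofPred_eq, map_smul] at *
    exact hx.const_smul c

/-- Uniform boundedness lets strong continuity pass to limits. For the lifted semigroups it then
suffices to test indicator functions, respectively families with one non-zero coordinate. -/
theorem isClosed_strongSubmodule {T : ℝ → E →L[ℝ] E} (hN : ∀ t, 0 ≤ t → ‖T t‖ ≤ N) :
    IsClosed (strongSubmodule T : Set E) := by
  refine isClosed_of_closure_subset fun x hx => ?_
  have hN0 : 0 ≤ N := (norm_nonneg _).trans (hN 0 le_rfl)
  refine Metric.tendsto_nhds.2 fun ε hε => ?_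
  obtain ⟨y, hy, hxy⟩ := Metric.mem_closure_iff.1 hx (ε / (2 * (N + 1))) (by positivity)
  filter_upwards [Metric.tendsto_nhds.1 hy (ε / 2) (by linarith), self_mem_nhdsWithin]
    with t ht ht0
  rw [dist_eq_norm] at *
  have e : T t x - x = T t (x - y) + (T t y - y) - (x - y) := by rw [map_sub]; abel
  have h1 : ‖T t (x - y)‖ ≤ N * ‖x - y‖ := (T t).le_of_opNorm_le (hN t (le_of_lt ht0)) _
  have h2 : (N + 1) * ‖x - y‖ < ε / 2 := by
    rw [lt_div_iff₀ (by positivity)] at hxy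
    linarith
  rw [e]
  have h3 := norm_sub_le (T t (x - y) + (T t y - y)) (x - y)
  have h4 := norm_add_le (T t (x - y)) (T t y - y)
  linarith

end Semigroup

/-! ### The semigroup on square integrable random vectors and on square summable families. -/

section Lift

variable {E : Type*} [NormedAddCommGroup E] [NormedSpace ℝ E] {N α : ℝ} {S : ℝ → E →L[ℝ] E}

/-- A semigroup acting on square integrable random variables. -/
noncomputable def onLp {Ω : Type*} [MeasurableSpace Ω] (P : Measure Ω) (S : ℝ → E →L[ℝ] E)
    (t : ℝ) : Lp E 2 P →L[ℝ] Lp E 2 P :=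
  (S t).compLpL 2 P

/-- A semigroup acting coordinatewise on square summable families. -/
noncomputable def onSeq (ι : Type*) (S : ℝ → E →L[ℝ] E) (t : ℝ) :
    lp (fun _ : ι => E) 2 →L[ℝ] lp (fun _ : ι => E) 2 :=
  lp.mapCLM 2 (fun _ => S t) (norm_nonneg (S t)) fun _ => le_rfl

theorem onSeq_apply {ι : Type*} (t : ℝ) (x : lp (fun _ : ι => E) 2) (n : ι) :
    onSeq ι S t x n = S t (x n) := rfl

theorem IsStable.onLp {Ω : Type*} [MeasurableSpace Ω] (P : Measure Ω) [IsProbabilityMeasure P]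
    (hS : IsStable N α S) : IsStable N α (onLp P S) where
  N_pos := hS.N_pos
  α_pos := hS.α_pos
  bound t ht := (ContinuousLinearMap.norm_compLpL_le _).trans (hS.bound t ht)
  zero := by
    ext x
    simp only [Evol.onLp, hS.zero]
    filter_upwards [ContinuousLinearMap.coeFn_compLpL (p := 2) (μ := P)
      (ContinuousLinearMap.id ℝ E) x] with ω h
    rw [h]
    rfl
  add s t hs ht := by
    ext x
    simp only [Evol.onLp, hS.add s t hs ht]
    filter_upwards [ContinuousLinearMap.coeFn_compLpL (p := 2) (μ := P) ((S s).comp (S t)) x,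
      ContinuousLinearMap.coeFn_compLpL (p := 2) (μ := P) (S s) ((S t).compLpL 2 P x),
      ContinuousLinearMap.coeFn_compLpL (p := 2) (μ := P) (S t) x] with ω h1 h2 h3
    rw [h1]
    change _ = ((S s).compLpL 2 P ((S t).compLpL 2 P x)) ω
    rw [h2, h3]
    rfl
  strong x := by
    have hcl : IsClosed (strongSubmodule (Evol.onLp P S) : Set (Lp E 2 P)) :=
      isClosed_strongSubmodule (N := N) fun t ht =>
        (ContinuousLinearMap.norm_compLpL_le _).trans (hS.norm_le ht)
    change x ∈ strongSubmodule (Evol.onLp P S)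
    refine Lp.induction (by norm_num) (motive := fun x => x ∈ strongSubmodule (Evol.onLp P S))
      ?_ ?_ hcl x
    · intro c s hs hμs
      rw [Lp.simpleFunc.coe_indicatorConst]
      refine tendsto_iff_norm_sub_tendsto_zero.2 ?_
      have hc := tendsto_iff_norm_sub_tendsto_zero.1 (hS.strong c)
      have hle : ∀ t, ‖Evol.onLp P S t (indicatorConstLp 2 hs hμs.ne c)
          - indicatorConstLp 2 hs hμs.ne c‖ ≤ ‖S t c - c‖ * P.real s ^ (1 / (2 : ℝ≥0∞).toReal) := by
        intro t
        have e : Evol.onLp P S t (indicatorConstLp 2 hs hμs.ne c) - indicatorConstLp 2 hs hμs.ne c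
            = indicatorConstLp 2 hs hμs.ne (S t c - c) := by
          rw [Evol.onLp]
          have : (S t).compLpL 2 P (indicatorConstLp 2 hs hμs.ne c)
              = indicatorConstLp 2 hs hμs.ne (S t c) := by
            ext
            filter_upwards [ContinuousLinearMap.coeFn_compLpL (p := 2) (μ := P) (S t)
              (indicatorConstLp 2 hs hμs.ne c), indicatorConstLp_coeFn (p := 2) (hs := hs)
              (hμs := hμs.ne) (c := c), indicatorConstLp_coeFn (p := 2) (hs := hs)
              (hμs := hμs.ne) (c := S t c)] with ω h1 h2 h3
            rw [h1, h2, h3]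
            by_cases hω : ω ∈ s <;> simp [hω]
          rw [this, ← indicatorConstLp_sub]
        rw [e]
        exact norm_indicatorConstLp_le
      refine squeeze_zero (fun _ => norm_nonneg _) hle ?_
      simpa using hc.mul_const (P.real s ^ (1 / (2 : ℝ≥0∞).toReal))
    · intro f g hf hg _ h1 h2
      exact Submodule.add_mem _ h1 h2

theorem IsStable.onSeq (ι : Type*) (hS : IsStable N α S) : IsStable N α (onSeq ι S) where
  N_pos := hS.N_pos
  α_pos := hS.α_pos
  bound t ht := (lp.norm_mapCLM_le _ _ _ _).trans (hS.bound t ht)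
  zero := by
    ext x n
    simp [onSeq_apply, hS.zero]
  add s t hs ht := by
    ext x n
    simp [onSeq_apply, hS.add s t hs ht]
  strong x := by
    classical
    have hcl : IsClosed (strongSubmodule (Evol.onSeq ι S) : Set (lp (fun _ : ι => E) 2)) :=
      isClosed_strongSubmodule (N := N) fun t ht =>
        (lp.norm_mapCLM_le _ _ _ _).trans (hS.norm_le ht)
    change x ∈ strongSubmodule (Evol.onSeq ι S)
    refine hcl.mem_of_tendsto (lp.hasSum_single (by norm_num) x) (Eventually.of_forall fun s => ?_)
    refine Submodule.sum_mem _ fun n _ => ?_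
    refine tendsto_iff_norm_sub_tendsto_zero.2 ?_
    have hc := tendsto_iff_norm_sub_tendsto_zero.1 (hS.strong (x n))
    refine hc.congr fun t => ?_
    have e : Evol.onSeq ι S t (lp.single 2 n (x n)) - lp.single 2 n (x n)
        = lp.single 2 n (S t (x n) - x n) := by
      ext m
      rcases eq_or_ne m n with rfl | hm
      · simp [onSeq_apply]
      · simp [onSeq_apply, Pi.single_eq_of_ne hm]
    rw [e, lp.norm_single (by norm_num)]

end Lift

/-! ### Mild solutions in an abstract Hilbert space. -/

section Mild

open FBM

variable {𝓗 𝓛 : Type*} [NormedAddCommGroup 𝓗] [InnerProductSpace ℝ 𝓗]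
  [NormedAddCommGroup 𝓛] [InnerProductSpace ℝ 𝓛] [CompleteSpace 𝓛]

/-- The increment `∫_a^t T(t - s) p₁(s) ds + ∫_a^t T'(t - s) p₂(s) dB(s)` of a mild solution. -/
noncomputable def duhamel (T : ℝ → 𝓛 →L[ℝ] 𝓛) (T' : ℝ → 𝓗 →L[ℝ] 𝓗) (B : ℝ → 𝓗 →L[ℝ] 𝓛)
    (p : ℝ → 𝓛 × 𝓗) (a t : ℝ) : 𝓛 :=
  (∫ s in a..t, T (t - s) (p s).1) + FBM.integral B (fun s => T' (t - s) (p s).2) a t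

/-- The bounded mild solution. -/
noncomputable def sol (T : ℝ → 𝓛 →L[ℝ] 𝓛) (T' : ℝ → 𝓗 →L[ℝ] 𝓗) (B : ℝ → 𝓗 →L[ℝ] 𝓛)
    (p : ℝ → 𝓛 × 𝓗) (t : ℝ) : 𝓛 :=
  ∑' n : ℕ, T n (duhamel T T' B p (t - n - 1) (t - n))

/-- The data of a linear evolution equation driven by a fractional noise. -/
structure IsSystem (h N α : ℝ) (T : ℝ → 𝓛 →L[ℝ] 𝓛) (T' : ℝ → 𝓗 →L[ℝ] 𝓗)
    (B : ℝ → 𝓗 →L[ℝ] 𝓛) : Prop where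
  hh : 1 / 2 < h
  stable : IsStable N α T
  stable' : IsStable N α T'
  noise : IsNoise h B
  comm : ∀ r s x, T r (B s x) = B s (T' r x)

variable {h N α : ℝ} {T : ℝ → 𝓛 →L[ℝ] 𝓛} {T' : ℝ → 𝓗 →L[ℝ] 𝓗} {B : ℝ → 𝓗 →L[ℝ] 𝓛}
  {p q : ℝ → 𝓛 × 𝓗} {a b t M : ℝ}

theorem IsSystem.shift (hs : IsSystem h N α T T' B) (τ : ℝ) :
    IsSystem h N α T T' (shiftNoise B τ) where
  hh := hs.hh
  stable := hs.stable
  stable' := hs.stable'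
  noise := hs.noise.shift hs.hh τ
  comm r s x := by simp only [shiftNoise, sub_apply, map_sub, hs.comm]

theorem IsSystem.cont₁ (hs : IsSystem h N α T T' B) (hp : Continuous p) (hbt : b ≤ t) :
    ContinuousOn (fun s => T (t - s) (p s).1) (Set.Icc a b) :=
  hs.stable.continuousOn (by fun_prop) (by fun_prop) fun s hs => by linarith [hs.2]

theorem IsSystem.cont₂ (hs : IsSystem h N α T T' B) (hp : Continuous p) (hbt : b ≤ t) :
    ContinuousOn (fun s => T' (t - s) (p s).2) (Set.Icc a b) :=
  hs.stable'.continuousOn (by fun_prop) (by fun_prop) fun s hs => by linarith [hs.2]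

theorem IsSystem.intervalIntegrable (hs : IsSystem h N α T T' B) (hp : Continuous p)
    (hab : a ≤ b) (hbt : b ≤ t) :
    IntervalIntegrable (fun s => T (t - s) (p s).1) volume a b :=
  ContinuousOn.intervalIntegrable (by rw [Set.uIcc_of_le hab]; exact hs.cont₁ hp hbt)

/-- The relation `T r (B s x) = B s (T' r x)` moves the semigroup under the stochastic integral,
where the semigroup law of `T'` applies. -/
theorem IsSystem.duhamel_cocycle (hs : IsSystem h N α T T' B) (hp : Continuous p)
    (hab : a ≤ b) (hbt : b ≤ t) :
    duhamel T T' B p a t = T (t - b) (duhamel T T' B p a b) + duhamel T T' B p b t := by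
  have h0 : 0 ≤ t - b := sub_nonneg.2 hbt
  have e1 : T (t - b) (∫ s in a..b, T (b - s) (p s).1) = ∫ s in a..b, T (t - s) (p s).1 := by
    rw [← ContinuousLinearMap.intervalIntegral_comp_comm _ (hs.intervalIntegrable hp hab le_rfl)]
    refine intervalIntegral.integral_congr fun s hsm => ?_
    rw [Set.uIcc_of_le hab] at hsm
    rw [← hs.stable.add_apply h0 (sub_nonneg.2 hsm.2), sub_add_sub_cancel]
  have e2 : T (t - b) (FBM.integral B (fun s => T' (b - s) (p s).2) a b)
      = FBM.integral B (fun s => T' (t - s) (p s).2) a b := by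
    rw [hs.noise.map_integral hs.hh hs.noise (T' (t - b)) (T (t - b)) (fun s x => hs.comm _ s x)
      hab (hs.cont₂ hp le_rfl)]
    refine integral_congr hab fun s hsm => ?_
    rw [← hs.stable'.add_apply h0 (sub_nonneg.2 hsm.2), sub_add_sub_cancel]
  rw [duhamel, duhamel, duhamel, map_add, e1, e2,
    ← intervalIntegral.integral_add_adjacent_intervals (hs.intervalIntegrable hp hab hbt)
      (hs.intervalIntegrable hp hbt le_rfl),
    ← hs.noise.integral_add_adjacent hs.hh hab hbt (hs.cont₂ hp le_rfl)]
  abel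

theorem IsSystem.norm_duhamel_le (hs : IsSystem h N α T T' B) (hp : Continuous p) (hat : a ≤ t)
    (hM : ∀ s ∈ Set.Icc a t, ‖p s‖ ≤ M) :
    ‖duhamel T T' B p a t‖ ≤ ((t - a) + (t - a) ^ h) * (N * M) := by
  have hM0 : 0 ≤ M := (norm_nonneg _).trans (hM a (Set.left_mem_Icc.2 hat))
  have i1 : ‖∫ s in a..t, T (t - s) (p s).1‖ ≤ N * M * |t - a| := by
    refine intervalIntegral.norm_integral_le_of_norm_le_const fun s hsm => ?_
    rw [Set.uIoc_of_le hat] at hsm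
    refine (hs.stable.norm_apply_le (sub_nonneg.2 hsm.2) _).trans ?_
    exact mul_le_mul_of_nonneg_left ((norm_fst_le _).trans (hM s ⟨hsm.1.le, hsm.2⟩))
      hs.stable.N_pos.le
  have i2 := hs.noise.norm_integral_le hs.hh hat (hs.cont₂ hp le_rfl) (M := N * M)
    (mul_nonneg hs.stable.N_pos.le hM0) fun s hsm =>
      (hs.stable'.norm_apply_le (sub_nonneg.2 hsm.2) _).trans
        (mul_le_mul_of_nonneg_left ((norm_snd_le _).trans (hM s hsm)) hs.stable.N_pos.le)
  rw [abs_of_nonneg (sub_nonneg.2 hat)] at i1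
  refine (norm_add_le _ _).trans ((add_le_add i1 i2).trans_eq ?_)
  ring

theorem IsSystem.sum_duhamel (hs : IsSystem h N α T T' B) (hp : Continuous p) (t : ℝ) (m : ℕ) :
    ∑ n ∈ Finset.range m, T n (duhamel T T' B p (t - n - 1) (t - n))
      = duhamel T T' B p (t - m) t := by
  induction m with
  | zero => simp [duhamel, FBM.integral, FBM.rsum, upart, tendsto_const_nhds.limUnder_eq]
  | succ m ih =>
    rw [Finset.sum_range_succ, ih, hs.duhamel_cocycle hp (a := t - (m + 1 : ℕ)) (b := t - m)
      (by push_cast; linarith) (by linarith [(Nat.cast_nonneg m : (0 : ℝ) ≤ m)])]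
    rw [add_comm, sub_sub_cancel]
    congr 3
    push_cast
    ring

/-- A bound for the solution operator. -/
noncomputable def solConst (N α : ℝ) : ℝ := ∑' n : ℕ, N * Real.exp (-α * n) * (2 * N)

theorem IsStable.summable_const {T : ℝ → 𝓛 →L[ℝ] 𝓛} (hT : IsStable N α T) :
    Summable fun n : ℕ => N * Real.exp (-α * n) * (2 * N) := by
  refine Summable.mul_right _ (Summable.mul_left _ ?_)
  have : ∀ n : ℕ, Real.exp (-α * n) = Real.exp (-α) ^ n := fun n => by
    rw [← Real.exp_nat_mul, mul_comm]
  simp only [this]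
  exact summable_geometric_of_lt_one (Real.exp_pos _).le
    (Real.exp_lt_one_iff.2 (by linarith [hT.α_pos]))

theorem IsStable.solConst_nonneg {T : ℝ → 𝓛 →L[ℝ] 𝓛} (hT : IsStable N α T) :
    0 ≤ solConst N α :=
  tsum_nonneg fun n => by have := hT.N_pos; positivity

theorem IsSystem.norm_term_le (hs : IsSystem h N α T T' B) (hp : Continuous p) (n : ℕ)
    (hM : ∀ s ∈ Set.Icc (t - n - 1) (t - n), ‖p s‖ ≤ M) :
    ‖T n (duhamel T T' B p (t - n - 1) (t - n))‖ ≤ N * Real.exp (-α * n) * (2 * N) * M := by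
  have h1 := hs.norm_duhamel_le hp (by linarith : t - n - 1 ≤ t - n) hM
  -- The interval has length one, so the drift and the noise each contribute `N * M`; this is the
  -- factor `2 * N` in `solConst`.
  rw [sub_sub_cancel, Real.one_rpow] at h1
  refine (hs.stable.norm_apply_le' (Nat.cast_nonneg n) _).trans ?_
  have : 0 ≤ N * Real.exp (-α * n) := mul_nonneg hs.stable.N_pos.le (Real.exp_pos _).le
  refine (mul_le_mul_of_nonneg_left h1 this).trans_eq ?_
  ring

theorem IsSystem.summable (hs : IsSystem h N α T T' B) (hp : Continuous p)
    (hM : ∀ s, ‖p s‖ ≤ M) (t : ℝ) :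
    Summable fun n : ℕ => T n (duhamel T T' B p (t - n - 1) (t - n)) :=
  Summable.of_norm_bounded (hs.stable.summable_const.mul_right M) fun n =>
    hs.norm_term_le hp n fun s _ => hM s

theorem IsSystem.tendsto_sol (hs : IsSystem h N α T T' B) (hp : Continuous p)
    (hM : ∀ s, ‖p s‖ ≤ M) (t : ℝ) :
    Tendsto (fun m : ℕ => duhamel T T' B p (t - m) t) atTop (𝓝 (sol T T' B p t)) := by
  have := (hs.summable hp hM t).hasSum.tendsto_sum_nat
  simp only [hs.sum_duhamel hp] at this
  exact this

theorem IsSystem.norm_duhamel_nat_le (hs : IsSystem h N α T T' B) (hp : Continuous p) (m : ℕ)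
    (hM : ∀ s ∈ Set.Icc (t - m) t, ‖p s‖ ≤ M) :
    ‖duhamel T T' B p (t - m) t‖ ≤ solConst N α * M := by
  have hM0 : 0 ≤ M := (norm_nonneg _).trans (hM t ⟨by linarith [(Nat.cast_nonneg m : (0 : ℝ) ≤ m)],
    le_rfl⟩)
  rw [← hs.sum_duhamel hp]
  refine (norm_sum_le _ _).trans ((Finset.sum_le_sum fun n hn => hs.norm_term_le hp n
    (M := M) fun s hsm => hM s ⟨?_, ?_⟩).trans ?_)
  · have : ((n + 1 : ℕ) : ℝ) ≤ m := by exact_mod_cast Finset.mem_range.1 hn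
    push_cast at this
    linarith [hsm.1]
  · linarith [hsm.2, (Nat.cast_nonneg n : (0 : ℝ) ≤ n)]
  · rw [← Finset.sum_mul]
    refine mul_le_mul_of_nonneg_right (hs.stable.summable_const.sum_le_tsum _ fun n _ => ?_) hM0
    have := hs.stable.N_pos
    positivity

theorem IsSystem.norm_sol_le (hs : IsSystem h N α T T' B) (hp : Continuous p)
    (hM : ∀ s, ‖p s‖ ≤ M) (t : ℝ) : ‖sol T T' B p t‖ ≤ solConst N α * M :=
  le_of_tendsto (hs.tendsto_sol hp hM t).norm
    (Eventually.of_forall fun m => hs.norm_duhamel_nat_le hp m fun s _ => hM s)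

theorem IsStable.tendsto_zero (hT : IsStable N α T) {x : ℕ → 𝓛} {C : ℝ} (hC : ∀ n, ‖x n‖ ≤ C)
    {r : ℕ → ℝ} (hr : Tendsto r atTop atTop) :
    Tendsto (fun n => T (r n) (x n)) atTop (𝓝 0) := by
  have h1 : Tendsto (fun n => N * Real.exp (-α * r n) * C) atTop (𝓝 (N * 0 * C)) := by
    refine Tendsto.mul_const _ (Tendsto.const_mul _ (Real.tendsto_exp_atBot.comp ?_))
    exact hr.const_mul_atTop_of_neg (by linarith [hT.α_pos])
  rw [mul_zero, zero_mul] at h1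
  refine squeeze_zero_norm' ?_ h1
  filter_upwards [hr.eventually_ge_atTop 0] with n hn
  exact (hT.norm_apply_le' hn _).trans (mul_le_mul_of_nonneg_left (hC n)
    (mul_nonneg hT.N_pos.le (Real.exp_pos _).le))

/-- Let the starting time `a - m` of the increment ending at `t` tend to `-∞` and compute the limit
in two ways: by splitting at `a`, and by comparison with the start `t - m` used for `sol`. -/
theorem IsSystem.sol_eq (hs : IsSystem h N α T T' B) (hp : Continuous p)
    (hM : ∀ s, ‖p s‖ ≤ M) (hat : a ≤ t) :
    sol T T' B p t = T (t - a) (sol T T' B p a) + duhamel T T' B p a t := by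
  have h0 : 0 ≤ t - a := sub_nonneg.2 hat
  have h1 : Tendsto (fun m : ℕ => duhamel T T' B p (a - m) t) atTop
      (𝓝 (T (t - a) (sol T T' B p a) + duhamel T T' B p a t)) := by
    refine ((((T (t - a)).continuous.tendsto _).comp (hs.tendsto_sol hp hM a)).add_const
      (duhamel T T' B p a t)).congr fun m => ?_
    rw [hs.duhamel_cocycle hp (a := a - m) (b := a)
      (by linarith [(Nat.cast_nonneg m : (0 : ℝ) ≤ m)]) hat]
    rfl
  -- Between `a - m` and `t - m` there is an interval of fixed length `t - a`, whose bounded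
  -- contribution is damped by `T m`.
  have h2 : Tendsto (fun m : ℕ => duhamel T T' B p (a - m) t) atTop (𝓝 (0 + sol T T' B p t)) := by
    have h3 : Tendsto (fun m : ℕ => T m (duhamel T T' B p (a - m) (t - m))) atTop (𝓝 0) := by
      refine hs.stable.tendsto_zero (C := ((t - a) + (t - a) ^ h) * (N * M)) (fun m => ?_)
        tendsto_natCast_atTop_atTop
      have := hs.norm_duhamel_le hp (by linarith : a - m ≤ t - m) fun s _ => hM s
      rwa [sub_sub_sub_cancel_right] at this
    refine (h3.add (hs.tendsto_sol hp hM t)).congr fun m => ?_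
    rw [hs.duhamel_cocycle hp (a := a - m) (b := t - m) (t := t) (by linarith)
      (by linarith [(Nat.cast_nonneg m : (0 : ℝ) ≤ m)]), sub_sub_cancel]
  rw [zero_add] at h2
  exact tendsto_nhds_unique h2 h1

/-- The difference `D` of two bounded solutions satisfies `D t = T n (D (t - n))` for all `n`, and
the right side tends to zero by exponential stability. -/
theorem IsSystem.eq_sol (hs : IsSystem h N α T T' B) (hp : Continuous p)
    (hM : ∀ s, ‖p s‖ ≤ M) {x : ℝ → 𝓛} {C : ℝ} (hC : ∀ s, ‖x s‖ ≤ C)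
    (hx : ∀ a t, a ≤ t → x t = T (t - a) (x a) + duhamel T T' B p a t) : x = sol T T' B p := by
  funext t
  have h1 : Tendsto (fun n : ℕ => T n (x (t - n) - sol T T' B p (t - n))) atTop (𝓝 0) :=
    hs.stable.tendsto_zero (C := C + solConst N α * M) (fun n => (norm_sub_le _ _).trans
      (add_le_add (hC _) (hs.norm_sol_le hp hM _))) tendsto_natCast_atTop_atTop
  have h2 : ∀ n : ℕ, T n (x (t - n) - sol T T' B p (t - n)) = x t - sol T T' B p t := by
    intro n
    have hn : t - n ≤ t := by linarith [(Nat.cast_nonneg n : (0 : ℝ) ≤ n)]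
    rw [hx _ _ hn, hs.sol_eq hp hM hn, sub_sub_cancel, map_sub]
    abel
  simp only [h2] at h1
  exact sub_eq_zero.1 (tendsto_nhds_unique tendsto_const_nhds h1)

/-- Restart both `u` and `t` from `t - r`: the semigroup term is continuous in `u`, and the
increments over intervals of length at most `2 * r` are uniformly small. -/
theorem IsSystem.continuous_sol (hs : IsSystem h N α T T' B) (hp : Continuous p)
    (hM : ∀ s, ‖p s‖ ≤ M) : Continuous (sol T T' B p) := by
  have hh := hs.hh
  refine continuous_iff_continuousAt.2 fun t => Metric.tendsto_nhds.2 fun ε hε => ?_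
  have hlim : Tendsto (fun r : ℝ => ((r + r) + (r + r) ^ h) * (N * M)) (𝓝[>] 0) (𝓝 0) := by
    have : Continuous fun r : ℝ => ((r + r) + (r + r) ^ h) * (N * M) := by
      have := Real.continuous_rpow_const (q := h) (by linarith)
      fun_prop
    have h2 := this.tendsto 0
    simp only [add_zero, Real.zero_rpow (by linarith : h ≠ 0), zero_mul] at h2
    exact h2.mono_left nhdsWithin_le_nhds
  obtain ⟨r, hr, hr0⟩ := ((hlim.eventually (gt_mem_nhds (show (0 : ℝ) < ε / 3 by linarith))).and
    self_mem_nhdsWithin).exists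
  have hr0 : 0 < r := hr0
  have hsmall : ∀ u, t - r ≤ u → u ≤ t + r → ‖duhamel T T' B p (t - r) u‖ < ε / 3 := by
    intro u h1 h2
    refine (hs.norm_duhamel_le hp h1 fun s _ => hM s).trans_lt (hr.trans_le' ?_)
    have hNM : 0 ≤ N * M := mul_nonneg hs.stable.N_pos.le ((norm_nonneg _).trans (hM 0))
    refine mul_le_mul_of_nonneg_right (add_le_add (by linarith) ?_) hNM
    exact Real.rpow_le_rpow (by linarith) (by linarith) (by linarith)
  have hcont : ContinuousOn (fun u => T (u - (t - r)) (sol T T' B p (t - r))) (Set.Ici (t - r)) :=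
    hs.stable.continuousOn (by fun_prop) continuousOn_const fun u hu => sub_nonneg.2 hu
  have hat := Metric.tendsto_nhds.1
    (hcont.continuousAt (Ici_mem_nhds (by linarith : t - r < t))) (ε / 3) (by linarith)
  filter_upwards [hat, Icc_mem_nhds (by linarith : t - r < t) (by linarith : t < t + r)]
    with u hu hur
  rw [dist_eq_norm] at *
  rw [hs.sol_eq hp hM hur.1, hs.sol_eq hp hM (by linarith : t - r ≤ t)]
  have h1 := hsmall u hur.1 hur.2
  have h2 := hsmall t (by linarith) (by linarith)
  rw [add_sub_add_comm]
  refine (norm_add_le _ _).trans_lt ?_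
  have := norm_sub_le (duhamel T T' B p (t - r) u) (duhamel T T' B p (t - r) t)
  linarith

/-- The solution at time `t` is small if the coefficients are small in the recent past. -/
theorem IsSystem.norm_sol_le_of_window (hs : IsSystem h N α T T' B) (hp : Continuous p)
    (hM : ∀ s, ‖p s‖ ≤ M) (m : ℕ) {δ : ℝ} (hδ : ∀ s ∈ Set.Icc (t - m) t, ‖p s‖ ≤ δ) :
    ‖sol T T' B p t‖ ≤ N * Real.exp (-α * m) * (solConst N α * M) + solConst N α * δ := by
  rw [hs.sol_eq hp hM (by linarith [(Nat.cast_nonneg m : (0 : ℝ) ≤ m)] : t - m ≤ t),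
    sub_sub_cancel]
  refine (norm_add_le _ _).trans (add_le_add ?_ (hs.norm_duhamel_nat_le hp m hδ))
  exact (hs.stable.norm_apply_le' (Nat.cast_nonneg m) _).trans (mul_le_mul_of_nonneg_left
    (hs.norm_sol_le hp hM _) (mul_nonneg hs.stable.N_pos.le (Real.exp_pos _).le))

theorem IsSystem.duhamel_add (hs : IsSystem h N α T T' B) (hp : Continuous p) (hq : Continuous q)
    (hat : a ≤ t) : duhamel T T' B (fun s => p s + q s) a t
      = duhamel T T' B p a t + duhamel T T' B q a t := by
  simp only [duhamel, Prod.fst_add, Prod.snd_add, map_add]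
  rw [intervalIntegral.integral_add (hs.intervalIntegrable hp hat le_rfl)
    (hs.intervalIntegrable hq hat le_rfl),
    hs.noise.integral_add hs.hh hat (hs.cont₂ hp le_rfl) (hs.cont₂ hq le_rfl)]
  abel

theorem IsSystem.sol_add (hs : IsSystem h N α T T' B) (hp : Continuous p) (hq : Continuous q)
    (hM : ∀ s, ‖p s‖ ≤ M) {M' : ℝ} (hM' : ∀ s, ‖q s‖ ≤ M') (t : ℝ) :
    sol T T' B (fun s => p s + q s) t = sol T T' B p t + sol T T' B q t := by
  refine tendsto_nhds_unique (hs.tendsto_sol (hp.add hq) (M := M + M')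
    (fun s => (norm_add_le _ _).trans (add_le_add (hM s) (hM' s))) t) ?_
  refine ((hs.tendsto_sol hp hM t).add (hs.tendsto_sol hq hM' t)).congr fun m => ?_
  exact (hs.duhamel_add hp hq (by linarith [(Nat.cast_nonneg m : (0 : ℝ) ≤ m)])).symm

theorem IsSystem.sol_sub (hs : IsSystem h N α T T' B) (hp : Continuous p) (hq : Continuous q)
    (hM : ∀ s, ‖p s‖ ≤ M) {M' : ℝ} (hM' : ∀ s, ‖q s‖ ≤ M') (t : ℝ) :
    sol T T' B p t - sol T T' B q t = sol T T' B (fun s => p s - q s) t := by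
  have := hs.sol_add (p := fun s => p s - q s) (hp.sub hq) hq (M := M + M')
    (fun s => (norm_sub_le _ _).trans (add_le_add (hM s) (hM' s))) hM' t
  simp only [sub_add_cancel] at this
  rw [this, add_sub_cancel_right]

/-- Solutions are close where the coefficients are close in the recent past. -/
theorem IsSystem.exists_window (T : ℝ → 𝓛 →L[ℝ] 𝓛) (T' : ℝ → 𝓗 →L[ℝ] 𝓗) (hT : IsStable N α T)
    (M : ℝ) {ε : ℝ} (hε : 0 < ε) : ∃ δ > 0, ∃ K > 0, ∀ (B : ℝ → 𝓗 →L[ℝ] 𝓛) (p q : ℝ → 𝓛 × 𝓗),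
      IsSystem h N α T T' B → Continuous p → Continuous q → (∀ s, ‖p s‖ ≤ M) → (∀ s, ‖q s‖ ≤ M) →
      ∀ t, (∀ s ∈ Set.Icc (t - K) t, dist (p s) (q s) ≤ δ) →
        dist (sol T T' B p t) (sol T T' B q t) ≤ ε := by
  set C := solConst N α
  have hC : 0 ≤ C := hT.solConst_nonneg
  have hlim : Tendsto (fun n : ℕ => N * Real.exp (-α * n) * (C * (M + M))) atTop
      (𝓝 (N * 0 * (C * (M + M)))) := by
    refine Tendsto.mul_const _ (Tendsto.const_mul _ (Real.tendsto_exp_atBot.comp ?_))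
    exact tendsto_natCast_atTop_atTop.const_mul_atTop_of_neg (by linarith [hT.α_pos])
  rw [mul_zero, zero_mul] at hlim
  -- The number `m` of unit intervals after which the forgotten past contributes at most `ε / 2`;
  -- the difference of the coefficients is bounded by `M + M`.
  obtain ⟨m, hm, hm0⟩ := ((hlim.eventually (gt_mem_nhds (half_pos hε))).and
    (eventually_gt_atTop 0)).exists
  -- Neither `δ` nor the window depends on `B`, so the estimate holds uniformly over all restarted
  -- noises.
  refine ⟨ε / (2 * (C + 1)), by positivity, m, by exact_mod_cast hm0, ?_⟩
  intro B p q hs hp hq hpM hqM t hwin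
  rw [dist_eq_norm, hs.sol_sub hp hq hpM hqM]
  refine (hs.norm_sol_le_of_window (hp.sub hq) (M := M + M)
    (fun s => (norm_sub_le _ _).trans (add_le_add (hpM s) (hqM s))) m
    (δ := ε / (2 * (C + 1))) fun s hsm => ?_).trans ?_
  · exact (dist_eq_norm (p s) (q s)).symm.trans_le (hwin s hsm)
  · have : C * (ε / (2 * (C + 1))) ≤ ε / 2 := by
      rw [mul_div_assoc', div_le_div_iff₀ (by positivity) (by norm_num)]
      nlinarith
    linarith

theorem duhamel_shift (τ : ℝ) : duhamel T T' B p (a + τ) (t + τ)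
    = duhamel T T' (shiftNoise B τ) (fun s => p (s + τ)) a t := by
  simp only [duhamel]
  rw [integral_shift, ← intervalIntegral.integral_comp_add_right (a := a) (b := t)]
  simp only [add_sub_add_right_eq_sub]

/-- An identity of vectors, not only of laws: in each term the drift integral is substituted, and
uniform partitions translate to uniform partitions. -/
theorem sol_shift (τ : ℝ) : sol T T' B p (t + τ)
    = sol T T' (shiftNoise B τ) (fun s => p (s + τ)) t := by
  simp only [sol]
  congr 1
  funext n
  rw [← duhamel_shift]
  congr 2 <;> ring

/-- Used with three kinds of closed subspaces: vectors measurable for a given σ-algebra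
(adaptedness), almost surely constant vectors, and the closed span of the noise. Only the
coefficients up to time `t` are constrained. -/
theorem IsSystem.sol_mem (hs : IsSystem h N α T T' B) (hp : Continuous p) (hM : ∀ s, ‖p s‖ ≤ M)
    {W : Submodule ℝ 𝓛} (hW : IsClosed (W : Set 𝓛)) (hT : ∀ r, ∀ x ∈ W, T r x ∈ W)
    (h1 : ∀ s ≤ t, (p s).1 ∈ W) (h2 : ∀ s ≤ t, ∀ r ≤ t, ∀ u, B s (T' u (p r).2) ∈ W) :
    sol T T' B p t ∈ W := by
  refine hW.mem_of_tendsto (hs.tendsto_sol hp hM t) (Eventually.of_forall fun m => ?_)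
  have hm : t - m ≤ t := by linarith [(Nat.cast_nonneg m : (0 : ℝ) ≤ m)]
  refine W.add_mem ?_ (hs.noise.integral_mem hs.hh hm (hs.cont₂ hp le_rfl) hW
    fun s hsm r hrm => h2 s hsm.2 r hrm.2 _)
  have : CompleteSpace W := hW.completeSpace_coe
  set c := t - (m : ℝ)
  -- The drift integral is computed inside the complete space `W`; the value `0` after time `t` is
  -- irrelevant.
  set F : ℝ → W := fun s => if hs : s ≤ t then ⟨T (t - s) (p s).1, hT _ _ (h1 s hs)⟩ else 0
  have hF : ∀ s ≤ t, ((F s : W) : 𝓛) = T (t - s) (p s).1 := fun s hs => by simp [F, hs]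
  have hFc : ContinuousOn F (Set.Icc c t) := by
    rw [continuousOn_iff_continuous_domRestrict]
    refine continuous_induced_rng.2 ?_
    have := continuousOn_iff_continuous_domRestrict.1 (hs.cont₁ (a := c) hp (le_refl t))
    refine this.congr fun s => (hF s s.2.2).symm
  have hint : IntervalIntegrable F volume c t :=
    ContinuousOn.intervalIntegrable (by rwa [Set.uIcc_of_le hm])
  have e : (∫ s in c..t, T (t - s) (p s).1) = W.subtypeL (∫ s in c..t, F s) := by
    rw [← ContinuousLinearMap.intervalIntegral_comp_comm _ hint]
    refine intervalIntegral.integral_congr fun s hsm => ?_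
    rw [Set.uIcc_of_le hm] at hsm
    exact (hF s hsm.2).symm
  rw [e]
  exact (∫ s in c..t, F s).2

end Mild

end Evol

/-! ## Transfer of recurrence properties -/

namespace Recur

variable {X Y : Type*} [PseudoMetricSpace X] [PseudoMetricSpace Y]

theorem translate_apply (φ : C(ℝ, X)) (h t : ℝ) : translate φ h t = φ (h + t) := rfl

theorem bddAbove_dist_Icc (φ ψ : C(ℝ, X)) (T : ℝ) :
    BddAbove (Set.range fun t : Set.Icc (-T) T => dist (φ t) (ψ t)) := by
  have hc : Continuous fun t : ℝ => dist (φ t) (ψ t) := by fun_prop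
  have := (isCompact_Icc (a := -T) (b := T)).bddAbove_image hc.continuousOn
  refine this.mono ?_
  rintro _ ⟨t, rfl⟩
  exact ⟨t, t.2, rfl⟩

theorem bddAbove_cdist (φ ψ : C(ℝ, X)) :
    BddAbove (Set.range fun T : Set.Ioi (0 : ℝ) =>
      min (⨆ t : Set.Icc (-(T : ℝ)) (T : ℝ), dist (φ t) (ψ t)) (1 / (T : ℝ))) := by
  refine ⟨max (⨆ t : Set.Icc (-(1 : ℝ)) (1 : ℝ), dist (φ t) (ψ t)) 1, ?_⟩
  rintro _ ⟨⟨T, hT⟩, rfl⟩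
  have hT : 0 < T := hT
  rcases le_total T 1 with h | h
  · refine (min_le_left _ _).trans (le_max_of_le_left ?_)
    have : Nonempty (Set.Icc (-T) T) := ⟨⟨0, by constructor <;> linarith⟩⟩
    refine ciSup_le fun t => ?_
    exact le_ciSup (bddAbove_dist_Icc φ ψ 1) ⟨t, by have := t.2.1; linarith,
      t.2.2.trans h⟩
  · refine (min_le_right _ _).trans (le_max_of_le_right ?_)
    rw [div_le_one hT]
    exact h

/-- With `ε ≤ 1 / T` the minimum in `cdist` at this `T` cannot be the term `1 / T`. -/
theorem dist_lt_of_cdist_lt {φ ψ : C(ℝ, X)} {ε T : ℝ} (h : cdist φ ψ < ε) (hT : 0 < T)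
    (hε : ε ≤ 1 / T) {t : ℝ} (ht : |t| ≤ T) : dist (φ t) (ψ t) < ε := by
  have h1 := (le_ciSup (bddAbove_cdist φ ψ) ⟨T, hT⟩).trans_lt h
  rcases min_lt_iff.1 h1 with h2 | h2
  · exact (le_ciSup (bddAbove_dist_Icc φ ψ T) ⟨t, abs_le.1 ht⟩).trans_lt h2
  · exact absurd h2 (not_lt.2 hε)

theorem cdist_le {φ ψ : C(ℝ, X)} {ε T : ℝ} (hT : 0 < T) (hε : 1 / T ≤ ε)
    (h : ∀ t, |t| ≤ T → dist (φ t) (ψ t) ≤ ε) : cdist φ ψ ≤ ε := by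
  have : Nonempty (Set.Ioi (0 : ℝ)) := ⟨⟨1, Set.mem_Ioi.2 one_pos⟩⟩
  refine ciSup_le fun R => ?_
  have hR : 0 < (R : ℝ) := R.2
  rcases le_total (R : ℝ) T with hRT | hRT
  · refine (min_le_left _ _).trans ?_
    have : Nonempty (Set.Icc (-(R : ℝ)) R) := ⟨⟨0, by constructor <;> linarith⟩⟩
    exact ciSup_le fun t => h t ((abs_le.2 t.2).trans hRT)
  · exact (min_le_right _ _).trans ((one_div_le_one_div_of_le hT hRT).trans hε)

/-- The increments of `Λ` are controlled by those of `J` in the recent past. -/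
def Dominated (J : C(ℝ, X)) (Λ : C(ℝ, Y)) : Prop :=
  ∀ ε > 0, ∃ δ > 0, ∃ K > 0, ∀ t τ : ℝ,
    (∀ s ∈ Set.Icc (t - K) t, dist (J (s + τ)) (J s) ≤ δ) → dist (Λ (t + τ)) (Λ t) ≤ ε

/-- The function returns close to each of its values in the remote past. -/
def ReturnsInPast (J : C(ℝ, X)) : Prop :=
  ∀ t ε l : ℝ, 0 < ε → ∃ τ < -l, dist (J (t + τ)) (J t) < ε

variable {J : C(ℝ, X)} {Λ : C(ℝ, Y)}

/-- Domination yields distance zero only; `hY` turns this into equality, the space of laws being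
introduced as a pseudometric space. -/
theorem Dominated.eq_of_eq (hD : Dominated J Λ) (hY : ∀ x y : Y, dist x y = 0 → x = y) {τ : ℝ}
    (hJ : ∀ s, J (s + τ) = J s) (t : ℝ) : Λ (t + τ) = Λ t := by
  refine hY _ _ (le_antisymm (le_of_forall_pos_le_add fun ε hε => ?_) dist_nonneg)
  obtain ⟨δ, hδ, K, -, H⟩ := hD ε hε
  rw [zero_add]
  exact H t τ fun s _ => by rw [hJ s, dist_self]; exact hδ.le

theorem Dominated.isStationary (hD : Dominated J Λ) (hY : ∀ x y : Y, dist x y = 0 → x = y)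
    (hJ : IsStationary J) : IsStationary Λ := fun t => by
  have := hD.eq_of_eq hY (τ := t) (fun s => by rw [hJ (s + t), hJ s]) 0
  rwa [zero_add] at this

theorem Dominated.isPeriodic (hD : Dominated J Λ) (hY : ∀ x y : Y, dist x y = 0 → x = y) {τ : ℝ}
    (hJ : IsPeriodic τ J) : IsPeriodic τ Λ :=
  hD.eq_of_eq hY hJ

theorem Dominated.almostPeriods (hD : Dominated J Λ) {ε : ℝ} (hε : 0 < ε) :
    ∃ δ > 0, almostPeriods J δ ⊆ almostPeriods Λ ε := by
  obtain ⟨δ, hδ, K, -, H⟩ := hD (ε / 2) (half_pos hε)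
  exact ⟨δ, hδ, fun τ hτ t => (H t τ fun s _ => (hτ s).le).trans_lt (half_lt_self hε)⟩

theorem Dominated.shifts (hD : Dominated J Λ) {ε : ℝ} (hε : 0 < ε) :
    ∃ δ > 0, shifts J δ ⊆ shifts Λ ε := by
  obtain ⟨δ, hδ, K, hK, H⟩ := hD (ε / 2) (half_pos hε)
  set T := 1 / (ε / 2)
  have hT : 0 < T := by positivity
  -- The windows of length `K` ending in `[-T, T]` lie in `[-(T + K), T + K]`, so the shift must be
  -- small on that interval.
  refine ⟨min δ (1 / (T + K)), by positivity, fun τ hτ => ?_⟩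
  refine lt_of_le_of_lt (cdist_le hT (by simp [T]) fun t ht => ?_) (half_lt_self hε)
  rw [translate_apply, add_comm τ t]
  refine H t τ fun s hs => ?_
  have hs' : |s| ≤ T + K := by
    have := abs_le.1 ht
    rw [abs_le]
    constructor <;> linarith [hs.1, hs.2]
  have := dist_lt_of_cdist_lt hτ (by positivity : 0 < T + K) (min_le_right _ _) hs'
  rw [translate_apply, add_comm τ s] at this
  exact this.le.trans (min_le_left _ _)

theorem RelativelyDense.mono {A B : Set ℝ} (hA : RelativelyDense A) (h : A ⊆ B) :
    RelativelyDense B := by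
  obtain ⟨l, hl, H⟩ := hA
  exact ⟨l, hl, fun a => (H a).mono (Set.inter_subset_inter_left _ h)⟩

theorem RelativelyDense.exists_lt {A : Set ℝ} (hA : RelativelyDense A) (l : ℝ) :
    ∃ τ ∈ A, τ < -l := by
  obtain ⟨r, _, H⟩ := hA
  obtain ⟨τ, hτ, h2⟩ := H (-l - r - 1)
  exact ⟨τ, hτ, by linarith [h2.2]⟩

theorem Dominated.isBohrAlmostPeriodic (hD : Dominated J Λ) (hJ : IsBohrAlmostPeriodic J) :
    IsBohrAlmostPeriodic Λ := fun ε hε => by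
  obtain ⟨δ, hδ, H⟩ := hD.almostPeriods hε
  exact (hJ δ hδ).mono H

theorem Dominated.isAlmostRecurrent (hD : Dominated J Λ) (hJ : IsAlmostRecurrent J) :
    IsAlmostRecurrent Λ := fun ε hε => by
  obtain ⟨δ, hδ, H⟩ := hD.shifts hε
  exact (hJ δ hδ).mono H

theorem Dominated.isLevitanAlmostPeriodic (hD : Dominated J Λ) (hJ : IsLevitanAlmostPeriodic J) :
    IsLevitanAlmostPeriodic Λ := by
  obtain ⟨Z, i1, i2, ψ, hψ, H⟩ := hJ
  refine ⟨Z, i1, i2, ψ, hψ, fun ε hε => ?_⟩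
  obtain ⟨δ, hδ, h1⟩ := hD.shifts hε
  obtain ⟨δ', hδ', h2⟩ := H δ hδ
  exact ⟨δ', hδ', h2.trans h1⟩

theorem Dominated.isPoissonStable (hD : Dominated J Λ) (hJ : IsPoissonStable J) :
    IsPoissonStable Λ := fun ε l hε hl => by
  obtain ⟨δ, hδ, H⟩ := hD.shifts hε
  obtain ⟨⟨τ, h1, h2⟩, τ', h3, h4⟩ := hJ δ l hδ hl
  exact ⟨⟨τ, H h1, h2⟩, τ', H h3, h4⟩

theorem Dominated.isPseudoPeriodic (hD : Dominated J Λ) (hJ : IsPseudoPeriodic J) :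
    IsPseudoPeriodic Λ := fun ε l hε hl => by
  obtain ⟨δ, hδ, H⟩ := hD.almostPeriods hε
  obtain ⟨⟨τ, h1, h2⟩, τ', h3, h4⟩ := hJ δ l hδ hl
  exact ⟨⟨τ, H h1, h2⟩, τ', H h3, h4⟩

/-- The half-line `t ≤ 1 / ε` contains the window preceding each of its points, so `K` plays no
role. -/
theorem Dominated.isPseudoRecurrent (hD : Dominated J Λ) (hJ : IsPseudoRecurrent J) :
    IsPseudoRecurrent Λ := fun ε l hε => by
  obtain ⟨δ, hδ, K, -, H⟩ := hD ε hε
  obtain ⟨L, hL, h1⟩ := hJ (min δ ε) l (lt_min hδ hε)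
  refine ⟨L, hL, fun τ₀ => ?_⟩
  obtain ⟨τ, hτ, h2⟩ := h1 τ₀
  refine ⟨τ, hτ, fun t ht => H _ _ fun s hs => ?_⟩
  have := h2 (s - τ₀) (by
    have := one_div_le_one_div_of_le (lt_min hδ hε) (min_le_right δ ε)
    linarith [hs.2])
  rw [sub_add_cancel] at this
  exact this.trans (min_le_left _ _)

theorem Dominated.isWindowPseudoRecurrent (hD : Dominated J Λ) (hJ : IsWindowPseudoRecurrent J) :
    IsWindowPseudoRecurrent Λ := fun ε l hε => by
  obtain ⟨δ, hδ, K, hK, H⟩ := hD ε hε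
  -- The bounded window has to be enlarged by `K`.
  have hη : 0 < min δ (1 / (1 / ε + K)) := by positivity
  obtain ⟨L, hL, h1⟩ := hJ _ l hη
  refine ⟨L, hL, fun τ₀ => ?_⟩
  obtain ⟨τ, hτ, h2⟩ := h1 τ₀
  refine ⟨τ, hτ, fun t ht => H _ _ fun s hs => ?_⟩
  have := h2 (s - τ₀) (by
    have h3 := one_div_le_one_div_of_le hη (min_le_right δ _)
    rw [one_div_one_div] at h3
    have := abs_le.1 ht
    refine le_trans (abs_le.2 ?_) h3
    constructor <;> linarith [hs.1, hs.2])
  rw [sub_add_cancel] at this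
  exact this.trans (min_le_left _ _)

theorem ReturnsInPast.of_shifts (h : ∀ ε > 0, ∀ l, ∃ τ ∈ shifts J ε, τ < -l) :
    ReturnsInPast J := fun t ε l hε => by
  obtain ⟨τ, hτ, hl⟩ := h (min ε (1 / (|t| + 1))) (by positivity) l
  refine ⟨τ, hl, ?_⟩
  have := dist_lt_of_cdist_lt hτ (by positivity : 0 < |t| + 1) (min_le_right _ _)
    (t := t) (by linarith)
  rw [translate_apply, add_comm τ t] at this
  exact this.trans_le (min_le_left _ _)

theorem ReturnsInPast.of_almostPeriods (h : ∀ ε > 0, ∀ l, ∃ τ ∈ almostPeriods J ε, τ < -l) :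
    ReturnsInPast J := fun t ε l hε => by
  obtain ⟨τ, hτ, hl⟩ := h ε hε l
  exact ⟨τ, hl, hτ t⟩

theorem IsPeriodic.returnsInPast {τ : ℝ} (hτ : τ ≠ 0) (hJ : IsPeriodic τ J) :
    ReturnsInPast J := by
  have hn : ∀ (n : ℕ) t, J (t + n * τ) = J t := by
    intro n
    induction n with
    | zero => simp
    | succ n ih =>
      intro t
      rw [Nat.cast_succ, add_mul, one_mul, ← add_assoc, hJ, ih]
  have hn' : ∀ (n : ℕ) t, J (t + -(n * τ)) = J t := fun n t => by
    have := hn n (t + -(n * τ))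
    rw [neg_add_cancel_right] at this
    exact this.symm
  intro t ε l hε
  obtain ⟨n, hn1⟩ := exists_nat_gt (l / |τ|)
  have hpos : 0 < |τ| := abs_pos.2 hτ
  rw [div_lt_iff₀ hpos] at hn1
  refine ⟨-(n * |τ|), by linarith, ?_⟩
  rcases abs_choice τ with h | h
  · rw [h, hn', dist_self]; exact hε
  · rw [h, mul_neg, neg_neg, hn, dist_self]; exact hε

theorem IsStationary.returnsInPast (hJ : IsStationary J) : ReturnsInPast J :=
  IsPeriodic.returnsInPast one_ne_zero fun t => by rw [hJ (t + 1), hJ t]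

theorem IsBohrAlmostPeriodic.returnsInPast (hJ : IsBohrAlmostPeriodic J) : ReturnsInPast J :=
  .of_almostPeriods fun ε hε l => (hJ ε hε).exists_lt l

theorem IsAlmostRecurrent.returnsInPast (hJ : IsAlmostRecurrent J) : ReturnsInPast J :=
  .of_shifts fun ε hε l => (hJ ε hε).exists_lt l

theorem IsLevitanAlmostPeriodic.returnsInPast (hJ : IsLevitanAlmostPeriodic J) :
    ReturnsInPast J := by
  obtain ⟨Z, i1, i2, ψ, hψ, H⟩ := hJ
  refine .of_shifts fun ε hε l => ?_
  obtain ⟨δ, hδ, h1⟩ := H ε hε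
  obtain ⟨τ, hτ, hl⟩ := (hψ δ hδ).exists_lt l
  exact ⟨τ, h1 hτ, hl⟩

theorem IsPoissonStable.returnsInPast (hJ : IsPoissonStable J) : ReturnsInPast J :=
  .of_shifts fun ε hε l => by
    obtain ⟨-, τ, hτ, hl⟩ := hJ ε (max l 1) hε (by positivity)
    exact ⟨τ, hτ, by linarith [le_max_left l 1]⟩

theorem IsPseudoPeriodic.returnsInPast (hJ : IsPseudoPeriodic J) : ReturnsInPast J :=
  .of_almostPeriods fun ε hε l => by
    obtain ⟨-, τ, hτ, hl⟩ := hJ ε (max l 1) hε (by positivity)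
    exact ⟨τ, hτ, by linarith [le_max_left l 1]⟩

/-- With base point `t`, evaluate the estimate at `-τ`, which compares `J t` with `J (t - τ)`. A
point `-τ` arbitrarily far to the left belongs to the half-line but not to a bounded window, and
this is why the window variant needs an additional hypothesis. -/
theorem IsPseudoRecurrent.returnsInPast (hJ : IsPseudoRecurrent J) : ReturnsInPast J := by
  intro t ε l hε
  obtain ⟨L, -, H⟩ := hJ (ε / 2) (max l 0 + 1) (half_pos hε)
  obtain ⟨τ, hτ, h1⟩ := H t
  have h2 := h1 (-τ) (by
    have : 0 < 1 / (ε / 2) := by positivity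
    linarith [hτ.1, le_max_right l 0])
  refine ⟨-τ, by linarith [hτ.1, le_max_left l 0], ?_⟩
  rw [dist_comm, add_comm t (-τ)]
  have e : -τ + t + τ = t := by ring
  rw [e] at h2
  exact h2.trans_lt (half_lt_self hε)

/-- The periods of `Φ` form a subgroup, which contains the lattice spanned by the `2 * π`-multiples
of the basis vectors. -/
theorem apply_add_int {k : ℕ} {Φ : C(Fin k → ℝ, X)}
    (hΦ : ∀ (θ : Fin k → ℝ) (i : Fin k), Φ (θ + Pi.single i (2 * Real.pi)) = Φ θ)
    (m : Fin k → ℤ) (θ : Fin k → ℝ) : Φ (θ + fun i => m i * (2 * Real.pi)) = Φ θ := by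
  let G : AddSubgroup (Fin k → ℝ) :=
    { carrier := {v | ∀ θ, Φ (θ + v) = Φ θ}
      zero_mem' := fun θ => by rw [add_zero]
      add_mem' := fun {v w} hv hw θ => by rw [← add_assoc, hw, hv]
      neg_mem' := fun {v} hv θ => by
        have := hv (θ + -v)
        rw [neg_add_cancel_right] at this
        exact this.symm }
  have h1 : ∑ i, m i • (Pi.single i (2 * Real.pi) : Fin k → ℝ) ∈ G :=
    G.sum_mem fun i _ => G.zsmul_mem (fun θ => hΦ θ i) _
  have h2 : ∑ i, m i • (Pi.single i (2 * Real.pi) : Fin k → ℝ) = fun i => m i * (2 * Real.pi) := by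
    funext j
    simp [Finset.sum_apply, Pi.single_apply]
  rw [h2] at h1
  exact h1 θ

theorem exists_mem_Icc_apply_eq {k : ℕ} {Φ : C(Fin k → ℝ, X)}
    (hΦ : ∀ (θ : Fin k → ℝ) (i : Fin k), Φ (θ + Pi.single i (2 * Real.pi)) = Φ θ)
    (θ : Fin k → ℝ) : ∃ θ' ∈ Set.Icc (0 : Fin k → ℝ) (fun _ => 2 * Real.pi),
      ∀ η, Φ (η + θ') = Φ (η + θ) := by
  have hpos : (0 : ℝ) < 2 * Real.pi := by positivity
  refine ⟨θ + fun i => ((-⌊θ i / (2 * Real.pi)⌋ : ℤ) : ℝ) * (2 * Real.pi), ⟨fun i => ?_, fun i => ?_⟩,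
    fun η => ?_⟩
  · have := Int.floor_le (θ i / (2 * Real.pi))
    rw [le_div_iff₀ hpos] at this
    simp only [Pi.zero_apply, Pi.add_apply]
    push_cast
    linarith
  · have := (Int.lt_floor_add_one (θ i / (2 * Real.pi))).le
    rw [div_le_iff₀ hpos] at this
    simp only [Pi.add_apply]
    push_cast
    linarith
  · rw [← add_assoc, apply_add_int hΦ (fun i => -⌊θ i / (2 * Real.pi)⌋)]

/-- In the remote past a quasi-periodic function approaches a translate of its torus function. -/
theorem IsQuasiPeriodic.exists_limit {k : ℕ} {ν : Fin k → ℝ} {Φ : C(Fin k → ℝ, X)}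
    (hΦ : ∀ (θ : Fin k → ℝ) (i : Fin k), Φ (θ + Pi.single i (2 * Real.pi)) = Φ θ) :
    ∃ (θ : Fin k → ℝ) (n : ℕ → ℕ), StrictMono n ∧
      (∀ η, Tendsto (fun j => Φ (η - fun i => ν i * (n j : ℝ))) atTop (𝓝 (Φ (η + θ)))) ∧
      (∀ η, Tendsto (fun j => Φ (η + (fun i => ν i * (n j : ℝ)) + θ)) atTop (𝓝 (Φ η))) := by
  -- Reduce the phases `-ν * n` modulo `2 * π` into a compact cube; `θ` is the limit of a
  -- subsequence of the reduced phases.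
  choose x hx hxe using fun n : ℕ => exists_mem_Icc_apply_eq hΦ (-fun i => ν i * (n : ℝ))
  obtain ⟨θ, -, n, hn, hlim⟩ := isCompact_Icc.tendsto_subseq hx
  refine ⟨θ, n, hn, fun η => ?_, fun η => ?_⟩
  · have := ((map_continuous Φ).tendsto _).comp (tendsto_const_nhds (x := η) |>.add hlim)
    refine this.congr fun j => ?_
    simp only [Function.comp_apply]
    rw [hxe, sub_eq_add_neg]
  · have h1 := ((map_continuous Φ).tendsto _).comp
      (tendsto_const_nhds (x := η + θ) |>.sub hlim)
    rw [add_sub_cancel_right] at h1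
    refine h1.congr fun j => ?_
    simp only [Function.comp_apply]
    have h2 := hxe (n j) (η + θ - x (n j) + fun i => ν i * (n j : ℝ))
    rw [add_neg_cancel_right] at h2
    rw [← h2]
    congr 1
    abel

end Recur

/-! ## Cylindrical fractional noise in `L²(P, E)` and its stochastic integral -/

namespace FBM

variable {Ω : Type*} [MeasurableSpace Ω] {P : Measure Ω}
variable {E : Type*} [NormedAddCommGroup E] [InnerProductSpace ℝ E]

/-- The random vector `b ⊗ x = b(·) x`. -/
noncomputable def tens (b : Lp ℝ 2 P) : E →L[ℝ] Lp E 2 P :=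
  ((ContinuousLinearMap.lsmul ℝ ℝ).flip.compLpL₂ 2 P).flip b

theorem coeFn_tens (b : Lp ℝ 2 P) (x : E) : tens b x =ᵐ[P] fun ω => b ω • x := by
  filter_upwards [ContinuousLinearMap.coeFn_compLp
    ((ContinuousLinearMap.lsmul ℝ ℝ : ℝ →L[ℝ] E →L[ℝ] E).flip x) b] with ω h
  exact h

theorem tens_sub (b c : Lp ℝ 2 P) (x : E) : tens (b - c) x = tens b x - tens c x := by
  simp only [tens, map_sub, sub_apply]

theorem tens_smul (r : ℝ) (b : Lp ℝ 2 P) (x : E) : tens (r • b) x = r • tens b x := by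
  simp only [tens, map_smul, smul_apply]

theorem inner_tens (b c : Lp ℝ 2 P) (x y : E) : ⟪tens b x, tens c y⟫ = ⟪b, c⟫ * ⟪x, y⟫ := by
  rw [L2.inner_def, L2.inner_def, ← integral_mul_const]
  refine integral_congr_ae ?_
  filter_upwards [coeFn_tens b x, coeFn_tens c y] with ω h1 h2
  rw [h1, h2, real_inner_smul_left, real_inner_smul_right]
  simp only [RCLike.inner_apply, conj_trivial]
  ring

theorem norm_tens (b : Lp ℝ 2 P) (x : E) : ‖tens b x‖ = ‖b‖ * ‖x‖ := by
  have h := inner_tens b b x x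
  rw [real_inner_self_eq_norm_sq, real_inner_self_eq_norm_sq, real_inner_self_eq_norm_sq,
    ← mul_pow] at h
  exact (pow_left_inj₀ (norm_nonneg _) (by positivity) two_ne_zero).1 h

theorem onLp_tens (S : ℝ → E →L[ℝ] E) (r : ℝ) (b : Lp ℝ 2 P) (x : E) :
    Evol.onLp P S r (tens b x) = tens b (S r x) := by
  ext
  filter_upwards [ContinuousLinearMap.coeFn_compLpL (p := 2) (μ := P) (S r) (tens b x),
    coeFn_tens b x, coeFn_tens b (S r x)] with ω h1 h2 h3
  rw [Evol.onLp, h1, h2, h3, map_smul]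

/-- The covariances of independent fractional Brownian motions. -/
structure IsFamily {ι : Type*} (h : ℝ) (b : ι → ℝ → Lp ℝ 2 P) : Prop where
  self : ∀ n s t, ⟪b n s, b n t⟫ = cov h s t
  ne : ∀ n m, n ≠ m → ∀ s t, ⟪b n s, b m t⟫ = 0

variable {ι : Type*} {h : ℝ} {b : ι → ℝ → Lp ℝ 2 P}

theorem IsFamily.isNoise (hb : IsFamily h b) (n : ι) :
    IsNoise h (fun t => (tens (b n t) : E →L[ℝ] Lp E 2 P)) := fun s t x y => by
  rw [inner_tens, hb.self]

theorem cov_self {h : ℝ} (hh : 1 / 2 < h) (t : ℝ) : cov h t t = |t| ^ (2 * h) := by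
  rw [cov, sub_self, abs_zero, Real.zero_rpow (by linarith)]
  ring

/-- `B t` is the cylindrical noise `∑ b_n(t) ⊗ e_n`. -/
def IsCylindrical (b : ι → ℝ → Lp ℝ 2 P)
    (B : ℝ → lp (fun _ : ι => E) 2 →L[ℝ] Lp E 2 P) : Prop :=
  ∀ t x, HasSum (fun n => tens (b n t) (x n)) (B t x)

/-- After division by `|t| ^ h` the maps `x ↦ b n t ⊗ x` are isometries with pairwise orthogonal
ranges. Hence the series converges for every square summable family and defines `|t| ^ h` times an
isometry; at `t = 0` the noise vanishes. -/
theorem IsFamily.exists_isCylindrical [CompleteSpace E] (hh : 1 / 2 < h) (hb : IsFamily h b) :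
    ∃ B : ℝ → lp (fun _ : ι => E) 2 →L[ℝ] Lp E 2 P, IsCylindrical b B := by
  suffices H : ∀ t, ∃ B : lp (fun _ : ι => E) 2 →L[ℝ] Lp E 2 P,
      ∀ x, HasSum (fun n => tens (b n t) (x n)) (B x) by
    choose B hB using H
    exact ⟨B, hB⟩
  intro t
  have hnorm : ∀ n, ‖b n t‖ ^ 2 = |t| ^ (2 * h) := fun n => by
    rw [← real_inner_self_eq_norm_sq, hb.self, cov_self hh]
  rcases eq_or_ne t 0 with rfl | ht
  · refine ⟨0, fun x => ?_⟩
    have : ∀ n, b n 0 = 0 := fun n => by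
      have := hnorm n
      rw [abs_zero, Real.zero_rpow (by linarith)] at this
      exact norm_eq_zero.1 (pow_eq_zero_iff two_ne_zero |>.1 this)
    simp only [this, zero_apply]
    convert! hasSum_zero with n
    exact norm_eq_zero.1 (by rw [norm_tens, norm_zero, zero_mul])
  · set c : ℝ := |t| ^ h
    have hc : 0 < c := Real.rpow_pos_of_pos (abs_pos.2 ht) _
    have hnorm' : ∀ n, ‖b n t‖ = c := fun n => by
      refine (pow_left_inj₀ (norm_nonneg _) hc.le two_ne_zero).1 ?_
      rw [hnorm, ← Real.rpow_natCast, ← Real.rpow_mul (abs_nonneg t), mul_comm]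
      norm_num
    let V : ι → E →ₗᵢ[ℝ] Lp E 2 P := fun n =>
      { toLinearMap := (tens (c⁻¹ • b n t) : E →L[ℝ] Lp E 2 P)
        norm_map' := fun x => by
          change ‖tens (c⁻¹ • b n t) x‖ = _
          rw [norm_tens, norm_smul, hnorm', norm_inv, Real.norm_of_nonneg hc.le,
            inv_mul_cancel₀ hc.ne', one_mul] }
    have hV : OrthogonalFamily ℝ (fun _ : ι => E) V := fun n m hnm x y => by
      change ⟪tens (c⁻¹ • b n t) x, tens (c⁻¹ • b m t) y⟫ = 0
      rw [inner_tens, real_inner_smul_left, real_inner_smul_right, hb.ne n m hnm]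
      simp
    refine ⟨c • hV.linearIsometry.toContinuousLinearMap, fun x => ?_⟩
    have h1 := (hV.hasSum_linearIsometry x).const_smul c
    convert! h1 using 2 with n
    change _ = c • tens (c⁻¹ • b n t) (x n)
    rw [tens_smul, smul_smul, mul_inv_cancel₀ hc.ne', one_smul]

variable {B : ℝ → lp (fun _ : ι => E) 2 →L[ℝ] Lp E 2 P}

theorem coe_single_self [DecidableEq ι] (n : ι) (x : E) :
    (lp.single 2 n x : lp (fun _ : ι => E) 2) n = x :=
  lp.single_apply_self (E := fun _ : ι => E) 2 n x

theorem coe_single_ne [DecidableEq ι] {n m : ι} (hm : m ≠ n) (x : E) :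
    (lp.single 2 n x : lp (fun _ : ι => E) 2) m = 0 :=
  lp.single_apply_ne (E := fun _ : ι => E) 2 n x hm

theorem IsCylindrical.single (hB : IsCylindrical b B) [DecidableEq ι] (t : ℝ) (n : ι) (x : E) :
    B t (lp.single 2 n x) = tens (b n t) x := by
  have h1 := hasSum_single (f := fun m => tens (b m t)
    ((lp.single 2 n x : lp (fun _ : ι => E) 2) m)) n fun m hm => by
      beta_reduce
      rw [coe_single_ne hm, map_zero]
  have h2 := (hB t _).unique h1
  rw [h2]
  exact congrArg _ (coe_single_self n x)

/-- Expand both series: orthogonality of different components leaves the diagonal terms, which carry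
the common factor `cov h s t`. -/
theorem IsCylindrical.isNoise (hb : IsFamily h b) (hB : IsCylindrical b B) : IsNoise h B := by
  intro s t x y
  have h1 : HasSum (fun n => ⟪tens (b n s) (x n), B t y⟫) ⟪B s x, B t y⟫ := by
    have := (hB s x).mapL (innerSL ℝ (B t y))
    simpa only [innerSL_apply_apply, real_inner_comm] using this
  have h2 : ∀ n, ⟪tens (b n s) (x n), B t y⟫ = cov h s t * ⟪x n, y n⟫ := fun n => by
    have h3 : HasSum (fun m => ⟪tens (b n s) (x n), tens (b m t) (y m)⟫)
        ⟪tens (b n s) (x n), B t y⟫ := by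
      have := (hB t y).mapL (innerSL ℝ (tens (b n s) (x n)))
      simpa only [innerSL_apply_apply] using this
    have h4 : HasSum (fun m => ⟪tens (b n s) (x n), tens (b m t) (y m)⟫)
        ⟪tens (b n s) (x n), tens (b n t) (y n)⟫ :=
      hasSum_single n fun m hm => by
        rw [inner_tens, hb.ne n m hm.symm, zero_mul]
    rw [h3.unique h4, inner_tens, hb.self]
  have h5 : HasSum (fun n => cov h s t * ⟪x n, y n⟫) ⟪B s x, B t y⟫ :=
    h1.congr_fun fun n => (h2 n).symm
  have h6 : HasSum (fun n => ⟪x n, y n⟫) ⟪x, y⟫ := lp.hasSum_inner x y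
  exact h5.unique (h6.mul_left _)

theorem IsCylindrical.comm (hB : IsCylindrical b B) (S : ℝ → E →L[ℝ] E) (r s : ℝ)
    (x : lp (fun _ : ι => E) 2) : Evol.onLp P S r (B s x) = B s (Evol.onSeq ι S r x) := by
  have h1 := (hB s x).mapL (Evol.onLp P S r)
  simp only [onLp_tens] at h1
  exact h1.unique (hB s (Evol.onSeq ι S r x))

theorem IsCylindrical.shift (hB : IsCylindrical b B) (τ : ℝ) :
    IsCylindrical (fun n t => b n (t + τ) - b n τ) (shiftNoise B τ) := fun t x => by
  simp only [tens_sub, shiftNoise, sub_apply]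
  exact (hB _ x).sub (hB _ x)

theorem IsCylindrical.isSystem [IsProbabilityMeasure P] (hh : 1 / 2 < h) (hb : IsFamily h b)
    (hB : IsCylindrical b B) {N α : ℝ} {S : ℝ → E →L[ℝ] E} (hS : Evol.IsStable N α S) :
    Evol.IsSystem h N α (Evol.onLp P S) (Evol.onSeq ι S) B where
  hh := hh
  stable := hS.onLp P
  stable' := hS.onSeq ι
  noise := hB.isNoise hb
  comm := hB.comm S

end FBM

namespace FBM

variable {Ω : Type*} [MeasurableSpace Ω] {P : Measure Ω}
variable {E : Type*} [NormedAddCommGroup E] [InnerProductSpace ℝ E] {h : ℝ}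

/-! ### Step functions -/

variable {a c : ℝ}

theorem Step.toFun_eq (ψ : Step E a c) {i : ℕ} (hi : i < ψ.n) {s : ℝ}
    (hs : s ∈ Set.Ioc (ψ.t i) (ψ.t (i + 1))) : ψ.toFun s = ψ.x i := by
  rw [Step.toFun, Finset.sum_eq_single i]
  · rw [Set.indicator_of_mem hs]
  · intro j _ hj
    refine Set.indicator_of_notMem (fun hsj => ?_) _
    exact Set.disjoint_left.1 (ψ.mono.pairwise_disjoint_on_Ioc_succ hj) hsj hs
  · intro hn
    exact absurd (Finset.mem_range.2 hi) hn

theorem Step.exists_mem (ψ : Step E a c) {s : ℝ} (hs : s ∈ Set.Ioc a c) :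
    ∃ i < ψ.n, s ∈ Set.Ioc (ψ.t i) (ψ.t (i + 1)) := by
  have h1 := ψ.mono.biUnion_Ico_Ioc_map_succ 0 ψ.n
  rw [ψ.left, ψ.right] at h1
  rw [← h1] at hs
  simp only [Set.mem_iUnion] at hs
  obtain ⟨i, hi, h2⟩ := hs
  exact ⟨i, hi.2, h2⟩

/-- The integral of a step function as an element of `L²`. -/
noncomputable def Step.integralLp (ψ : Step E a c) (b : ℝ → Lp ℝ 2 P) : Lp E 2 P :=
  ∑ i ∈ Finset.range ψ.n, tens (b (ψ.t (i + 1)) - b (ψ.t i)) (ψ.x i)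

theorem Step.coeFn_integralLp (ψ : Step E a c) {b : ℝ → Lp ℝ 2 P} {β : ℝ → Ω → ℝ}
    (hβ : ∀ t, b t =ᵐ[P] β t) : ψ.integralLp b =ᵐ[P] ψ.integral β := by
  have h1 : ∀ i, (tens (b (ψ.t (i + 1)) - b (ψ.t i)) (ψ.x i) : Lp E 2 P)
      =ᵐ[P] fun ω => (β (ψ.t (i + 1)) ω - β (ψ.t i) ω) • ψ.x i := by
    intro i
    filter_upwards [Lp.coeFn_sub (b (ψ.t (i + 1))) (b (ψ.t i)),
      coeFn_tens (b (ψ.t (i + 1)) - b (ψ.t i)) (ψ.x i), hβ (ψ.t (i + 1)),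
      hβ (ψ.t i)] with ω e1 e2 e3 e4
    rw [e2, e1, Pi.sub_apply, e3, e4]
  have h2 : ∀ s : Finset ℕ,
      (∑ i ∈ s, tens (b (ψ.t (i + 1)) - b (ψ.t i)) (ψ.x i) : Lp E 2 P)
      =ᵐ[P] fun ω => ∑ i ∈ s, (β (ψ.t (i + 1)) ω - β (ψ.t i) ω) • ψ.x i := by
    intro s
    induction s using Finset.cons_induction with
    | empty =>
      filter_upwards [Lp.coeFn_zero E 2 P] with ω h0
      simpa only [Finset.sum_empty, Pi.zero_apply] using h0
    | cons i s hi ih =>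
      simp only [Finset.sum_cons]
      filter_upwards [Lp.coeFn_add (tens (b (ψ.t (i + 1)) - b (ψ.t i)) (ψ.x i) : Lp E 2 P)
        (∑ i ∈ s, tens (b (ψ.t (i + 1)) - b (ψ.t i)) (ψ.x i)), h1 i, ih] with ω e1 e2 e3
      rw [e1, Pi.add_apply, e2, e3]
  exact h2 _

theorem isWienerIntegral_iff {b : ℝ → Lp ℝ 2 P} {β : ℝ → Ω → ℝ}
    (hβ : ∀ t, b t =ᵐ[P] β t) {φ : ℝ → E} {y : Lp E 2 P} :
    IsWienerIntegral P h β φ a c y ↔ ∃ ψ : ℕ → Step E a c,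
      Tendsto (fun k => eLpNorm (fun s => (ψ k).toFun s - φ s) (ENNReal.ofReal (1 / h))
        (volume.restrict (Set.Icc a c))) atTop (𝓝 0) ∧
      Tendsto (fun k => (ψ k).integralLp b) atTop (𝓝 y) := by
  refine exists_congr fun ψ => and_congr_right fun _ => ?_
  rw [Lp.tendsto_Lp_iff_tendsto_eLpNorm']
  refine tendsto_congr fun k => eLpNorm_congr_ae ?_
  filter_upwards [(ψ k).coeFn_integralLp hβ] with ω hω
  rw [Pi.sub_apply, hω]

/-- The step functions taking the left endpoint values on uniform partitions converge uniformly to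
`φ`, hence in `L^{1/h}`, and their integrals are exactly the Riemann sums. -/
theorem isWienerIntegral_integral [CompleteSpace E] (hh : 1 / 2 < h)
    {b : ℝ → Lp ℝ 2 P} (hb : IsNoise h (fun t => (tens (b t) : E →L[ℝ] Lp E 2 P)))
    {β : ℝ → Ω → ℝ} (hβ : ∀ t, b t =ᵐ[P] β t) (hac : a ≤ c) {φ : ℝ → E}
    (hφ : ContinuousOn φ (Set.Icc a c)) :
    IsWienerIntegral P h β φ a c (FBM.integral (fun t => tens (b t)) φ a c) := by
  rw [isWienerIntegral_iff hβ]
  have hp := fun k : ℕ => isPart_upart hac (n := k + 1) (by omega)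
  set ψ : ℕ → Step E a c := fun k =>
    { n := k + 1
      t := upart a c (k + 1)
      mono := (hp k).mono
      left := (hp k).left
      right := (hp k).right
      x := fun i => φ (upart a c (k + 1) i) }
  have h2 : ∀ k, (ψ k).integralLp b
      = rsum (fun t => (tens (b t) : E →L[ℝ] Lp E 2 P)) φ (upart a c (k + 1)) (k + 1) := fun k =>
    Finset.sum_congr rfl fun i _ => tens_sub _ _ _
  refine ⟨ψ, ?_, (hb.tendsto_integral hh hac hφ).congr fun k => (h2 k).symm⟩
  set μ := volume.restrict (Set.Icc a c)
  set C := μ Set.univ ^ (ENNReal.ofReal (1 / h)).toReal⁻¹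
  have hC : C ≠ ∞ := ENNReal.rpow_ne_top_of_nonneg (by positivity) (measure_ne_top _ _)
  have hlim : Tendsto (fun η : ℝ => C * ENNReal.ofReal η) (𝓝[>] 0) (𝓝 0) := by
    have h1 : Tendsto (fun η : ℝ => C * ENNReal.ofReal η) (𝓝 0) (𝓝 (C * ENNReal.ofReal 0)) :=
      ENNReal.Tendsto.const_mul (ENNReal.continuous_ofReal.tendsto 0) (Or.inr hC)
    rw [ENNReal.ofReal_zero, mul_zero] at h1
    exact h1.mono_left nhdsWithin_le_nhds
  rw [ENNReal.tendsto_nhds_zero]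
  intro ε hε
  obtain ⟨η, hη, hη0⟩ := ((ENNReal.tendsto_nhds_zero.1 hlim ε hε).and self_mem_nhdsWithin).exists
  obtain ⟨δ, hδ, H⟩ := exists_modulus hφ hη0
  filter_upwards [eventually_mesh_le a c hδ] with k hk
  refine (eLpNorm_le_of_ae_bound (C := η) ?_).trans hη
  -- Step functions live on half-open intervals and miss the point `a`, a null set.
  have h0 : ∀ᵐ s ∂μ, s ∈ Set.Ioc a c := by
    have : μ = volume.restrict (Set.Ioc a c) := (restrict_Ioc_eq_restrict_Icc).symm
    rw [this]
    exact ae_restrict_mem measurableSet_Ioc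
  filter_upwards [h0] with s hs
  obtain ⟨i, hi, hsi⟩ := (ψ k).exists_mem hs
  rw [(ψ k).toFun_eq hi hsi]
  refine H _ ((hp k).mem hi.le) _ (Set.Ioc_subset_Icc_self hs) ?_
  have h1 := upart_mesh hac (k + 1) i
  have h2 : upart a c (k + 1) i < s := hsi.1
  have h3 : s ≤ upart a c (k + 1) (i + 1) := hsi.2
  rw [abs_le]
  constructor <;> linarith

/-- The derivative of the covariance in its first argument. -/
noncomputable def covDeriv (h d s : ℝ) : ℝ :=
  1 / 2 * (2 * h * |s| ^ (2 * h - 2) * s - 2 * h * |s - d| ^ (2 * h - 2) * (s - d))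

theorem hasDerivAt_cov {h : ℝ} (hh : 1 / 2 < h) (d s : ℝ) :
    HasDerivAt (fun s => cov h s d) (covDeriv h d s) s := by
  have h1 := hasDerivAt_abs_rpow s (p := 2 * h) (by linarith)
  have h2 := (hasDerivAt_abs_rpow (s - d) (p := 2 * h) (by linarith)).comp s
    ((hasDerivAt_id s).sub_const d)
  rw [mul_one] at h2
  exact (((h1.add_const (|d| ^ (2 * h))).sub h2).const_mul (1 / 2 : ℝ))

/-- The exponent `2 * h - 2` is negative, so continuity at the origin is not visible from the
formula; it is obtained because the expression is the derivative of the `C¹` function `|x| ^ (2 *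
h)`. -/
theorem continuous_covDeriv {h : ℝ} (hh : 1 / 2 < h) (d : ℝ) : Continuous (covDeriv h d) := by
  have h1 : Continuous fun x : ℝ => 2 * h * |x| ^ (2 * h - 2) * x := by
    have h2 : ContDiff ℝ 1 fun x : ℝ => ‖x‖ ^ (2 * h) := contDiff_norm_rpow (by linarith)
    refine (h2.continuous_deriv le_rfl).congr fun x => ?_
    exact (hasDerivAt_abs_rpow x (by linarith)).deriv
  exact continuous_const.mul (h1.sub (h1.comp (continuous_id.sub continuous_const)))

/-- The fundamental theorem of calculus on each piece of the step function. The right side is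
continuous in `ψ.toFun` for the `L¹` norm, which lets correlations with the noise pass to the limit
in the definition of the Wiener integral. -/
theorem inner_integralLp (hh : 1 / 2 < h) {b : ℝ → Lp ℝ 2 P}
    (hb : ∀ s t, ⟪b s, b t⟫ = cov h s t) (ψ : Step E a c) (d : ℝ) (v : E) :
    ⟪ψ.integralLp b, tens (b d) v⟫
      = ∫ s in Set.Icc a c, ⟪ψ.toFun s, v⟫ * covDeriv h d s := by
  have hac : a ≤ c := by
    have := ψ.mono (Nat.zero_le ψ.n)
    rwa [ψ.left, ψ.right] at this
  have hint : ∀ u w, IntervalIntegrable (covDeriv h d) volume u w := fun u w =>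
    (continuous_covDeriv hh d).intervalIntegrable u w
  have e1 : ∀ i, ∫ s in ψ.t i..ψ.t (i + 1), ⟪ψ.x i, v⟫ * covDeriv h d s
      = (cov h (ψ.t (i + 1)) d - cov h (ψ.t i) d) * ⟪ψ.x i, v⟫ := fun i => by
    rw [intervalIntegral.integral_const_mul, intervalIntegral.integral_eq_sub_of_hasDerivAt
      (fun s _ => hasDerivAt_cov hh d s) (hint _ _), mul_comm]
  have e2 : ∀ i ∈ Finset.range ψ.n, ∫ s in ψ.t i..ψ.t (i + 1), ⟪ψ.toFun s, v⟫ * covDeriv h d s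
      = ∫ s in ψ.t i..ψ.t (i + 1), ⟪ψ.x i, v⟫ * covDeriv h d s := fun i hi => by
    refine intervalIntegral.integral_congr_ae (Eventually.of_forall fun s hs => ?_)
    rw [Set.uIoc_of_le (ψ.mono (Nat.le_succ i))] at hs
    rw [ψ.toFun_eq (Finset.mem_range.1 hi) hs]
  have hI : ∀ i < ψ.n, IntervalIntegrable (fun s => ⟪ψ.toFun s, v⟫ * covDeriv h d s) volume
      (ψ.t i) (ψ.t (i + 1)) := fun i hi => by
    refine ((hint (ψ.t i) (ψ.t (i + 1))).const_mul ⟪ψ.x i, v⟫).congr fun s hs => ?_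
    rw [Set.uIoc_of_le (ψ.mono (Nat.le_succ i))] at hs
    rw [ψ.toFun_eq hi hs]
  rw [integral_Icc_eq_integral_Ioc, ← intervalIntegral.integral_of_le hac]
  have e3 := intervalIntegral.sum_integral_adjacent_intervals (μ := volume) hI
  rw [ψ.left, ψ.right] at e3
  rw [← e3, Finset.sum_congr rfl e2, Step.integralLp, sum_inner]
  refine Finset.sum_congr rfl fun i _ => ?_
  rw [e1, tens_sub, inner_sub_left, inner_tens, inner_tens, hb, hb]
  ring

theorem Step.measurable_toFun [MeasurableSpace E] [BorelSpace E] (ψ : Step E a c) :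
    StronglyMeasurable ψ.toFun := by
  have : ψ.toFun = ∑ i ∈ Finset.range ψ.n,
      (Set.Ioc (ψ.t i) (ψ.t (i + 1))).indicator (fun _ => ψ.x i) := by
    funext s
    rw [Step.toFun, Finset.sum_apply]
  rw [this]
  exact Finset.stronglyMeasurable_sum _ fun i _ =>
    stronglyMeasurable_const.indicator measurableSet_Ioc

theorem Step.norm_toFun_le (ψ : Step E a c) (s : ℝ) :
    ‖ψ.toFun s‖ ≤ ∑ i ∈ Finset.range ψ.n, ‖ψ.x i‖ :=
  (norm_sum_le _ _).trans (Finset.sum_le_sum fun _ _ => norm_indicator_le_norm_self _ _)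

/-- The Wiener integral of a continuous function is unique. -/
theorem IsWienerIntegral.unique [MeasurableSpace E] [BorelSpace E] [CompleteSpace E]
    (hh : 1 / 2 < h) (hh1 : h < 1) {b : ℝ → Lp ℝ 2 P}
    (hb : ∀ s t, ⟪b s, b t⟫ = cov h s t) {β : ℝ → Ω → ℝ} (hβ : ∀ t, b t =ᵐ[P] β t) {φ : ℝ → E}
    (hφ : ContinuousOn φ (Set.Icc a c)) {y z : Lp E 2 P}
    (hy : IsWienerIntegral P h β φ a c y) (hz : IsWienerIntegral P h β φ a c z) : y = z := by
  rw [isWienerIntegral_iff hβ] at hy hz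
  -- Wiener integrals lie in the closed span of the noise, and a vector of this span is determined
  -- by its inner products with the generators.
  set W : Submodule ℝ (Lp E 2 P) :=
    (Submodule.span ℝ {x | ∃ (d : ℝ) (v : E), tens (b d) v = x}).topologicalClosure
  have hgen : ∀ d v, (tens (b d) v : Lp E 2 P) ∈ W := fun d v =>
    Submodule.le_topologicalClosure _ (Submodule.subset_span ⟨d, v, rfl⟩)
  have key : ∀ y : Lp E 2 P, (∃ ψ : ℕ → Step E a c,
      Tendsto (fun k => eLpNorm (fun s => (ψ k).toFun s - φ s) (ENNReal.ofReal (1 / h))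
        (volume.restrict (Set.Icc a c))) atTop (𝓝 0) ∧
      Tendsto (fun k => (ψ k).integralLp b) atTop (𝓝 y)) → y ∈ W ∧
      ∀ d v, ⟪y, tens (b d) v⟫ = ∫ s in Set.Icc a c, ⟪φ s, v⟫ * covDeriv h d s := by
    rintro y ⟨ψ, h1, h2⟩
    refine ⟨?_, fun d v => ?_⟩
    · refine (Submodule.isClosed_topologicalClosure _).mem_of_tendsto h2
        (Eventually.of_forall fun k => Submodule.sum_mem _ fun i _ => ?_)
      rw [tens_sub]
      exact W.sub_mem (hgen _ _) (hgen _ _)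
    · set μ := volume.restrict (Set.Icc a c)
      obtain ⟨C, hC⟩ := isCompact_Icc.exists_bound_of_continuousOn
        (continuous_covDeriv hh d).continuousOn (s := Set.Icc a c)
      have hφm : AEStronglyMeasurable φ μ := hφ.aestronglyMeasurable_of_isCompact
        isCompact_Icc measurableSet_Icc
      have hwm : AEStronglyMeasurable (covDeriv h d) μ :=
        (continuous_covDeriv hh d).aestronglyMeasurable
      have hmem : ∀ᵐ s ∂μ, s ∈ Set.Icc a c := ae_restrict_mem measurableSet_Icc
      have hlim : Tendsto (fun k => ⟪(ψ k).integralLp b, tens (b d) v⟫) atTop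
          (𝓝 (∫ s, ⟪φ s, v⟫ * covDeriv h d s ∂μ)) := by
        simp only [inner_integralLp hh hb]
        refine tendsto_integral_of_L1' _ ?_ (Eventually.of_forall fun k => ?_) ?_
        · have h3 : ContinuousOn (fun s => ⟪φ s, v⟫ * covDeriv h d s) (Set.Icc a c) :=
            (hφ.inner continuousOn_const).mul (continuous_covDeriv hh d).continuousOn
          exact (h3.integrableOn_Icc (μ := volume)).aestronglyMeasurable
        · refine Integrable.of_bound
            ((((ψ k).measurable_toFun.aestronglyMeasurable).inner
              aestronglyMeasurable_const).mul hwm)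
            ((∑ i ∈ Finset.range (ψ k).n, ‖(ψ k).x i‖) * ‖v‖ * C) ?_
          filter_upwards [hmem] with s hs
          rw [norm_mul]
          refine mul_le_mul ?_ (hC s hs) (norm_nonneg _) (by positivity)
          exact (norm_inner_le_norm _ _).trans
            (mul_le_mul_of_nonneg_right ((ψ k).norm_toFun_le s) (norm_nonneg _))
        · set D : ℝ≥0∞ := ENNReal.ofReal (‖v‖ * C) *
            μ Set.univ ^ (1 / (1 : ℝ≥0∞).toReal - 1 / (ENNReal.ofReal (1 / h)).toReal)
          -- As `h < 1`, convergence in `L^{1/h}` on the bounded interval implies convergence in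
          -- `L¹`, by Hölder.
          have hp1 : 1 ≤ ENNReal.ofReal (1 / h) := by
            rw [← ENNReal.ofReal_one]
            refine ENNReal.ofReal_le_ofReal ?_
            rw [le_div_iff₀ (by linarith)]
            linarith
          have hD : D ≠ ∞ := by
            refine ENNReal.mul_ne_top ENNReal.ofReal_ne_top
              (ENNReal.rpow_ne_top_of_nonneg ?_ (measure_ne_top _ _))
            rw [ENNReal.toReal_one, ENNReal.toReal_ofReal (by positivity), one_div_one_div]
            linarith
          have h3 := ENNReal.Tendsto.const_mul (a := D) h1 (Or.inr hD)
          rw [mul_zero] at h3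
          refine tendsto_of_tendsto_of_tendsto_of_le_of_le tendsto_const_nhds h3
            (fun _ => zero_le) fun k => ?_
          have hdm : AEStronglyMeasurable (fun s => (ψ k).toFun s - φ s) μ :=
            ((ψ k).measurable_toFun.aestronglyMeasurable).sub hφm
          calc eLpNorm ((fun s => ⟪(ψ k).toFun s, v⟫ * covDeriv h d s)
                - fun s => ⟪φ s, v⟫ * covDeriv h d s) 1 μ
              ≤ ENNReal.ofReal (‖v‖ * C) * eLpNorm (fun s => (ψ k).toFun s - φ s) 1 μ := by
                refine eLpNorm_le_mul_eLpNorm_of_ae_le_mul ?_ 1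
                filter_upwards [hmem] with s hs
                rw [Pi.sub_apply, ← sub_mul, ← inner_sub_left, norm_mul]
                calc ‖⟪(ψ k).toFun s - φ s, v⟫‖ * ‖covDeriv h d s‖
                    ≤ (‖(ψ k).toFun s - φ s‖ * ‖v‖) * C :=
                      mul_le_mul (norm_inner_le_norm _ _) (hC s hs) (norm_nonneg _) (by positivity)
                  _ = ‖v‖ * C * ‖(ψ k).toFun s - φ s‖ := by ring
            _ ≤ ENNReal.ofReal (‖v‖ * C) * (eLpNorm (fun s => (ψ k).toFun s - φ s)
                  (ENNReal.ofReal (1 / h)) μ * μ Set.univ ^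
                  (1 / (1 : ℝ≥0∞).toReal - 1 / (ENNReal.ofReal (1 / h)).toReal)) := by
                gcongr
                exact eLpNorm_le_eLpNorm_mul_rpow_measure_univ hp1 hdm
            _ = D * _ := by ring
      refine tendsto_nhds_unique ?_ hlim
      exact ((continuous_id.inner continuous_const).tendsto y).comp h2
  obtain ⟨y1, y2⟩ := key y hy
  obtain ⟨z1, z2⟩ := key z hz
  have hperp : W ≤ (ℝ ∙ (y - z))ᗮ := by
    refine Submodule.topologicalClosure_minimal _ (Submodule.span_le.2 ?_)
      (Submodule.isClosed_orthogonal _)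
    rintro _ ⟨d, v, rfl⟩
    rw [SetLike.mem_coe, Submodule.mem_orthogonal_singleton_iff_inner_right, inner_sub_left, y2, z2,
      sub_self]
  -- The vector `y - z` lies in `W` and is orthogonal to `W`.
  have h3 := hperp (W.sub_mem y1 z1)
  rw [Submodule.mem_orthogonal_singleton_iff_inner_right, inner_self_eq_zero] at h3
  exact sub_eq_zero.1 h3

end FBM

/-! ## The stochastic integral as a series of Wiener integrals; adaptedness -/

namespace FBM

variable {Ω : Type*} [MeasurableSpace Ω] {P : Measure Ω}
variable {E : Type*} [NormedAddCommGroup E] [InnerProductSpace ℝ E] {h : ℝ} {ι : Type*} {a c : ℝ}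

/-- A continuous curve in `ℓ²` is approximated by finitely many coordinates, uniformly on
compact intervals. -/
theorem eventually_norm_sub_sum_single_le [DecidableEq ι] {Φ : ℝ → lp (fun _ : ι => E) 2}
    (hΦ : ContinuousOn Φ (Set.Icc a c)) {ε : ℝ} (hε : 0 < ε) :
    ∀ᶠ s : Finset ι in atTop, ∀ t ∈ Set.Icc a c, ‖Φ t - ∑ n ∈ s, lp.single 2 n (Φ t n)‖ ≤ ε := by
  have h2 : (0 : ℝ) < (2 : ℝ≥0∞).toReal := by norm_num
  -- Dini's theorem: the partial sums of the squared coordinate norms are continuous and increase to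
  -- the continuous function `‖Φ t‖ ^ 2`.
  have hD := Monotone.tendstoUniformlyOn_of_forall_tendsto
    (F := fun (s : Finset ι) t => ∑ n ∈ s, ‖Φ t n‖ ^ (2 : ℝ≥0∞).toReal)
    (f := fun t => ‖Φ t‖ ^ (2 : ℝ≥0∞).toReal) isCompact_Icc
    (fun s => by
      refine continuousOn_finsetSum _ fun n _ => ContinuousOn.rpow_const ?_ fun _ _ => Or.inr h2.le
      exact ((lp.evalCLM ℝ (fun _ : ι => E) 2 n).continuous.comp_continuousOn hΦ).norm)
    (fun t _ s s' hss => Finset.sum_le_sum_of_subset_of_nonneg hss fun _ _ _ => by positivity)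
    (hΦ.norm.rpow_const fun _ _ => Or.inr h2.le) fun t _ => lp.hasSum_norm h2 (Φ t)
  filter_upwards [Metric.tendstoUniformlyOn_iff.1 hD (ε ^ 2) (by positivity)] with s hs t ht
  have h3 := hs t ht
  rw [Real.dist_eq, ← lp.norm_compl_sum_single h2] at h3
  have h4 := (le_abs_self _).trans h3.le
  rw [ENNReal.toReal_ofNat, Real.rpow_ofNat] at h4
  exact (pow_le_pow_iff_left₀ (norm_nonneg _) hε.le two_ne_zero).1 h4

variable {b : ι → ℝ → Lp ℝ 2 P} {B : ℝ → lp (fun _ : ι => E) 2 →L[ℝ] Lp E 2 P}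

theorem IsNoise.integral_zero {𝓗 𝓛 : Type*} [NormedAddCommGroup 𝓗] [InnerProductSpace ℝ 𝓗]
    [NormedAddCommGroup 𝓛] [InnerProductSpace ℝ 𝓛] [CompleteSpace 𝓛] (hh : 1 / 2 < h)
    {B : ℝ → 𝓗 →L[ℝ] 𝓛} (hB : IsNoise h B) (hac : a ≤ c) : integral B (fun _ => 0) a c = 0 := by
  have h1 := hB.norm_integral_le hh hac (Φ := fun _ => 0) continuousOn_const le_rfl
    (fun _ _ => by simp)
  rw [mul_zero] at h1
  exact norm_le_zero_iff.1 h1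

theorem IsNoise.integral_sum {𝓗 𝓛 : Type*} [NormedAddCommGroup 𝓗] [InnerProductSpace ℝ 𝓗]
    [NormedAddCommGroup 𝓛] [InnerProductSpace ℝ 𝓛] [CompleteSpace 𝓛] (hh : 1 / 2 < h)
    {B : ℝ → 𝓗 →L[ℝ] 𝓛} (hB : IsNoise h B) (hac : a ≤ c) {Φ : ι → ℝ → 𝓗}
    (hΦ : ∀ n, ContinuousOn (Φ n) (Set.Icc a c)) (s : Finset ι) :
    integral B (fun t => ∑ n ∈ s, Φ n t) a c = ∑ n ∈ s, integral B (Φ n) a c := by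
  induction s using Finset.cons_induction with
  | empty => simpa only [Finset.sum_empty] using hB.integral_zero hh hac
  | cons n s hn ih =>
    simp only [Finset.sum_cons]
    rw [← ih]
    exact hB.integral_add hh hac (hΦ n) (continuousOn_finsetSum _ fun n _ => hΦ n)

/-- Truncations of `Φ` to finitely many coordinates converge uniformly on `[a, c]`, and the integral
is bounded in the supremum norm. The integral of one coordinate against `b n` is the integral
against `B` of the family having only that coordinate. -/
theorem IsCylindrical.hasSum_integral [CompleteSpace E] (hh : 1 / 2 < h) (hb : IsFamily h b)
    (hB : IsCylindrical b B) (hac : a ≤ c) {Φ : ℝ → lp (fun _ : ι => E) 2}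
    (hΦ : ContinuousOn Φ (Set.Icc a c)) :
    HasSum (fun n => integral (fun t => (tens (b n t) : E →L[ℝ] Lp E 2 P)) (fun t => Φ t n) a c)
      (integral B Φ a c) := by
  classical
  have hN := hB.isNoise hb
  have hc : ∀ n, ContinuousOn (fun t => Φ t n) (Set.Icc a c) := fun n =>
    (lp.evalCLM ℝ (fun _ : ι => E) 2 n).continuous.comp_continuousOn hΦ
  have hc' : ∀ n, ContinuousOn (fun t => (lp.single 2 n (Φ t n) : lp (fun _ : ι => E) 2))
      (Set.Icc a c) := fun n =>
    (lp.singleContinuousLinearMap ℝ (fun _ : ι => E) 2 n).continuous.comp_continuousOn (hc n)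
  have h1 : ∀ n, integral (fun t => (tens (b n t) : E →L[ℝ] Lp E 2 P)) (fun t => Φ t n) a c
      = integral B (fun t => lp.single 2 n (Φ t n)) a c := fun n =>
    (hb.isNoise n).map_integral hh hN (lp.singleContinuousLinearMap ℝ (fun _ : ι => E) 2 n)
      (ContinuousLinearMap.id ℝ _) (fun t x => (hB.single t n x).symm) hac (hc n)
  simp only [h1]
  rw [HasSum, Metric.tendsto_nhds]
  intro ε hε
  have hC : 0 ≤ (c - a) ^ h := Real.rpow_nonneg (sub_nonneg.2 hac) _
  filter_upwards [eventually_norm_sub_sum_single_le hΦ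
    (ε := ε / ((c - a) ^ h + 1)) (by positivity)] with s hs
  rw [← hN.integral_sum hh hac hc', dist_comm, dist_eq_norm]
  have hcs : ContinuousOn (fun t => ∑ n ∈ s, (lp.single 2 n (Φ t n) : lp (fun _ : ι => E) 2))
    (Set.Icc a c) := continuousOn_finsetSum _ fun n _ => hc' n
  have h2 := hN.integral_add hh hac (hΦ.sub hcs) hcs
  have h3 : integral B Φ a c - integral B (fun t => ∑ n ∈ s, lp.single 2 n (Φ t n)) a c
      = integral B (fun t => Φ t - ∑ n ∈ s, lp.single 2 n (Φ t n)) a c := by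
    rw [sub_eq_iff_eq_add]
    exact (integral_congr hac fun t _ => (sub_add_cancel _ _).symm).trans h2
  rw [h3]
  refine (hN.norm_integral_le hh hac (hΦ.sub hcs) (by positivity) hs).trans_lt ?_
  rw [mul_div_assoc', div_lt_iff₀ (by positivity)]
  nlinarith

variable {U : Type*} [NormedAddCommGroup U] [InnerProductSpace ℝ U] {e : HilbertBasis ι ℝ U}
  {σ : ι → ℝ} {β : ι → ℝ → Ω → ℝ}

theorem IsCylindrical.isStochIntegral [CompleteSpace E] (hh : 1 / 2 < h) (hb : IsFamily h b)
    (hβ : ∀ n t, b n t =ᵐ[P] β n t) (hB : IsCylindrical b B) (hac : a ≤ c) {Φ : ℝ → U →L[ℝ] E}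
    {Ψ : ℝ → lp (fun _ : ι => E) 2} (hΨ : ContinuousOn Ψ (Set.Icc a c))
    (hΦ : ∀ n s, Ψ s n = Φ s (sqrtQ e σ n)) :
    IsStochIntegral P h e σ β Φ a c (integral B Ψ a c) := by
  refine ⟨_, fun n => ?_, hB.hasSum_integral hh hb hac hΨ⟩
  simp only [← hΦ]
  exact isWienerIntegral_integral hh (hb.isNoise n) (hβ n) hac
    ((lp.evalCLM ℝ (fun _ : ι => E) 2 n).continuous.comp_continuousOn hΨ)

theorem IsStochIntegral.unique [MeasurableSpace E] [BorelSpace E] [CompleteSpace E]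
    (hh : 1 / 2 < h) (hh1 : h < 1) (hb : IsFamily h b)
    (hβ : ∀ n t, b n t =ᵐ[P] β n t) {Φ : ℝ → U →L[ℝ] E}
    (hΦ : ∀ n, ContinuousOn (fun s => Φ s (sqrtQ e σ n)) (Set.Icc a c)) {y z : Lp E 2 P}
    (hy : IsStochIntegral P h e σ β Φ a c y) (hz : IsStochIntegral P h e σ β Φ a c z) : y = z := by
  obtain ⟨I, h1, h2⟩ := hy
  obtain ⟨J, h3, h4⟩ := hz
  have : I = J := funext fun n =>
    (h1 n).unique hh hh1 (hb.self n) (hβ n) (hΦ n) (h3 n)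
  rw [this] at h2
  exact h2.unique h4

/-! ### Adaptedness -/

theorem filt_mono (σ : ι → ℝ) (β : ι → ℝ → Ω → ℝ) : Monotone (filt σ β) := fun _ _ hst =>
  iSup_mono fun _ => iSup_mono fun _ => iSup_le fun hr => le_iSup_of_le (hr.trans hst) le_rfl

theorem filt_le (hβ : ∀ n t, Measurable (β n t)) (t : ℝ) : filt σ β t ≤ ‹MeasurableSpace Ω› :=
  iSup_le fun n => iSup_le fun s => iSup_le fun _ =>
    ((hβ n s).const_mul _).comap_le

theorem measurable_filt (σ : ι → ℝ) (β : ι → ℝ → Ω → ℝ) (n : ι) {s t : ℝ} (hst : s ≤ t) :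
    Measurable[filt σ β t] fun ω => √(σ n) * β n s ω :=
  (comap_measurable _).mono
    (le_iSup_of_le n (le_iSup_of_le s (le_iSup_of_le hst le_rfl))) le_rfl

theorem isClosed_lpMeas [CompleteSpace E] {m m0 : MeasurableSpace Ω} {P : Measure Ω} (hm : m ≤ m0) :
    IsClosed (lpMeas E ℝ m 2 P : Set (Lp E 2 P)) := by
  have := isClosed_aestronglyMeasurable (F := E) (p := 2) (μ := P) hm
  convert! this using 1

/-- The filtration sees only `√(σ n) * β n`, so every coordinate must contain the factor `√(σ n)`;
in particular it vanishes where `σ n = 0`. -/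
theorem IsCylindrical.mem_lpMeas [CompleteSpace E] (hβm : ∀ n t, Measurable (β n t))
    (hβ : ∀ n t, b n t =ᵐ[P] β n t) (hB : IsCylindrical b B) {s t : ℝ} (hst : s ≤ t)
    {x : lp (fun _ : ι => E) 2} (hx : ∀ n, ∃ y, x n = √(σ n) • y) :
    B s x ∈ lpMeas E ℝ (filt σ β t) 2 P := by
  refine (isClosed_lpMeas (filt_le hβm t)).mem_of_tendsto (hB s x)
    (Eventually.of_forall fun u => Submodule.sum_mem _ fun n _ => ?_)
  rw [mem_lpMeas_iff_aestronglyMeasurable]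
  obtain ⟨y, hy⟩ := hx n
  refine ⟨fun ω => (√(σ n) * β n s ω) • y, ?_, ?_⟩
  · exact (measurable_filt σ β n hst).stronglyMeasurable.smul_const y
  · filter_upwards [coeFn_tens (b n s) (x n), hβ n s] with ω h1 h2
    rw [h1, h2, hy, smul_smul, mul_comm]

theorem exists_isFamily [IsProbabilityMeasure P] (hβ : ∀ n, IsFBM P h (β n))
    (hind : iIndepFun (fun n ω => fun t : ℝ => β n t ω) P) :
    ∃ b : ι → ℝ → Lp ℝ 2 P, (∀ n t, b n t =ᵐ[P] β n t) ∧ IsFamily h b := by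
  have hm : ∀ n t, MemLp (β n t) 2 P := fun n t =>
    ((hβ n).gaussian.hasGaussianLaw_eval t).memLp_two
  refine ⟨fun n t => (hm n t).toLp _, fun n t => (hm n t).coeFn_toLp, ?_, ?_⟩
  · intro n s t
    rw [L2.inner_def, cov, ← (hβ n).covariance]
    refine integral_congr_ae ?_
    filter_upwards [(hm n s).coeFn_toLp, (hm n t).coeFn_toLp] with ω h1 h2
    rw [h1, h2]
    simp only [RCLike.inner_apply, conj_trivial]
    ring
  · intro n m hnm s t
    have h1 : IndepFun (β n s) (β m t) P := (hind.indepFun hnm).comp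
      (measurable_pi_apply s) (measurable_pi_apply t)
    have h2 := h1.integral_fun_mul_eq_mul_integral (hm n s).aestronglyMeasurable
      (hm m t).aestronglyMeasurable
    rw [(hβ n).centered, zero_mul] at h2
    rw [L2.inner_def, ← h2]
    refine integral_congr_ae ?_
    filter_upwards [(hm n s).coeFn_toLp, (hm m t).coeFn_toLp] with ω h1 h2
    rw [h1, h2]
    simp only [RCLike.inner_apply, conj_trivial]
    ring

end FBM

/-! ## Gaussian subspaces of `L²(P, ℝ)` -/

namespace Gauss

variable {Ω : Type*} [MeasurableSpace Ω] {P : Measure Ω} [IsProbabilityMeasure P]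
variable {E : Type*} [NormedAddCommGroup E] [InnerProductSpace ℝ E]

theorem integral_norm_le {F : Type*} [NormedAddCommGroup F] (Z : Lp F 2 P) :
    ∫ ω, ‖Z ω‖ ∂P ≤ ‖Z‖ := by
  rw [integral_norm_eq_lintegral_enorm (Lp.aestronglyMeasurable Z),
    ← eLpNorm_one_eq_lintegral_enorm, Lp.norm_def]
  exact ENNReal.toReal_mono (Lp.eLpNorm_ne_top Z)
    (eLpNorm_le_eLpNorm_of_exponent_le (by norm_num) (Lp.aestronglyMeasurable Z))

/-- The characteristic function of `X` at `1`. -/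
noncomputable def cf (X : Lp ℝ 2 P) : ℂ := ∫ ω, Complex.exp (X ω * Complex.I) ∂P

theorem integrable_cexp {X : Ω → ℝ} (hX : AEStronglyMeasurable X P) :
    Integrable (fun ω => Complex.exp (X ω * Complex.I)) P := by
  refine Integrable.of_bound (C := 1) ?_ (Eventually.of_forall fun ω => ?_)
  · exact (by fun_prop : Continuous fun x : ℝ =>
      Complex.exp (x * Complex.I)).comp_aestronglyMeasurable hX
  · rw [Complex.norm_exp_ofReal_mul_I]

theorem norm_cexp_sub_le (x y : ℝ) :
    ‖Complex.exp (x * Complex.I) - Complex.exp (y * Complex.I)‖ ≤ ‖x - y‖ := by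
  have h1 : Complex.exp (x * Complex.I) - Complex.exp (y * Complex.I)
      = Complex.exp (y * Complex.I) * (Complex.exp (Complex.I * (x - y : ℝ)) - 1) := by
    rw [mul_sub, ← Complex.exp_add, mul_one]
    congr 2
    push_cast
    ring
  rw [h1, norm_mul, Complex.norm_exp_ofReal_mul_I, one_mul]
  exact Real.norm_exp_I_mul_ofReal_sub_one_le

theorem continuous_cf : Continuous (cf : Lp ℝ 2 P → ℂ) := by
  refine (LipschitzWith.of_dist_le_mul (K := 1) fun X Y => ?_).continuous
  rw [dist_eq_norm, dist_eq_norm, cf, cf, ← integral_sub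
    (integrable_cexp (Lp.aestronglyMeasurable X)) (integrable_cexp (Lp.aestronglyMeasurable Y)),
    NNReal.coe_one, one_mul]
  refine (norm_integral_le_of_norm_le (Lp.memLp (X - Y) |>.integrable (by norm_num)).norm ?_).trans
    (integral_norm_le (X - Y))
  filter_upwards [Lp.coeFn_sub X Y] with ω h
  rw [h]
  exact norm_cexp_sub_le _ _

/-- A subspace of `L²` consisting of centered Gaussian random variables. -/
def IsGaussian (𝒢 : Submodule ℝ (Lp ℝ 2 P)) : Prop :=
  ∀ X ∈ 𝒢, cf X = Complex.exp (-(‖X‖ ^ 2 / 2 : ℝ))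

/-- Both sides of the defining identity are continuous in `X` for the `L²` norm. -/
theorem IsGaussian.topologicalClosure {𝒢 : Submodule ℝ (Lp ℝ 2 P)} (h𝒢 : IsGaussian 𝒢) :
    IsGaussian 𝒢.topologicalClosure := by
  intro X hX
  have hc : IsClosed {X : Lp ℝ 2 P | cf X = Complex.exp (-(‖X‖ ^ 2 / 2 : ℝ))} :=
    isClosed_eq continuous_cf (by fun_prop)
  exact hc.closure_subset_iff.2 h𝒢 hX

/-! ### The span of independent fractional Brownian motions -/

section span

variable {h : ℝ} {ι : Type*} {β : ι → ℝ → Ω → ℝ} {b : ι → ℝ → Lp ℝ 2 P}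

/-- Writing `X` as a measurable function `G` of the path of `β n` lets the independence of the paths
pass to elements of the spans. -/
theorem exists_eq_of_mem_span (hβ : ∀ n, FBM.IsFBM P h (β n)) (hb : ∀ n t, b n t =ᵐ[P] β n t)
    (n : ι) {X : Lp ℝ 2 P} (hX : X ∈ Submodule.span ℝ (Set.range (b n))) :
    ∃ G : (ℝ → ℝ) → ℝ, Measurable G ∧ (X =ᵐ[P] fun ω => G fun t => β n t ω) ∧
      cf X = Complex.exp (-(‖X‖ ^ 2 / 2 : ℝ)) := by
  obtain ⟨c, rfl⟩ := Finsupp.mem_span_range_iff_exists_finsupp.1 hX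
  have hG : Measurable fun x : ℝ → ℝ => ∑ t ∈ c.support, c t • x t := by fun_prop
  have h1 : ∀ s : Finset ℝ, (∑ t ∈ s, c t • b n t : Lp ℝ 2 P)
      =ᵐ[P] fun ω => ∑ t ∈ s, c t • β n t ω := by
    intro s
    induction s using Finset.cons_induction with
    | empty =>
      filter_upwards [Lp.coeFn_zero ℝ 2 P] with ω h0
      simpa only [Finset.sum_empty, Pi.zero_apply] using h0
    | cons i s hi ih =>
      simp only [Finset.sum_cons]
      filter_upwards [Lp.coeFn_add (c i • b n i) (∑ t ∈ s, c t • b n t), Lp.coeFn_smul (c i) (b n i),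
        hb n i, ih] with ω e1 e2 e3 e4
      rw [e1, Pi.add_apply, e2, Pi.smul_apply, e3, e4]
  have h2 := h1 c.support
  refine ⟨_, hG, h2, ?_⟩
  set Y : Ω → ℝ := fun ω => ∑ t ∈ c.support, c t • β n t ω
  set X : Lp ℝ 2 P := c.sum fun i a => a • b n i
  have hXY : X =ᵐ[P] Y := h2
  have hY : HasGaussianLaw Y P :=
    ((hβ n).gaussian.smul c).hasGaussianLaw_fun_sum (I := c.support)
  have h3 := hY.charFun_map_eq 1
  have hYi : ∀ t, Integrable (β n t) P := fun t =>
    ((hβ n).gaussian.hasGaussianLaw_eval t).integrable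
  have hmean : ∫ ω, Y ω ∂P = 0 := by
    change ∫ ω, ∑ t ∈ c.support, c t • β n t ω ∂P = 0
    rw [integral_finsetSum (f := fun t ω => c t • β n t ω) _ fun t _ => (hYi t).smul (c t)]
    exact Finset.sum_eq_zero fun t _ => by rw [integral_smul, (hβ n).centered, smul_zero]
  have hvar : Var[Y; P] = ‖X‖ ^ 2 := by
    rw [variance_of_integral_eq_zero hY.aemeasurable hmean, ← real_inner_self_eq_norm_sq,
      L2.inner_def]
    refine integral_congr_ae ?_
    filter_upwards [hXY] with ω hω
    rw [hω]
    simp only [RCLike.inner_apply, conj_trivial]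
    rw [sq]
  have h4 : (fun ω => ⟪(1 : ℝ), Y ω⟫) = Y := by
    funext ω
    simp
  rw [h4, hmean, hvar, charFun_apply_real, integral_map hY.aemeasurable (by fun_prop)] at h3
  rw [cf]
  calc ∫ ω, Complex.exp (X ω * Complex.I) ∂P
      = ∫ ω, Complex.exp ((1 : ℝ) * Y ω * Complex.I) ∂P := by
        refine integral_congr_ae ?_
        filter_upwards [hXY] with ω hω
        rw [hω, Complex.ofReal_one, one_mul]
    _ = _ := h3
    _ = _ := by
        congr 1
        push_cast
        ring

/-- An element is a finite sum of one vector per component. Independence makes the characteristic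
functions multiply, orthogonality makes the squared norms add. -/
theorem isGaussian_span (hβ : ∀ n, FBM.IsFBM P h (β n))
    (hind : iIndepFun (fun n ω => fun t : ℝ => β n t ω) P)
    (hb : ∀ n t, b n t =ᵐ[P] β n t) (hf : FBM.IsFamily h b) :
    IsGaussian (⨆ n, Submodule.span ℝ (Set.range (b n))) := by
  intro X hX
  obtain ⟨Y, hY, rfl⟩ := (Submodule.mem_iSup_iff_exists_finsupp _ _).1 hX
  choose G hG hYG hcf using fun n => exists_eq_of_mem_span hβ hb n (hY n)
  have hi : iIndepFun (fun n ω => G n fun t => β n t ω) P := hind.comp G hG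
  have horth : ∀ n m, n ≠ m → ⟪Y n, Y m⟫ = 0 := by
    intro n m hnm
    have h1 : ∀ t, Submodule.span ℝ (Set.range (b n)) ≤ (ℝ ∙ b m t)ᗮ := fun t => by
      rw [Submodule.span_le]
      rintro _ ⟨s, rfl⟩
      rw [SetLike.mem_coe, Submodule.mem_orthogonal_singleton_iff_inner_left]
      exact hf.ne n m hnm s t
    have h2 : Submodule.span ℝ (Set.range (b m)) ≤ (ℝ ∙ Y n)ᗮ := by
      rw [Submodule.span_le]
      rintro _ ⟨t, rfl⟩
      rw [SetLike.mem_coe, Submodule.mem_orthogonal_singleton_iff_inner_right]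
      exact Submodule.mem_orthogonal_singleton_iff_inner_left.1 (h1 t (hY n))
    exact Submodule.mem_orthogonal_singleton_iff_inner_right.1 (h2 (hY m))
  have hm : ∀ n, Measurable fun ω => G n fun t => β n t ω := fun n =>
    (hG n).comp (measurable_pi_lambda _ fun t => (hβ n).measurable t)
  have key : ∀ s : Finset ι, cf (∑ n ∈ s, Y n)
      = Complex.exp (-(‖∑ n ∈ s, Y n‖ ^ 2 / 2 : ℝ)) := by
    intro s
    induction s using Finset.cons_induction with
    | empty =>
      simp only [Finset.sum_empty, norm_zero, cf]
      have : ∫ ω, Complex.exp ((0 : Lp ℝ 2 P) ω * Complex.I) ∂P = ∫ ω, (1 : ℂ) ∂P := by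
        refine integral_congr_ae ?_
        filter_upwards [Lp.coeFn_zero ℝ 2 P] with ω h0
        rw [h0]
        simp
      rw [this]
      simp
    | cons n s hn ih =>
      classical
      have hsum : (∑ m ∈ s, Y m : Lp ℝ 2 P) =ᵐ[P] fun ω => ∑ m ∈ s, G m fun t => β m t ω := by
        clear ih hn
        induction s using Finset.cons_induction with
        | empty =>
          filter_upwards [Lp.coeFn_zero ℝ 2 P] with ω h0
          simpa only [Finset.sum_empty, Pi.zero_apply] using h0
        | cons i s hi ih =>
          simp only [Finset.sum_cons]
          filter_upwards [Lp.coeFn_add (Y i) (∑ t ∈ s, Y t), hYG i, ih] with ω e1 e2 e3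
          rw [e1, Pi.add_apply, e2, e3]
      have hind2 : IndepFun (fun ω => ∑ m ∈ s, G m fun t => β m t ω)
          (fun ω => G n fun t => β n t ω) P := by
        have := hi.indepFun_finsetSum_of_notMem hm hn
        convert! this using 1
        funext ω
        rw [Finset.sum_apply]
      have h1 : cf (Y n + ∑ m ∈ s, Y m) = cf (Y n) * cf (∑ m ∈ s, Y m) := by
        have hc : Measurable fun x : ℝ => Complex.exp (x * Complex.I) := by fun_prop
        have h2 := (hind2.symm.comp hc hc).integral_fun_mul_eq_mul_integral
          (hc.comp (hm n)).aestronglyMeasurable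
          (hc.comp (Finset.measurable_fun_sum s fun m _ => hm m)).aestronglyMeasurable
        have e1 : cf (Y n + ∑ m ∈ s, Y m) = ∫ ω, Complex.exp ((G n fun t => β n t ω : ℝ) * Complex.I) *
            Complex.exp ((∑ m ∈ s, G m fun t => β m t ω : ℝ) * Complex.I) ∂P := by
          refine integral_congr_ae ?_
          filter_upwards [Lp.coeFn_add (Y n) (∑ m ∈ s, Y m), hYG n, hsum] with ω e1 e2 e3
          rw [e1, Pi.add_apply, e2, e3, ← Complex.exp_add, ← add_mul, Complex.ofReal_add]
        have e2 : cf (Y n) = ∫ ω, Complex.exp ((G n fun t => β n t ω : ℝ) * Complex.I) ∂P := by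
          refine integral_congr_ae ?_
          filter_upwards [hYG n] with ω e2
          rw [e2]
        have e3 : cf (∑ m ∈ s, Y m)
            = ∫ ω, Complex.exp ((∑ m ∈ s, G m fun t => β m t ω : ℝ) * Complex.I) ∂P := by
          refine integral_congr_ae ?_
          filter_upwards [hsum] with ω e2
          rw [e2]
        rw [e1, e2, e3]
        exact h2
      have h3 : ⟪Y n, ∑ m ∈ s, Y m⟫ = 0 := by
        rw [inner_sum]
        exact Finset.sum_eq_zero fun m hm => horth n m fun hnm => hn (hnm ▸ hm)
      rw [Finset.sum_cons, h1, hcf, ih, ← Complex.exp_add, norm_add_sq_real, h3]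
      congr 1
      push_cast
      ring
  exact key _

end span

end Gauss

/-! ## Gaussian random vectors, laws and independence -/

namespace BL

variable {E : Type*} [NormedAddCommGroup E] [InnerProductSpace ℝ E] [MeasurableSpace E]

theorem Prob.ext {μ ν : Prob E} (h : μ.meas = ν.meas) : μ = ν := by
  cases μ
  cases ν
  congr

variable [BorelSpace E]

theorem integral_eq_of_dist_eq_zero {μ ν : Prob E} (h : dist μ ν = 0) {u : ℝ → ℝ}
    (hu : LipschitzWith 1 u) (hu1 : ∀ x, |u x| ≤ 1) (v : E) :
    ∫ x, u ⟪x, v⟫ ∂μ.meas = ∫ x, u ⟪x, v⟫ ∂ν.meas := by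
  -- The test function `c * u ⟪x, v⟫` has Lipschitz constant `c * ‖v‖` and supremum at most `c`, so
  -- this `c` puts it in the unit ball.
  set c : ℝ≥0 := (1 + ‖v‖₊)⁻¹
  have hc : 0 < c := by positivity
  have hL : LipschitzWith (c * ‖v‖₊) fun x : E => (c : ℝ) * u ⟪x, v⟫ := by
    refine LipschitzWith.of_dist_le_mul fun x y => ?_
    rw [Real.dist_eq, ← mul_sub, abs_mul, abs_of_nonneg c.coe_nonneg, NNReal.coe_mul, mul_assoc]
    refine mul_le_mul_of_nonneg_left ?_ c.coe_nonneg
    have h1 := hu.dist_le_mul ⟪x, v⟫ ⟪y, v⟫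
    rw [Real.dist_eq, Real.dist_eq, NNReal.coe_one, one_mul, ← inner_sub_left] at h1
    rw [dist_eq_norm, coe_nnnorm, mul_comm]
    exact h1.trans (abs_real_inner_le_norm _ _)
  have hf : (fun x : E => (c : ℝ) * u ⟪x, v⟫) ∈ unitBall E := by
    refine ⟨c * ‖v‖₊, c, ?_, hL, fun x => ?_⟩
    · have : c * ‖v‖₊ + c = c * (1 + ‖v‖₊) := by ring
      rw [this, inv_mul_cancel₀ (by positivity)]
    · rw [abs_mul, abs_of_nonneg c.coe_nonneg]
      exact mul_le_of_le_one_right c.coe_nonneg (hu1 _)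
  have h1 : |∫ x, (c : ℝ) * u ⟪x, v⟫ ∂μ.meas - ∫ x, (c : ℝ) * u ⟪x, v⟫ ∂ν.meas| ≤ 0 :=
    h ▸ le_ciSup (bddAbove_bdist μ ν) ⟨_, hf⟩
  have h2 := abs_nonpos_iff.1 h1
  rw [integral_const_mul, integral_const_mul, ← mul_sub] at h2
  have hc' : (c : ℝ) ≠ 0 := by exact_mod_cast hc.ne'
  exact sub_eq_zero.1 ((mul_eq_zero.1 h2).resolve_left hc')

/-- The real and imaginary parts of the characteristic function are integrals of bounded Lipschitz
functions, so the metric separates laws. -/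
theorem eq_of_dist_eq_zero [CompleteSpace E] [SecondCountableTopology E] {μ ν : Prob E}
    (h : dist μ ν = 0) : μ = ν := by
  refine Prob.ext (Measure.ext_of_charFun (funext fun v => ?_))
  have key : ∀ κ : Prob E, charFun κ.meas v
      = ((∫ x, Real.cos ⟪x, v⟫ ∂κ.meas : ℝ) : ℂ)
        + ((∫ x, Real.sin ⟪x, v⟫ ∂κ.meas : ℝ) : ℂ) * Complex.I := by
    intro κ
    have hi : ∀ u : ℝ → ℝ, Continuous u → (∀ x, |u x| ≤ 1) →
        Integrable (fun x : E => u ⟪x, v⟫) κ.meas := fun u hu hu1 =>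
      Integrable.of_bound (hu.comp (by fun_prop)).aestronglyMeasurable 1
        (Eventually.of_forall fun x => hu1 _)
    rw [charFun_apply, ← integral_complex_ofReal, ← integral_complex_ofReal, ← integral_mul_const,
      ← integral_add (hi _ Real.continuous_cos Real.abs_cos_le_one).ofReal
        ((hi _ Real.continuous_sin Real.abs_sin_le_one).ofReal.mul_const _)]
    refine integral_congr_ae (Eventually.of_forall fun x => ?_)
    simp only [Complex.exp_mul_I, Complex.ofReal_cos, Complex.ofReal_sin]
  rw [key, key, integral_eq_of_dist_eq_zero h Real.lipschitzWith_cos Real.abs_cos_le_one,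
    integral_eq_of_dist_eq_zero h Real.lipschitzWith_sin Real.abs_sin_le_one]

theorem meas_law_const_add {Ω : Type*} [MeasurableSpace Ω] {P : Measure Ω} [IsProbabilityMeasure P]
    [SecondCountableTopology E] {X : Lp E 2 P} {c : E} (hX : X =ᵐ[P] fun _ => c) (Z : Lp E 2 P) :
    (law (X + Z)).meas = (P.map Z).map (fun x => c + x) := by
  rw [AEMeasurable.map_map_of_aemeasurable (by fun_prop)
    (Lp.aestronglyMeasurable Z).aemeasurable]
  refine Measure.map_congr ?_
  filter_upwards [Lp.coeFn_add X Z, hX] with ω h1 h2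
  rw [h1, Pi.add_apply, h2, Function.comp_apply]

end BL

/-! ### Scalar coordinates of random vectors, and independence from characteristic functions. -/

namespace Gauss

variable {Ω : Type*} [MeasurableSpace Ω] {P : Measure Ω}
variable {E : Type*} [NormedAddCommGroup E] [InnerProductSpace ℝ E]

/-- The scalar random variable `⟨v, Y⟩`. -/
noncomputable def coord (v : E) : Lp E 2 P →L[ℝ] Lp ℝ 2 P := (innerSL ℝ v).compLpL 2 P

theorem coeFn_coord (v : E) (Y : Lp E 2 P) : coord v Y =ᵐ[P] fun ω => ⟪v, Y ω⟫ := by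
  filter_upwards [ContinuousLinearMap.coeFn_compLpL (p := 2) (μ := P) (innerSL ℝ v) Y] with ω h
  exact h

theorem coord_tens (v : E) (X : Lp ℝ 2 P) (x : E) : coord v (FBM.tens X x) = ⟪v, x⟫ • X := by
  ext
  filter_upwards [coeFn_coord v (FBM.tens X x), FBM.coeFn_tens X x, Lp.coeFn_smul ⟪v, x⟫ X]
    with ω h1 h2 h3
  rw [h1, h2, h3, Pi.smul_apply, real_inner_smul_right, smul_eq_mul, mul_comm]

theorem inner_coord (v : E) (X : Lp ℝ 2 P) (Y : Lp E 2 P) :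
    ⟪X, coord v Y⟫ = ⟪FBM.tens X v, Y⟫ := by
  rw [L2.inner_def, L2.inner_def]
  refine integral_congr_ae ?_
  filter_upwards [coeFn_coord v Y, FBM.coeFn_tens X v] with ω h1 h2
  rw [h1, h2, real_inner_smul_left]
  simp only [RCLike.inner_apply, conj_trivial]
  ring

/-- The random vectors all of whose coordinates lie in `𝒢`. -/
noncomputable def vec (E : Type*) [NormedAddCommGroup E] [InnerProductSpace ℝ E] (𝒢 : Submodule ℝ (Lp ℝ 2 P)) :
    Submodule ℝ (Lp E 2 P) :=
  ⨅ v : E, 𝒢.comap (coord v).toLinearMap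

theorem mem_vec {𝒢 : Submodule ℝ (Lp ℝ 2 P)} {Y : Lp E 2 P} :
    Y ∈ vec E 𝒢 ↔ ∀ v, coord v Y ∈ 𝒢 := by
  simp only [vec, Submodule.mem_iInf, Submodule.mem_comap, ContinuousLinearMap.coe_coe]

theorem isClosed_vec {𝒢 : Submodule ℝ (Lp ℝ 2 P)} (h𝒢 : IsClosed (𝒢 : Set (Lp ℝ 2 P))) :
    IsClosed (vec E 𝒢 : Set (Lp E 2 P)) := by
  have : (vec E 𝒢 : Set (Lp E 2 P)) = ⋂ v : E, coord v ⁻¹' 𝒢 := by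
    ext Y
    simp only [SetLike.mem_coe, mem_vec, Set.mem_iInter, Set.mem_preimage]
  rw [this]
  exact isClosed_iInter fun v => h𝒢.preimage (coord v).continuous

theorem tens_mem_vec {𝒢 : Submodule ℝ (Lp ℝ 2 P)} {X : Lp ℝ 2 P} (hX : X ∈ 𝒢) (x : E) :
    FBM.tens X x ∈ vec E 𝒢 :=
  mem_vec.2 fun v => coord_tens v X x ▸ 𝒢.smul_mem _ hX

variable [IsProbabilityMeasure P] [CompleteSpace E] [MeasurableSpace E] [BorelSpace E]
  [SecondCountableTopology E]

/-- The law of a Gaussian vector is determined by the variances of its coordinates. -/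
theorem IsGaussian.map_eq {𝒢 : Submodule ℝ (Lp ℝ 2 P)} (h𝒢 : IsGaussian 𝒢) {Y Z : Lp E 2 P}
    (hY : Y ∈ vec E 𝒢) (hZ : Z ∈ vec E 𝒢) (h : ∀ v, ‖coord v Y‖ = ‖coord v Z‖) :
    P.map Y = P.map Z := by
  have hm : ∀ Y : Lp E 2 P, AEMeasurable Y P := fun Y => (Lp.aestronglyMeasurable Y).aemeasurable
  have := Measure.isProbabilityMeasure_map (hm Y)
  have := Measure.isProbabilityMeasure_map (hm Z)
  refine Measure.ext_of_charFun (funext fun v => ?_)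
  have key : ∀ Y : Lp E 2 P, charFun (P.map Y) v = cf (coord v Y) := by
    intro Y
    rw [charFun_apply, integral_map (hm Y) (by fun_prop)]
    refine integral_congr_ae ?_
    filter_upwards [coeFn_coord v Y] with ω h1
    rw [h1, real_inner_comm]
  rw [key, key, h𝒢 _ (mem_vec.1 hY v), h𝒢 _ (mem_vec.1 hZ v), h]

/-- The Cramér–Wold device: it suffices to treat finitely many `X j`, and a functional on the
product splits into a combination of these plus `⟪v, Z⟫`. The span and the arbitrary `v` absorb all
coefficients, so evaluation of characteristic functions at `1` is enough. -/
theorem indepFun_of_cf {J : Type*} {x : J → Lp ℝ 2 P} {X : J → Ω → ℝ} (hx : ∀ j, x j =ᵐ[P] X j)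
    {Z : Lp E 2 P} (h : ∀ w ∈ Submodule.span ℝ (Set.range x), ∀ v,
      cf (w + coord v Z) = cf w * cf (coord v Z)) : IndepFun (fun ω j => X j ω) Z P := by
  have hm : AEMeasurable Z P := (Lp.aestronglyMeasurable Z).aemeasurable
  have hmX : ∀ j, AEMeasurable (X j) P := fun j =>
    (Lp.aestronglyMeasurable (x j)).aemeasurable.congr (hx j)
  refine IndepFun.process_indepFun₀ hmX hm fun I => ?_
  have hmI : AEMeasurable (fun ω (j : I) => X j ω) P := aemeasurable_pi_lambda _ fun j => hmX j
  rw [indepFun_iff_charFunDual_prod hmI hm]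
  intro L
  set L1 := L ∘SL ContinuousLinearMap.inl ℝ (I → ℝ) E
  set L2 := L ∘SL ContinuousLinearMap.inr ℝ (I → ℝ) E
  classical
  set c : I → ℝ := fun j => L1 (Pi.single j 1)
  set v : E := (InnerProductSpace.toDual ℝ E).symm L2
  have hL1 : ∀ x, L1 x = ∑ j, c j * x j := fun x => by
    conv_lhs => rw [pi_eq_sum_univ' x]
    simp only [map_sum, map_smul, smul_eq_mul, c]
    refine Finset.sum_congr rfl fun j _ => ?_
    rw [mul_comm]
  have hL2 : ∀ y, L2 y = ⟪v, y⟫ := fun y => (InnerProductSpace.toDual_symm_apply).symm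
  set A : Lp ℝ 2 P := ∑ j : I, c j • x j
  have hA : A ∈ Submodule.span ℝ (Set.range x) := Submodule.sum_mem _ fun j _ =>
    Submodule.smul_mem _ _ (Submodule.subset_span ⟨j, rfl⟩)
  have hAe : A =ᵐ[P] fun ω => L1 fun j => X j ω := by
    have : ∀ s : Finset I, (∑ j ∈ s, c j • x j : Lp ℝ 2 P)
        =ᵐ[P] fun ω => ∑ j ∈ s, c j * X j ω := by
      intro s
      induction s using Finset.cons_induction with
      | empty =>
        filter_upwards [Lp.coeFn_zero ℝ 2 P] with ω h0
        simpa only [Finset.sum_empty, Pi.zero_apply] using h0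
      | cons i s hi ih =>
        simp only [Finset.sum_cons]
        filter_upwards [Lp.coeFn_add (c i • x i) (∑ j ∈ s, c j • x j), Lp.coeFn_smul (c i) (x i),
          ih, hx i] with ω e1 e2 e3 e4
        rw [e1, Pi.add_apply, e2, Pi.smul_apply, e3, smul_eq_mul, e4]
    filter_upwards [this Finset.univ] with ω hω
    rw [hω, hL1]
  have e1 : charFunDual (P.map fun ω => (fun j : I => X j ω, Z ω)) L = cf (A + coord v Z) := by
    rw [charFunDual_apply, integral_map (hmI.prodMk hm) (by fun_prop)]
    refine integral_congr_ae ?_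
    filter_upwards [coeFn_coord v Z, hAe, Lp.coeFn_add A (coord v Z)] with ω h1 h2 h3
    rw [h3, Pi.add_apply, h1, h2, ← hL2, ← L.comp_inl_add_comp_inr]
  have e2 : charFunDual (P.map fun ω (j : I) => X j ω) L1 = cf A := by
    rw [charFunDual_apply, integral_map hmI (by fun_prop)]
    refine integral_congr_ae ?_
    filter_upwards [hAe] with ω h2
    rw [h2]
  have e3 : charFunDual (P.map Z) L2 = cf (coord v Z) := by
    rw [charFunDual_apply, integral_map hm (by fun_prop)]
    refine integral_congr_ae ?_
    filter_upwards [coeFn_coord v Z] with ω h2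
    rw [h2, hL2]
  rw [e1, e2, e3, h A hA]

/-- Uncorrelated Gaussian families are independent. -/
theorem IsGaussian.indepFun {𝒢 : Submodule ℝ (Lp ℝ 2 P)} (h𝒢 : IsGaussian 𝒢) {J : Type*}
    {x : J → Lp ℝ 2 P} {X : J → Ω → ℝ} (hx : ∀ j, x j =ᵐ[P] X j) (hx𝒢 : ∀ j, x j ∈ 𝒢) {Z : Lp E 2 P}
    (hZ : Z ∈ vec E 𝒢) (h : ∀ j v, ⟪x j, coord v Z⟫ = 0) :
    IndepFun (fun ω j => X j ω) Z P := by
  refine indepFun_of_cf hx fun w hw v => ?_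
  have hw𝒢 : w ∈ 𝒢 := Submodule.span_le.2 (Set.range_subset_iff.2 hx𝒢) hw
  have h0 : ⟪w, coord v Z⟫ = 0 := by
    have : Submodule.span ℝ (Set.range x) ≤ (ℝ ∙ coord v Z)ᗮ := by
      refine Submodule.span_le.2 (Set.range_subset_iff.2 fun j => ?_)
      rw [SetLike.mem_coe, Submodule.mem_orthogonal_singleton_iff_inner_left]
      exact h j v
    exact Submodule.mem_orthogonal_singleton_iff_inner_left.1 (this hw)
  have hv := mem_vec.1 hZ v
  rw [h𝒢 _ hw𝒢, h𝒢 _ hv, h𝒢 _ (𝒢.add_mem hw𝒢 hv), ← Complex.exp_add, norm_add_sq_real, h0]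
  congr 1
  push_cast
  ring

end Gauss

/-! ## The isometry between two noises, and the invariance of laws under shifts -/

namespace FBM

/-! ### Comparing two noises with the same covariance. -/

section isometry

variable {𝓗 𝓛 𝓛' : Type*} [NormedAddCommGroup 𝓗] [InnerProductSpace ℝ 𝓗]
  [NormedAddCommGroup 𝓛] [InnerProductSpace ℝ 𝓛] [CompleteSpace 𝓛]
  [NormedAddCommGroup 𝓛'] [InnerProductSpace ℝ 𝓛'] [CompleteSpace 𝓛'] {h : ℝ}

/-- The closed span of the values of a noise. -/
noncomputable def noiseSpan (B : ℝ → 𝓗 →L[ℝ] 𝓛) : Submodule ℝ 𝓛 :=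
  (Submodule.span ℝ (Set.range fun q : ℝ × 𝓗 => B q.1 q.2)).topologicalClosure

theorem mem_noiseSpan (B : ℝ → 𝓗 →L[ℝ] 𝓛) (t : ℝ) (x : 𝓗) : B t x ∈ noiseSpan B :=
  Submodule.le_topologicalClosure _ (Submodule.subset_span ⟨(t, x), rfl⟩)

theorem noiseSpan_le {B : ℝ → 𝓗 →L[ℝ] 𝓛} {W : Submodule ℝ 𝓛} (hW : IsClosed (W : Set 𝓛))
    (h : ∀ t x, B t x ∈ W) : noiseSpan B ≤ W :=
  Submodule.topologicalClosure_minimal _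
    (Submodule.span_le.2 (Set.range_subset_iff.2 fun q => h q.1 q.2)) hW

/-- Two noises are related by a contraction, isometric on the closed span of the first one. -/
theorem IsNoise.exists_map {B : ℝ → 𝓗 →L[ℝ] 𝓛} {B' : ℝ → 𝓗 →L[ℝ] 𝓛'} (hB : IsNoise h B)
    (hB' : IsNoise h B') : ∃ V : 𝓛 →L[ℝ] 𝓛', (∀ t x, V (B t x) = B' t x) ∧ ∀ y, ‖V y‖ ≤ ‖y‖ := by
  set K := noiseSpan B
  have hK : IsClosed (K : Set 𝓛) := Submodule.isClosed_topologicalClosure _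
  have : CompleteSpace K := hK.completeSpace_coe
  set e : ((ℝ × 𝓗) →₀ ℝ) →ₗ[ℝ] K :=
    Finsupp.linearCombination ℝ fun q : ℝ × 𝓗 => (⟨B q.1 q.2, mem_noiseSpan B q.1 q.2⟩ : K)
  set f : ((ℝ × 𝓗) →₀ ℝ) →ₗ[ℝ] 𝓛' := Finsupp.linearCombination ℝ fun q : ℝ × 𝓗 => B' q.1 q.2
  have he : ∀ c, ((e c : K) : 𝓛) = Finsupp.linearCombination ℝ (fun q : ℝ × 𝓗 => B q.1 q.2) c :=
    fun c => by
      rw [← Submodule.subtype_apply, ← LinearMap.comp_apply]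
      congr 1
      ext q
      simp [e]
  -- The values of the two noises have the same Gram matrix, so equality holds; the bound is what
  -- the extension from the dense range requires.
  have hnorm : ∀ c, ‖f c‖ ≤ 1 * ‖e c‖ := fun c => by
    rw [one_mul]
    refine le_of_eq ((pow_left_inj₀ (norm_nonneg _) (norm_nonneg _) two_ne_zero).1 ?_)
    rw [Submodule.coe_norm, he, ← real_inner_self_eq_norm_sq, ← real_inner_self_eq_norm_sq]
    simp only [f, Finsupp.linearCombination_apply, Finsupp.sum, sum_inner, inner_sum,
      real_inner_smul_left, real_inner_smul_right]
    refine Finset.sum_congr rfl fun i _ => Finset.sum_congr rfl fun j _ => ?_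
    rw [hB, hB']
  have hd : DenseRange e := by
    rw [DenseRange, dense_iff_closure_eq, Set.eq_univ_iff_forall]
    intro y
    rw [closure_subtype]
    have hr : ((↑) '' Set.range e : Set 𝓛)
        = (Submodule.span ℝ (Set.range fun q : ℝ × 𝓗 => B q.1 q.2) : Set 𝓛) := by
      rw [← Finsupp.range_linearCombination, ← Set.range_comp]
      ext z
      simp only [Set.mem_range, Function.comp_apply, he, SetLike.mem_coe, LinearMap.mem_range]
    rw [hr]
    exact y.2
  -- Projecting onto `K` first defines the map on the whole space without increasing norms.
  refine ⟨(f.extendOfNorm e).comp K.orthogonalProjectionOnto, fun t x => ?_, fun y => ?_⟩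
  · have h1 : e (Finsupp.single (t, x) 1) = ⟨B t x, mem_noiseSpan B t x⟩ := by
      simp [e]
    have h2 : f (Finsupp.single (t, x) 1) = B' t x := by simp [f]
    have h3 := LinearMap.extendOfNorm_eq (f := f) hd ⟨1, hnorm⟩ (Finsupp.single (t, x) 1)
    rw [h1, h2] at h3
    rw [ContinuousLinearMap.comp_apply, ← h3]
    congr 1
    exact Submodule.orthogonalProjectionOnto_mem_subspace_eq_self (K := K) ⟨B t x, mem_noiseSpan B t x⟩
  · refine (LinearMap.norm_extendOfNorm_apply_le hd 1 hnorm _).trans ?_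
    rw [one_mul]
    exact K.norm_orthogonalProjectionOnto_apply_le y

/-- Equality of inner products on the generators extends to the closed span by linearity and
continuity, one argument at a time. Applied to a scalar coordinate `L`, it preserves the variance of
that coordinate. -/
theorem norm_map_eq_of_mem_noiseSpan {G : Type*} [NormedAddCommGroup G] [InnerProductSpace ℝ G]
    {B : ℝ → 𝓗 →L[ℝ] 𝓛} {V : 𝓛 →L[ℝ] 𝓛} {L : 𝓛 →L[ℝ] G}
    (hL : ∀ s t x y, ⟪L (V (B s x)), L (V (B t y))⟫ = ⟪L (B s x), L (B t y)⟫) {y : 𝓛}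
    (hy : y ∈ noiseSpan B) : ‖L (V y)‖ = ‖L y‖ := by
  have h1 : ∀ z, IsClosed {y | ⟪L (V z), L (V y)⟫ = ⟪L z, L y⟫} := fun z =>
    isClosed_eq (by fun_prop) (by fun_prop)
  have key : ∀ z, (∀ t x, ⟪L (V z), L (V (B t x))⟫ = ⟪L z, L (B t x)⟫) → ∀ y ∈ noiseSpan B,
      ⟪L (V z), L (V y)⟫ = ⟪L z, L y⟫ := by
    intro z hz y hy
    let W : Submodule ℝ 𝓛 :=
      { carrier := {y | ⟪L (V z), L (V y)⟫ = ⟪L z, L y⟫}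
        add_mem' := fun {a b} ha hb => by
          simp only [Set.mem_ofPred_eq, map_add, inner_add_right] at ha hb ⊢
          rw [ha, hb]
        zero_mem' := by simp
        smul_mem' := fun c a ha => by
          simp only [Set.mem_ofPred_eq, map_smul, real_inner_smul_right] at ha ⊢
          rw [ha] }
    exact noiseSpan_le (W := W) (h1 z) hz hy
  have h2 := key y (fun t x => by
    rw [real_inner_comm, key (B t x) (fun s z => hL t s x z) y hy, real_inner_comm]) y hy
  rw [real_inner_self_eq_norm_sq, real_inner_self_eq_norm_sq] at h2
  exact (pow_left_inj₀ (norm_nonneg _) (norm_nonneg _) two_ne_zero).1 h2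

end isometry

end FBM

/-! ### Splitting the solution into its drift part and its noise part. -/

namespace Evol

variable {𝓗 𝓛 : Type*} [NormedAddCommGroup 𝓗] [InnerProductSpace ℝ 𝓗]
  [NormedAddCommGroup 𝓛] [InnerProductSpace ℝ 𝓛] [CompleteSpace 𝓛]
  {h N α : ℝ} {T : ℝ → 𝓛 →L[ℝ] 𝓛} {T' : ℝ → 𝓗 →L[ℝ] 𝓗} {B B' : ℝ → 𝓗 →L[ℝ] 𝓛}
  {f : ℝ → 𝓛} {g : ℝ → 𝓗} {t M : ℝ}

theorem IsSystem.sol_mem_noiseSpan (hs : IsSystem h N α T T' B) (hg : Continuous g)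
    (hM : ∀ s, ‖g s‖ ≤ M) : sol T T' B (fun s => (0, g s)) t ∈ FBM.noiseSpan B := by
  have hK : IsClosed (FBM.noiseSpan B : Set 𝓛) := Submodule.isClosed_topologicalClosure _
  refine hs.sol_mem (M := M) (by fun_prop) (fun s => ?_) hK (fun r x hx => ?_)
    (fun s _ => Submodule.zero_mem _) fun s _ r _ u => FBM.mem_noiseSpan B s _
  · rw [Prod.norm_mk, norm_zero, max_eq_right (norm_nonneg _)]
    exact hM s
  · exact FBM.noiseSpan_le (W := (FBM.noiseSpan B).comap (T r).toLinearMap)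
      (hK.preimage (T r).continuous) (fun t x => by
        rw [Submodule.mem_comap, ContinuousLinearMap.coe_coe, hs.comm]
        exact FBM.mem_noiseSpan B t _) hx

/-- The semigroup acts inside the stochastic integral through `T'`, so `V` needs no relation with
`T`: it only has to carry one noise to the other. -/
theorem IsSystem.map_sol (hs : IsSystem h N α T T' B) (hs' : IsSystem h N α T T' B')
    (hg : Continuous g) (hM : ∀ s, ‖g s‖ ≤ M) {V : 𝓛 →L[ℝ] 𝓛} (hV : ∀ t x, V (B t x) = B' t x) :
    V (sol T T' B (fun s => (0, g s)) t) = sol T T' B' (fun s => (0, g s)) t := by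
  have hp : Continuous fun s => ((0 : 𝓛), g s) := by fun_prop
  have hpM : ∀ s, ‖((0 : 𝓛), g s)‖ ≤ M := fun s => by
    rw [Prod.norm_mk, norm_zero, max_eq_right (norm_nonneg _)]
    exact hM s
  refine tendsto_nhds_unique ((V.continuous.tendsto _).comp (hs.tendsto_sol hp hpM t))
    ((hs'.tendsto_sol hp hpM t).congr fun m => ?_)
  have hm : t - m ≤ t := by linarith [(Nat.cast_nonneg m : (0 : ℝ) ≤ m)]
  simp only [Function.comp_apply, duhamel, map_zero, intervalIntegral.integral_zero, zero_add]
  exact (hs.noise.map_integral hs.hh hs'.noise (ContinuousLinearMap.id ℝ 𝓗) V hV hm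
    (hs.cont₂ hp le_rfl)).symm

theorem IsSystem.sol_eq_add (hs : IsSystem h N α T T' B) (hf : Continuous f) (hg : Continuous g)
    (hM : ∀ s, ‖(f s, g s)‖ ≤ M) : sol T T' B (fun s => (f s, g s)) t
      = sol T T' B (fun s => (f s, 0)) t + sol T T' B (fun s => (0, g s)) t := by
  have h1 : ∀ s, ‖(f s, (0 : 𝓗))‖ ≤ M := fun s => by
    refine (max_le ?_ ?_).trans (hM s)
    · exact le_max_left _ _
    · rw [norm_zero]; exact norm_nonneg _
  have h2 : ∀ s, ‖((0 : 𝓛), g s)‖ ≤ M := fun s => by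
    refine (max_le ?_ ?_).trans (hM s)
    · rw [norm_zero]; exact norm_nonneg _
    · exact le_max_right _ _
  rw [← hs.sol_add (by fun_prop) (by fun_prop) h1 h2]
  simp only [Prod.mk_add_mk, add_zero, zero_add]

theorem IsSystem.sol_eq_sol (hs : IsSystem h N α T T' B) (hs' : IsSystem h N α T T' B')
    (hf : Continuous f) (hM : ∀ s, ‖f s‖ ≤ M) :
    sol T T' B (fun s => (f s, 0)) t = sol T T' B' (fun s => (f s, 0)) t := by
  have hp : Continuous fun s => (f s, (0 : 𝓗)) := by fun_prop
  have hpM : ∀ s, ‖(f s, (0 : 𝓗))‖ ≤ M := fun s => by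
    rw [Prod.norm_mk, norm_zero, max_eq_left (norm_nonneg _)]
    exact hM s
  refine tendsto_nhds_unique (hs.tendsto_sol hp hpM t)
    ((hs'.tendsto_sol hp hpM t).congr fun m => ?_)
  have hm : t - m ≤ t := by linarith [(Nat.cast_nonneg m : (0 : ℝ) ≤ m)]
  simp only [duhamel, map_zero]
  rw [hs.noise.integral_zero hs.hh hm, hs'.noise.integral_zero hs.hh hm]

end Evol

namespace FBM

variable {Ω : Type*} [MeasurableSpace Ω] {P : Measure Ω} [IsProbabilityMeasure P]
variable {E : Type*} [NormedAddCommGroup E] [InnerProductSpace ℝ E] [CompleteSpace E]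
  {ι : Type*} {h : ℝ} {b : ι → ℝ → Lp ℝ 2 P} {B : ℝ → lp (fun _ : ι => E) 2 →L[ℝ] Lp E 2 P}

/-- Testing the cylindrical noise against `v` gives the real cylindrical noise built from the same
`b`, applied to the family of coordinates `⟪v, x n⟫`. The covariance of a scalar coordinate can then
be read off. -/
theorem IsCylindrical.exists_coord (hh : 1 / 2 < h) (hb : IsFamily h b) (hB : IsCylindrical b B)
    (v : E) : ∃ (B₁ : ℝ → lp (fun _ : ι => ℝ) 2 →L[ℝ] Lp ℝ 2 P)
      (D : lp (fun _ : ι => E) 2 →L[ℝ] lp (fun _ : ι => ℝ) 2), IsNoise h B₁ ∧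
        ∀ t x, Gauss.coord v (B t x) = B₁ t (D x) := by
  obtain ⟨B₁, hB₁⟩ := hb.exists_isCylindrical (E := ℝ) hh
  refine ⟨B₁, lp.mapCLM 2 (fun _ => innerSL ℝ v) (norm_nonneg v) fun _ => (innerSL_apply_norm ℝ v).le, hB₁.isNoise hb, fun t x => ?_⟩
  have h1 : HasSum (fun n => ⟪v, x n⟫ • b n t) (Gauss.coord v (B t x)) := by
    have := (hB t x).mapL (Gauss.coord v)
    simpa only [Gauss.coord_tens] using this
  have h2 := hB₁ t (lp.mapCLM 2 (fun _ : ι => innerSL ℝ v) (norm_nonneg v)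
    (fun _ => (innerSL_apply_norm ℝ v).le) x)
  refine h1.unique (h2.congr_fun fun n => ?_)
  ext
  filter_upwards [coeFn_tens (b n t) (⟪v, x n⟫ : ℝ), Lp.coeFn_smul ⟪v, x n⟫ (b n t)] with ω h1 h2
  rw [h2, Pi.smul_apply, smul_eq_mul, mul_comm]
  exact h1.symm

/-- Stationarity of increments: the scalar noise of the coordinate and its restart at `τ` have the
same covariance. -/
theorem IsCylindrical.norm_coord_shift (hh : 1 / 2 < h) (hb : IsFamily h b)
    (hB : IsCylindrical b B) {τ : ℝ} {V : Lp E 2 P →L[ℝ] Lp E 2 P}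
    (hV : ∀ t x, V (B t x) = shiftNoise B τ t x) {y : Lp E 2 P} (hy : y ∈ noiseSpan B) (v : E) :
    ‖Gauss.coord v (V y)‖ = ‖Gauss.coord v y‖ := by
  obtain ⟨B₁, D, hB₁, hD⟩ := hB.exists_coord hh hb v
  refine norm_map_eq_of_mem_noiseSpan (fun s t x y => ?_) hy
  have h1 : ∀ t x, Gauss.coord v (V (B t x)) = shiftNoise B₁ τ t (D x) := fun t x => by
    rw [hV, shiftNoise, shiftNoise, sub_apply, sub_apply, map_sub, hD, hD]
  rw [h1, h1, hB₁.shift hh, hD, hD, hB₁]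

theorem IsCylindrical.noiseSpan_le_vec (hB : IsCylindrical b B) {𝒢 : Submodule ℝ (Lp ℝ 2 P)}
    (h𝒢 : IsClosed (𝒢 : Set (Lp ℝ 2 P))) (hb𝒢 : ∀ n t, b n t ∈ 𝒢) :
    noiseSpan B ≤ Gauss.vec E 𝒢 :=
  noiseSpan_le (Gauss.isClosed_vec h𝒢) fun t x =>
    (Gauss.isClosed_vec h𝒢).mem_of_tendsto (hB t x) (Eventually.of_forall fun _ =>
      Submodule.sum_mem _ fun n _ => Gauss.tens_mem_vec (hb𝒢 n t) _)

variable [MeasurableSpace E] [BorelSpace E] [SecondCountableTopology E]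

/-- The Gaussian part of the solution has the same law for the shifted noise. -/
theorem IsCylindrical.map_sol_shift (hh : 1 / 2 < h) (hb : IsFamily h b) (hB : IsCylindrical b B)
    {𝒢 : Submodule ℝ (Lp ℝ 2 P)} (h𝒢 : IsClosed (𝒢 : Set (Lp ℝ 2 P))) (hb𝒢 : ∀ n t, b n t ∈ 𝒢)
    (hG : Gauss.IsGaussian 𝒢) {N α : ℝ} {S : ℝ → E →L[ℝ] E} (hS : Evol.IsStable N α S)
    {g : ℝ → lp (fun _ : ι => E) 2} (hg : Continuous g) {M : ℝ} (hM : ∀ s, ‖g s‖ ≤ M) (τ t : ℝ) :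
    P.map ⇑(Evol.sol (Evol.onLp P S) (Evol.onSeq ι S) (shiftNoise B τ) (fun s => (0, g s)) t)
      = P.map ⇑(Evol.sol (Evol.onLp P S) (Evol.onSeq ι S) B (fun s => (0, g s)) t) := by
  have hs := hB.isSystem hh hb hS
  obtain ⟨V, hV, -⟩ := hs.noise.exists_map (hs.shift τ).noise
  have h1 := hs.sol_mem_noiseSpan (t := t) hg hM
  have h2 := (hs.shift τ).sol_mem_noiseSpan (t := t) hg hM
  have h3 : noiseSpan (shiftNoise B τ) ≤ Gauss.vec E 𝒢 :=
    (hB.shift τ).noiseSpan_le_vec h𝒢 fun n t => 𝒢.sub_mem (hb𝒢 _ _) (hb𝒢 _ _)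
  refine hG.map_eq (h3 h2) (hB.noiseSpan_le_vec h𝒢 hb𝒢 h1) fun v => ?_
  rw [← hs.map_sol (hs.shift τ) hg hM hV]
  exact hB.norm_coord_shift hh hb hV h1 v

theorem mem_lpMeas_bot_iff {X : Lp E 2 P} :
    X ∈ lpMeas E ℝ ⊥ 2 P ↔ ∃ c : E, X =ᵐ[P] fun _ => c := by
  rw [mem_lpMeas_iff_aestronglyMeasurable]
  constructor
  · rintro ⟨u, hu, h⟩
    obtain ⟨c, hc⟩ := stronglyMeasurable_bot_iff.1 hu
    exact ⟨c, hc ▸ h⟩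
  · rintro ⟨c, hc⟩
    exact ⟨fun _ => c, stronglyMeasurable_const, hc⟩

theorem onLp_mem_lpMeas {Ω : Type*} {m m0 : MeasurableSpace Ω} {P : Measure Ω} (S : ℝ → E →L[ℝ] E) (r : ℝ) {X : Lp E 2 P}
    (hX : X ∈ lpMeas E ℝ m 2 P) : Evol.onLp P S r X ∈ lpMeas E ℝ m 2 P := by
  rw [mem_lpMeas_iff_aestronglyMeasurable] at hX ⊢
  refine ((S r).continuous.comp_aestronglyMeasurable hX).congr ?_
  exact ((S r).coeFn_compLpL X).symm

/-- If the drift is non-random then the law of the solution does not change when the noise is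
shifted. -/
theorem IsCylindrical.law_sol_shift (hh : 1 / 2 < h) (hb : IsFamily h b) (hB : IsCylindrical b B)
    {𝒢 : Submodule ℝ (Lp ℝ 2 P)} (h𝒢 : IsClosed (𝒢 : Set (Lp ℝ 2 P))) (hb𝒢 : ∀ n t, b n t ∈ 𝒢)
    (hG : Gauss.IsGaussian 𝒢) {N α : ℝ} {S : ℝ → E →L[ℝ] E} (hS : Evol.IsStable N α S)
    {p : ℝ → Lp E 2 P × lp (fun _ : ι => E) 2} (hp : Continuous p) {M : ℝ} (hM : ∀ s, ‖p s‖ ≤ M)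
    (hc : ∀ s, ∃ c : E, (p s).1 =ᵐ[P] fun _ => c) (τ t : ℝ) :
    BL.law (Evol.sol (Evol.onLp P S) (Evol.onSeq ι S) (shiftNoise B τ) p t)
      = BL.law (Evol.sol (Evol.onLp P S) (Evol.onSeq ι S) B p t) := by
  have hs := hB.isSystem hh hb hS
  have h1 : ∀ s, ‖(p s).1‖ ≤ M := fun s => (norm_fst_le (p s)).trans (hM s)
  have h2 : ∀ s, ‖(p s).2‖ ≤ M := fun s => (norm_snd_le (p s)).trans (hM s)
  have e1 := hs.sol_eq_add (t := t) hp.fst hp.snd hM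
  have e2 := (hs.shift τ).sol_eq_add (t := t) hp.fst hp.snd hM
  -- The drift part stays in the closed space of almost surely constant vectors and does not see the
  -- noise, so both laws are translates of Gaussian laws by the same constant.
  have hcon : Evol.sol (Evol.onLp P S) (Evol.onSeq ι S) B (fun s => ((p s).1, 0)) t
      ∈ lpMeas E ℝ ⊥ 2 P := by
    refine hs.sol_mem (M := M) (by fun_prop) (fun s => ?_) (isClosed_lpMeas bot_le)
      (fun r x hx => onLp_mem_lpMeas S r hx) (fun s _ => mem_lpMeas_bot_iff.2 (hc s))
      fun s _ r _ u => ?_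
    · rw [Prod.norm_mk, norm_zero, max_eq_left (norm_nonneg _)]
      exact h1 s
    · rw [map_zero, map_zero]
      exact Submodule.zero_mem _
  obtain ⟨c, hc⟩ := mem_lpMeas_bot_iff.1 hcon
  refine BL.Prob.ext ?_
  rw [e1, e2, (hs.shift τ).sol_eq_sol hs hp.fst h1, BL.meas_law_const_add hc,
    BL.meas_law_const_add hc, hB.map_sol_shift hh hb h𝒢 hb𝒢 hG hS hp.snd h2]

end FBM

/-! ## The moving average representation of fractional Brownian motion -/

namespace FBM

/-- The Mandelbrot–van Ness kernel. -/
noncomputable def mvn (a t u : ℝ) : ℝ := (max (t - u) 0) ^ a - (max (-u) 0) ^ a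

variable {a : ℝ}

theorem continuous_mvn (ha : 0 < a) (t : ℝ) : Continuous (mvn a t) := by
  refine Continuous.sub ?_ ?_ <;>
  exact Continuous.rpow_const (by fun_prop) fun _ => Or.inr ha.le

theorem mvn_sub (a s t u : ℝ) : mvn a t u - mvn a s u = mvn a (t - s) (u - s) := by
  simp only [mvn, sub_sub_sub_cancel_right, neg_sub]

theorem mvn_neg (a t u : ℝ) : mvn a (-t) u = -mvn a t (u + t) := by
  have h1 : -t - u = -(u + t) := by ring
  have h2 : t - (u + t) = -u := by ring
  simp only [mvn, h1, h2]
  ring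

theorem mvn_mul {r : ℝ} (hr : 0 < r) (u : ℝ) : mvn a r (r * u) = r ^ a * mvn a 1 u := by
  have h1 : ∀ x : ℝ, (max (r * x) 0) ^ a = r ^ a * (max x 0) ^ a := fun x => by
    rw [← mul_zero r, ← mul_max_of_nonneg _ _ hr.le, mul_zero,
      Real.mul_rpow hr.le (le_max_right _ _)]
  have h2 : r - r * u = r * (1 - u) := by ring
  have h3 : -(r * u) = r * -u := by ring
  simp only [mvn, h2, h3, h1]
  ring

theorem mvn_of_nonneg {t u : ℝ} (ht : t ≤ u) (hu : 0 ≤ u) : mvn a t u = 0 := by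
  rw [mvn, max_eq_right (by linarith), max_eq_right (by linarith), sub_self]

theorem mvn_of_le (ha : 0 < a) {t u : ℝ} (ht : t ≤ u) (hu : u ≤ 0) : mvn a t u = -(-u) ^ a := by
  rw [mvn, max_eq_right (by linarith), max_eq_left (by linarith), Real.zero_rpow ha.ne', zero_sub]

/-- Bernoulli's inequality `(1 + 1 / v) ^ a ≤ 1 + a / v` with `v = -u`. The decay is square
integrable at `-∞` because `2 * a - 2 < -1`. -/
theorem abs_mvn_one_le (ha : 0 < a) (ha1 : a < 1 / 2) {u : ℝ} (hu : u < 0) :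
    |mvn a 1 u| ≤ (-u) ^ (a - 1) := by
  have hv : 0 < -u := neg_pos.2 hu
  have h1 : mvn a 1 u = (-u) ^ a * ((1 + (-u)⁻¹) ^ a - 1) := by
    rw [mvn, max_eq_left (by linarith), max_eq_left hv.le, mul_sub, mul_one,
      ← Real.mul_rpow hv.le (by positivity), mul_add, mul_one, mul_inv_cancel₀ hv.ne']
    congr 2
    ring
  have h2 : (1 + (-u)⁻¹) ^ a ≤ 1 + a * (-u)⁻¹ :=
    rpow_one_add_le_one_add_mul_self (by have := inv_pos.2 hv; linarith) ha.le (by linarith)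
  have h3 : 1 ≤ (1 + (-u)⁻¹) ^ a :=
    Real.one_le_rpow (by have := inv_pos.2 hv; linarith) ha.le
  rw [h1, abs_of_nonneg (mul_nonneg (by positivity) (by linarith)), Real.rpow_sub_one hv.ne',
    div_eq_mul_inv]
  refine mul_le_mul_of_nonneg_left ?_ (by positivity)
  have : a * (-u)⁻¹ ≤ 1 * (-u)⁻¹ := mul_le_mul_of_nonneg_right (by linarith) (by positivity)
  linarith

theorem integrable_mvn_one_sq (ha : 0 < a) (ha1 : a < 1 / 2) :
    Integrable fun u => mvn a 1 u ^ 2 := by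
  have hc : Continuous fun u => mvn a 1 u ^ 2 := (continuous_mvn ha 1).pow 2
  have h1 : IntegrableOn (fun u => mvn a 1 u ^ 2) (Set.Iic (-1)) := by
    have h2 : IntegrableOn (fun u : ℝ => (-u) ^ (2 * a - 2)) (Set.Iic (-1)) := by
      have h3 := (integrableOn_Ioi_rpow_of_lt (a := 2 * a - 2) (by linarith) one_pos)
      rw [← integrableOn_Ici_iff_integrableOn_Ioi] at h3
      have h4 := ((Measure.measurePreserving_neg (volume : Measure ℝ)).integrableOn_comp_preimage
        (MeasurableEquiv.neg ℝ).measurableEmbedding).2 h3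
      rwa [Set.neg_preimage, Set.neg_Ici] at h4
    refine Integrable.mono' h2 hc.aestronglyMeasurable ?_
    filter_upwards [ae_restrict_mem measurableSet_Iic] with u hu
    have hu' : u < 0 := lt_of_le_of_lt hu (by norm_num)
    rw [Real.norm_eq_abs, abs_pow]
    refine (pow_le_pow_left₀ (abs_nonneg _) (abs_mvn_one_le ha ha1 hu') 2).trans_eq ?_
    rw [← Real.rpow_natCast, ← Real.rpow_mul (by linarith)]
    congr 1
    push_cast
    ring
  have h2 : IntegrableOn (fun u => mvn a 1 u ^ 2) (Set.Icc (-1) 1) :=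
    hc.continuousOn.integrableOn_Icc
  have h3 : IntegrableOn (fun u => mvn a 1 u ^ 2) (Set.Ici 1) := by
    refine (integrableOn_zero).congr_fun (fun u hu => ?_) measurableSet_Ici
    have : (1 : ℝ) ≤ u := hu
    simp [mvn_of_nonneg this (by linarith)]
  rw [← integrableOn_univ]
  refine ((h1.union h2).union h3).mono_set fun u _ => ?_
  rcases le_total u (-1) with h | h
  · exact Or.inl (Or.inl h)
  · rcases le_total u 1 with h' | h'
    · exact Or.inl (Or.inr ⟨h, h'⟩)
    · exact Or.inr h'

/-- Positive `t` reduces to `t = 1` by scaling, negative `t` to positive by translation. -/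
theorem integrable_integral_mvn_sq (ha : 0 < a) (ha1 : a < 1 / 2) (t : ℝ) :
    (Integrable fun u => mvn a t u ^ 2) ∧
      ∫ u, mvn a t u ^ 2 = |t| ^ (2 * a + 1) * ∫ u, mvn a 1 u ^ 2 := by
  have hpos : ∀ r : ℝ, 0 < r → (Integrable fun u => mvn a r u ^ 2) ∧
      ∫ u, mvn a r u ^ 2 = |r| ^ (2 * a + 1) * ∫ u, mvn a 1 u ^ 2 := by
    intro r hr
    have h1 : (fun u => mvn a r u ^ 2) = fun u => (r ^ a) ^ 2 * mvn a 1 (r⁻¹ * u) ^ 2 := by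
      funext u
      rw [← mul_pow, ← mvn_mul hr, mul_inv_cancel_left₀ hr.ne']
    rw [h1]
    refine ⟨((integrable_mvn_one_sq ha ha1).comp_mul_left' (inv_ne_zero hr.ne')).const_mul _, ?_⟩
    rw [integral_const_mul, Measure.integral_comp_mul_left (fun u => mvn a 1 u ^ 2), inv_inv,
      abs_of_pos hr, smul_eq_mul, ← mul_assoc]
    congr 1
    rw [Real.rpow_add_one hr.ne', ← Real.rpow_natCast, ← Real.rpow_mul hr.le]
    congr 2
    push_cast
    ring
  rcases lt_trichotomy t 0 with ht | rfl | ht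
  · have h1 : (fun u => mvn a t u ^ 2) = fun u => mvn a (-t) (u + -t) ^ 2 := by
      funext u
      have := mvn_neg a (-t) u
      rw [neg_neg] at this
      rw [this, neg_sq]
    obtain ⟨h2, h3⟩ := hpos (-t) (neg_pos.2 ht)
    rw [h1]
    refine ⟨h2.comp_add_right (-t), ?_⟩
    rw [integral_add_right_eq_self (fun u => mvn a (-t) u ^ 2), h3, abs_neg]
  · have h1 : (fun u => mvn a 0 u ^ 2) = fun _ => 0 := by
      funext u
      simp [mvn]
    rw [h1, abs_zero, Real.zero_rpow (by linarith)]
    simp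
  · exact hpos t ht

theorem memLp_mvn (ha : 0 < a) (ha1 : a < 1 / 2) (t : ℝ) : MemLp (mvn a t) 2 volume :=
  (memLp_two_iff_integrable_sq (continuous_mvn ha t).aestronglyMeasurable).2
    (integrable_integral_mvn_sq ha ha1 t).1

theorem integral_mvn_one_sq_pos (ha : 0 < a) (ha1 : a < 1 / 2) : 0 < ∫ u, mvn a 1 u ^ 2 := by
  rw [integral_pos_iff_support_of_nonneg (fun u => sq_nonneg _) (integrable_mvn_one_sq ha ha1)]
  refine lt_of_lt_of_le ?_ (measure_mono (s := Set.Ioo 0 1) fun u hu => ?_)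
  · simp
  · have : 0 < mvn a 1 u := by
      rw [mvn, max_eq_left (by linarith [hu.2]), max_eq_right (by linarith [hu.1]),
        Real.zero_rpow ha.ne', sub_zero]
      exact Real.rpow_pos_of_pos (by linarith [hu.2]) _
    exact (pow_pos this 2).ne'

/-- Polarization: the difference of two kernels is a translate of a kernel, so the inner products
follow from the norms. The Hurst index is `a + 1 / 2`. -/
theorem integral_mvn_mul (ha : 0 < a) (ha1 : a < 1 / 2) (s t : ℝ) :
    ∫ u, mvn a s u * mvn a t u = (∫ u, mvn a 1 u ^ 2) * cov (a + 1 / 2) s t := by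
  have hi := integrable_integral_mvn_sq ha ha1
  have h1 : ∀ u, mvn a s u * mvn a t u
      = 1 / 2 * (mvn a s u ^ 2 + mvn a t u ^ 2 - mvn a (s - t) (u - t) ^ 2) := fun u => by
    rw [← mvn_sub]
    ring
  simp only [h1]
  have hst : Integrable fun u => mvn a s u ^ 2 + mvn a t u ^ 2 := (hi s).1.add (hi t).1
  rw [integral_const_mul, integral_sub hst ((hi (s - t)).1.comp_sub_right t),
    integral_add (hi s).1 (hi t).1, integral_sub_right_eq_self (fun u => mvn a (s - t) u ^ 2),
    (hi s).2, (hi t).2, (hi (s - t)).2, cov]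
  have : 2 * (a + 1 / 2) = 2 * a + 1 := by ring
  rw [this]
  ring

theorem abs_integral_mul_le {μ : Measure ℝ} {f g : ℝ → ℝ} (hf : MemLp f 2 μ) (hg : MemLp g 2 μ) :
    |∫ u, f u * g u ∂μ| ≤ √(∫ u, f u ^ 2 ∂μ) * √(∫ u, g u ^ 2 ∂μ) := by
  have key : ∀ {f g : ℝ → ℝ} (hf : MemLp f 2 μ) (hg : MemLp g 2 μ),
      ⟪hf.toLp f, hg.toLp g⟫ = ∫ u, f u * g u ∂μ := fun hf hg => by
    rw [L2.inner_def]
    refine integral_congr_ae ?_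
    filter_upwards [hf.coeFn_toLp, hg.coeFn_toLp] with u h1 h2
    rw [h1, h2]
    simp only [RCLike.inner_apply, conj_trivial]
    ring
  have h1 := abs_real_inner_le_norm (hf.toLp f) (hg.toLp g)
  rw [key, norm_eq_sqrt_real_inner, norm_eq_sqrt_real_inner, key, key] at h1
  simpa only [sq] using h1

theorem integral_neg_rpow_sq {a : ℝ} (ha : 0 < a) {R : ℝ} (hR : 0 ≤ R) :
    ∫ u in Set.Ioc (-R) 0, ((-u) ^ a) ^ 2 = R ^ (2 * a + 1) / (2 * a + 1) := by
  rw [← intervalIntegral.integral_of_le (by linarith)]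
  have h1 := intervalIntegral.integral_comp_neg (a := -R) (b := 0) fun u : ℝ => (u ^ a) ^ 2
  rw [neg_neg, neg_zero] at h1
  rw [h1]
  have h2 : ∫ u in (0 : ℝ)..R, (u ^ a) ^ 2 = ∫ u in (0 : ℝ)..R, u ^ (2 * a) := by
    refine intervalIntegral.integral_congr fun u hu => ?_
    rw [Set.uIcc_of_le hR] at hu
    rw [← Real.rpow_natCast, ← Real.rpow_mul hu.1, mul_comm]
    norm_num
  rw [h2, integral_rpow (Or.inl (by linarith)), Real.zero_rpow (by linarith), sub_zero]

/-- A combination of kernels with indices in the remote past is almost orthogonal to `mvn a t`. -/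
theorem abs_integral_sum_mvn_mul_le (ha : 0 < a) (ha1 : a < 1 / 2) {R T : ℝ} (hR : 0 < R)
    (hRT : R ≤ T) {I : Finset ℝ} (hI : ∀ s ∈ I, s ≤ -T) (c : ℝ → ℝ) (t : ℝ) :
    |∫ u, (∑ s ∈ I, c s * mvn a s u) * mvn a t u| ≤ √(∫ u, (∑ s ∈ I, c s * mvn a s u) ^ 2) *
      (√(∫ u in Set.Iic (-R), mvn a t u ^ 2) + √((R / T) ^ (2 * a + 1)) *
        √(∫ u, mvn a t u ^ 2)) := by
  set k : ℝ → ℝ := fun u => ∑ s ∈ I, c s * mvn a s u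
  have hT : 0 < T := hR.trans_le hRT
  have hk : MemLp k 2 volume := memLp_finsetSum I fun s _ => (memLp_mvn ha ha1 s).const_mul (c s)
  have ht := memLp_mvn ha ha1 t
  have hki : Integrable fun u => k u ^ 2 := (memLp_two_iff_integrable_sq hk.1).1 hk
  have hti : Integrable fun u => mvn a t u ^ 2 := (memLp_two_iff_integrable_sq ht.1).1 ht
  set l := ∑ s ∈ I, c s
  have hk0 : ∀ u, 0 < u → k u = 0 := fun u hu => Finset.sum_eq_zero fun s hs => by
    rw [mvn_of_nonneg (by linarith [hI s hs]) hu.le, mul_zero]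
  -- To the right of all indices every kernel equals `-(-u) ^ a`, so on this interval `k` has a
  -- fixed shape and only the factor `l` depends on the combination.
  have hkl : ∀ u ∈ Set.Ioc (-T) 0, k u ^ 2 = l ^ 2 * ((-u) ^ a) ^ 2 := fun u hu => by
    have : k u = -l * (-u) ^ a := by
      simp only [k, l]
      rw [neg_mul, Finset.sum_mul, ← Finset.sum_neg_distrib]
      refine Finset.sum_congr rfl fun s hs => ?_
      rw [mvn_of_le ha (by linarith [hI s hs, hu.1]) hu.2, mul_neg]
    rw [this]
    ring
  have hkR : ∀ r, 0 ≤ r → r ≤ T → ∫ u in Set.Ioc (-r) 0, k u ^ 2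
      = l ^ 2 * (r ^ (2 * a + 1) / (2 * a + 1)) := fun r hr hrT => by
    rw [← integral_neg_rpow_sq ha hr, ← integral_const_mul]
    exact setIntegral_congr_fun measurableSet_Ioc fun u hu =>
      hkl u ⟨by linarith [hu.1], hu.2⟩
  -- By homogeneity, the energy on `(-R, 0]` is the fraction `(R / T) ^ (2 * a + 1)` of the energy
  -- on `(-T, 0]`.
  have h1 : ∫ u in Set.Ioc (-R) 0, k u ^ 2 ≤ (R / T) ^ (2 * a + 1) * ∫ u, k u ^ 2 := by
    have h2 : ∫ u in Set.Ioc (-T) 0, k u ^ 2 ≤ ∫ u, k u ^ 2 :=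
      setIntegral_le_integral hki (Eventually.of_forall fun u => sq_nonneg _)
    refine le_trans (le_of_eq ?_) (mul_le_mul_of_nonneg_left h2 (by positivity))
    rw [hkR R hR.le hRT, hkR T hT.le le_rfl, Real.div_rpow hR.le hT.le]
    have : T ^ (2 * a + 1) ≠ 0 := (Real.rpow_pos_of_pos hT _).ne'
    field_simp
  have hint : Integrable fun u => k u * mvn a t u := hk.integrable_mul ht
  have h2 : ∫ u, k u * mvn a t u = (∫ u in Set.Iic (-R), k u * mvn a t u)
      + ∫ u in Set.Ioc (-R) 0, k u * mvn a t u := by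
    rw [← setIntegral_union (Set.Iic_disjoint_Ioc le_rfl) measurableSet_Ioc hint.integrableOn
      hint.integrableOn, Set.Iic_union_Ioc_eq_Iic (by linarith)]
    refine (setIntegral_eq_integral_of_forall_compl_eq_zero fun u hu => ?_).symm
    rw [hk0 u (not_le.1 hu), zero_mul]
  rw [h2]
  refine (abs_add_le _ _).trans ?_
  rw [mul_add]
  refine add_le_add ((abs_integral_mul_le (hk.restrict _) (ht.restrict _)).trans ?_)
    ((abs_integral_mul_le (hk.restrict _) (ht.restrict _)).trans ?_)
  · exact mul_le_mul_of_nonneg_right (Real.sqrt_le_sqrt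
      (setIntegral_le_integral hki (Eventually.of_forall fun u => sq_nonneg _))) (Real.sqrt_nonneg _)
  · calc √(∫ u in Set.Ioc (-R) 0, k u ^ 2) * √(∫ u in Set.Ioc (-R) 0, mvn a t u ^ 2)
        ≤ √((R / T) ^ (2 * a + 1) * ∫ u, k u ^ 2) * √(∫ u, mvn a t u ^ 2) := by
          refine mul_le_mul (Real.sqrt_le_sqrt h1) (Real.sqrt_le_sqrt
            (setIntegral_le_integral hti (Eventually.of_forall fun u => sq_nonneg _)))
            (Real.sqrt_nonneg _) (Real.sqrt_nonneg _)
      _ = _ := by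
          rw [Real.sqrt_mul (by positivity)]
          ring

/-- Choose `R = n` first, to make the tail of the kernel of index `t` below `-n` small, and then `T`
so large compared with `n` that the energy fraction is small. -/
theorem exists_abs_integral_sum_mvn_mul_le (ha : 0 < a) (ha1 : a < 1 / 2) (t : ℝ) {ε : ℝ}
    (hε : 0 < ε) : ∃ T : ℝ, ∀ I : Finset ℝ, (∀ s ∈ I, s ≤ -T) → ∀ c : ℝ → ℝ,
      |∫ u, (∑ s ∈ I, c s * mvn a s u) * mvn a t u|
        ≤ √(∫ u, (∑ s ∈ I, c s * mvn a s u) ^ 2) * ε := by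
  have hti := (integrable_integral_mvn_sq ha ha1 t).1
  have h1 : Tendsto (fun n : ℕ => √(∫ u in Set.Iic (-(n : ℝ)), mvn a t u ^ 2)) atTop (𝓝 0) := by
    have h2 := tendsto_setIntegral_of_antitone (μ := volume) (s := fun n : ℕ => Set.Iic (-(n : ℝ)))
      (fun n => measurableSet_Iic) (fun n m hnm => Set.Iic_subset_Iic.2 (by
        have : (n : ℝ) ≤ m := by exact_mod_cast hnm
        linarith)) ⟨0, hti.integrableOn⟩
    have h3 : ⋂ n : ℕ, Set.Iic (-(n : ℝ)) = ∅ := by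
      rw [Set.eq_empty_iff_forall_notMem]
      intro u hu
      obtain ⟨n, hn⟩ := exists_nat_gt (-u)
      have := Set.mem_iInter.1 hu n
      rw [Set.mem_Iic] at this
      linarith
    rw [h3, Measure.restrict_empty, integral_zero_measure] at h2
    have := h2.sqrt
    rwa [Real.sqrt_zero] at this
  obtain ⟨n, hn, hn0⟩ := ((h1.eventually (gt_mem_nhds (half_pos hε))).and
    (eventually_gt_atTop 0)).exists
  have hn0' : (0 : ℝ) < n := by exact_mod_cast hn0
  have h2 : Tendsto (fun T : ℝ => √((n / T) ^ (2 * a + 1)) * √(∫ u, mvn a t u ^ 2)) atTop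
      (𝓝 (√(0 ^ (2 * a + 1)) * √(∫ u, mvn a t u ^ 2))) := by
    refine Tendsto.mul_const _ (Tendsto.sqrt ?_)
    exact (tendsto_const_nhds.div_atTop tendsto_id).rpow_const (Or.inr (by linarith))
  rw [Real.zero_rpow (by linarith), Real.sqrt_zero, zero_mul] at h2
  obtain ⟨T, hT, hTn⟩ := ((h2.eventually (gt_mem_nhds (half_pos hε))).and
    (eventually_ge_atTop (n : ℝ))).exists
  refine ⟨T, fun I hI c => (abs_integral_sum_mvn_mul_le ha ha1 hn0' hTn hI c t).trans ?_⟩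
  exact mul_le_mul_of_nonneg_left (by linarith) (Real.sqrt_nonneg _)

/-- The remote past of a fractional Brownian motion is almost orthogonal to its present. -/
theorem exists_abs_inner_le {h : ℝ} (hh : 1 / 2 < h) (hh1 : h < 1) {𝓛 : Type*}
    [NormedAddCommGroup 𝓛] [InnerProductSpace ℝ 𝓛] {b : ℝ → 𝓛} (hb : ∀ s t, ⟪b s, b t⟫ = cov h s t)
    (t : ℝ) {ε : ℝ} (hε : 0 < ε) : ∃ T : ℝ, ∀ x ∈ Submodule.span ℝ (b '' Set.Iic (-T)),
      |⟪x, b t⟫| ≤ ε * ‖x‖ := by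
  set a := h - 1 / 2
  have ha : 0 < a := by simp only [a]; linarith
  have ha1 : a < 1 / 2 := by simp only [a]; linarith
  have hah : a + 1 / 2 = h := by simp only [a]; ring
  set C := ∫ u, mvn a 1 u ^ 2
  have hC : 0 < C := integral_mvn_one_sq_pos ha ha1
  obtain ⟨T, hT⟩ := exists_abs_integral_sum_mvn_mul_le ha ha1 t
    (ε := ε * √C) (by positivity)
  refine ⟨T, fun x hx => ?_⟩
  obtain ⟨c, hc, rfl⟩ := (Finsupp.mem_span_image_iff_linearCombination ℝ).1 hx
  have hcI : ∀ s ∈ c.support, s ≤ -T := fun s hs => hc hs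
  have h1 := hT c.support hcI c
  have hm := memLp_mvn ha ha1
  have hint : ∀ s t, Integrable fun u => mvn a s u * mvn a t u := fun s t =>
    (hm s).integrable_mul (hm t)
  -- The kernels and the vectors `b s` have proportional Gram matrices, so the estimate transfers
  -- without representing `b` itself as a moving average.
  have key : ∀ t, ∫ u, (∑ s ∈ c.support, c s * mvn a s u) * mvn a t u
      = C * ⟪Finsupp.linearCombination ℝ b c, b t⟫ := fun t => by
    simp only [Finset.sum_mul, mul_assoc]
    rw [integral_finsetSum _ fun s _ => (hint s t).const_mul (c s)]
    simp only [integral_const_mul, integral_mvn_mul ha ha1, hah, ← hb]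
    rw [Finsupp.linearCombination_apply, Finsupp.sum, sum_inner, Finset.mul_sum]
    refine Finset.sum_congr rfl fun s _ => ?_
    rw [real_inner_smul_left]
    ring
  have key2 : ∫ u, (∑ s ∈ c.support, c s * mvn a s u) ^ 2
      = C * ‖Finsupp.linearCombination ℝ b c‖ ^ 2 := by
    have e : ∀ u, (∑ s ∈ c.support, c s * mvn a s u) ^ 2
        = ∑ r ∈ c.support, c r * ((∑ s ∈ c.support, c s * mvn a s u) * mvn a r u) := fun u => by
      rw [sq]
      conv_lhs => rw [Finset.mul_sum]
      exact Finset.sum_congr rfl fun r _ => by ring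
    simp only [e]
    rw [integral_finsetSum _ fun r _ => ?_]
    · simp only [integral_const_mul, key]
      rw [← real_inner_self_eq_norm_sq]
      conv_rhs => rw [Finsupp.linearCombination_apply, Finsupp.sum, inner_sum]
      rw [Finset.mul_sum]
      refine Finset.sum_congr rfl fun s _ => ?_
      rw [real_inner_smul_right, Finsupp.linearCombination_apply, Finsupp.sum]
      ring
    · refine Integrable.const_mul ?_ _
      simp only [Finset.sum_mul, mul_assoc]
      exact integrable_finsetSum _ fun s _ => (hint s r).const_mul (c s)
  rw [key, key2, abs_mul, abs_of_pos hC, Real.sqrt_mul hC.le, Real.sqrt_sq (norm_nonneg _)] at h1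
  have h2 : √C * ‖Finsupp.linearCombination ℝ b c‖ * (ε * √C)
      = C * (ε * ‖Finsupp.linearCombination ℝ b c‖) := by
    nth_rewrite 3 [← Real.mul_self_sqrt hC.le]
    ring
  rw [h2] at h1
  exact le_of_mul_le_mul_left h1 hC

end FBM

/-! ## Triviality of the remote past -/

namespace FBM

variable {Ω : Type*} [MeasurableSpace Ω] {P : Measure Ω} [IsProbabilityMeasure P]
  {ι : Type*} {h : ℝ} {b : ι → ℝ → Lp ℝ 2 P} {β : ι → ℝ → Ω → ℝ} {σ : ι → ℝ}

/-- The closed Gaussian space spanned by a family of fractional Brownian motions. -/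
noncomputable def gaussSpan (b : ι → ℝ → Lp ℝ 2 P) : Submodule ℝ (Lp ℝ 2 P) :=
  (⨆ n, Submodule.span ℝ (Set.range (b n))).topologicalClosure

theorem isClosed_gaussSpan : IsClosed (gaussSpan b : Set (Lp ℝ 2 P)) :=
  Submodule.isClosed_topologicalClosure _

theorem mem_gaussSpan (n : ι) (t : ℝ) : b n t ∈ gaussSpan b :=
  Submodule.le_topologicalClosure _ (Submodule.mem_iSup_of_mem n (Submodule.subset_span ⟨t, rfl⟩))

theorem gaussSpan_le {W : Submodule ℝ (Lp ℝ 2 P)} (hW : IsClosed (W : Set (Lp ℝ 2 P)))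
    (h : ∀ n t, b n t ∈ W) : gaussSpan b ≤ W :=
  Submodule.topologicalClosure_minimal _
    (iSup_le fun n => Submodule.span_le.2 (Set.range_subset_iff.2 (h n))) hW

/-- The elements of the Gaussian space uncorrelated with the noise before time `-T`. -/
noncomputable def pastOrthogonal (b : ι → ℝ → Lp ℝ 2 P) (T : ℝ) : Submodule ℝ (Lp ℝ 2 P) :=
  gaussSpan b ⊓ ⨅ (n : ι) (s : ℝ) (_ : s ≤ -T), (ℝ ∙ b n s)ᗮ

theorem mem_pastOrthogonal {T : ℝ} {w : Lp ℝ 2 P} : w ∈ pastOrthogonal b T ↔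
    w ∈ gaussSpan b ∧ ∀ n, ∀ s ≤ -T, ⟪b n s, w⟫ = 0 := by
  simp only [pastOrthogonal, Submodule.mem_inf, Submodule.mem_iInf,
    Submodule.mem_orthogonal_singleton_iff_inner_right]

theorem pastOrthogonal_mono : Monotone (pastOrthogonal b) := fun S T hST w hw => by
  rw [mem_pastOrthogonal] at hw ⊢
  exact ⟨hw.1, fun n s hs => hw.2 n s (by linarith)⟩

/-- Subtract from `b n t` its projection onto the past of the same component before `-k`. The
projection is small because the past is almost orthogonal to `b n t`; the remainder is orthogonal to
that past, and to the other components anyway. -/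
theorem IsFamily.mem_closure_pastOrthogonal (hh : 1 / 2 < h) (hh1 : h < 1) (hb : IsFamily h b)
    (n : ι) (t : ℝ) : b n t ∈ (⨆ k : ℕ, pastOrthogonal b k).topologicalClosure := by
  rw [← SetLike.mem_coe, Submodule.topologicalClosure_coe, Metric.mem_closure_iff]
  intro ε hε
  obtain ⟨T, hT⟩ := exists_abs_inner_le hh hh1 (hb.self n) t (half_pos hε)
  obtain ⟨k, hk⟩ := exists_nat_ge T
  set V := (Submodule.span ℝ (b n '' Set.Iic (-(k : ℝ)))).topologicalClosure
  have hV : IsClosed (V : Set (Lp ℝ 2 P)) := Submodule.isClosed_topologicalClosure _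
  have : CompleteSpace V := hV.completeSpace_coe
  have hmem : ∀ s ≤ -(k : ℝ), b n s ∈ V := fun s hs =>
    Submodule.le_topologicalClosure _ (Submodule.subset_span ⟨s, hs, rfl⟩)
  have hVn : V ≤ (Submodule.span ℝ (Set.range (b n))).topologicalClosure :=
    Submodule.topologicalClosure_mono (Submodule.span_mono (Set.image_subset_range _ _))
  have hest : ∀ x ∈ V, |⟪x, b n t⟫| ≤ ε / 2 * ‖x‖ := by
    have hc : IsClosed {x : Lp ℝ 2 P | |⟪x, b n t⟫| ≤ ε / 2 * ‖x‖} :=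
      isClosed_le (by fun_prop) (by fun_prop)
    intro x hx
    refine hc.closure_subset_iff.2 (fun y hy => hT y ?_) hx
    exact Submodule.span_mono (Set.image_mono (Set.Iic_subset_Iic.2 (by linarith))) hy
  set y := V.starProjection (b n t)
  have hy : y ∈ V := V.starProjection_apply_mem _
  have hperp : ∀ x ∈ V, ⟪x, b n t - y⟫ = 0 := fun x hx =>
    (Submodule.sub_starProjection_mem_orthogonal (K := V) (b n t)) x hx
  -- For the projection `y`, `‖y‖ ^ 2 = ⟪y, b n t⟫ ≤ ε / 2 * ‖y‖`.
  have hyn : ‖y‖ ≤ ε / 2 := by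
    have h1 := hest y hy
    have h2 := hperp y hy
    rw [inner_sub_right, sub_eq_zero] at h2
    rw [h2, real_inner_self_eq_norm_sq, abs_of_nonneg (sq_nonneg _), sq] at h1
    rcases (norm_nonneg y).eq_or_lt with h3 | h3
    · rw [← h3]; positivity
    · exact le_of_mul_le_mul_right h1 h3
  refine ⟨b n t - y, Submodule.mem_iSup_of_mem k (mem_pastOrthogonal.2 ⟨?_, ?_⟩), ?_⟩
  · refine Submodule.sub_mem _ (mem_gaussSpan n t) ?_
    refine Submodule.topologicalClosure_mono ?_ (hVn hy)
    exact le_iSup (fun n => Submodule.span ℝ (Set.range (b n))) n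
  · intro m s hs
    rcases eq_or_ne m n with rfl | hmn
    · exact hperp _ (hmem s hs)
    · have h1 : (Submodule.span ℝ (Set.range (b n))).topologicalClosure ≤ (ℝ ∙ b m s)ᗮ := by
        refine Submodule.topologicalClosure_minimal _ (Submodule.span_le.2 ?_)
          (Submodule.isClosed_orthogonal _)
        rintro _ ⟨r, rfl⟩
        rw [SetLike.mem_coe, Submodule.mem_orthogonal_singleton_iff_inner_right]
        exact hb.ne m n hmn s r
      have h2 := Submodule.mem_orthogonal_singleton_iff_inner_right.1 (h1 (hVn hy))
      rw [inner_sub_right, hb.ne m n hmn, h2, sub_zero]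
  · rw [dist_eq_norm, sub_sub_cancel]
    linarith

theorem filt_le_comap (σ : ι → ℝ) (β : ι → ℝ → Ω → ℝ) (t : ℝ) : filt σ β t ≤
    MeasurableSpace.comap (fun ω (j : ι × Set.Iic t) => β j.1 j.2 ω) inferInstance :=
  iSup_le fun n => iSup_le fun s => iSup_le fun hs => by
    rw [← measurable_iff_comap_le]
    have h1 : Measurable fun x : ι × Set.Iic t → ℝ => √(σ n) * x (n, ⟨s, hs⟩) := by fun_prop
    exact h1.comp (comap_measurable _)

theorem cf_add_of_indepFun {A B : Lp ℝ 2 P} (h : IndepFun A B P) :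
    Gauss.cf (A + B) = Gauss.cf A * Gauss.cf B := by
  have hc : Measurable fun x : ℝ => Complex.exp (x * Complex.I) := by fun_prop
  have h1 := (h.comp hc hc).integral_fun_mul_eq_mul_integral
    (hc.comp_aemeasurable (Lp.aestronglyMeasurable A).aemeasurable).aestronglyMeasurable
    (hc.comp_aemeasurable (Lp.aestronglyMeasurable B).aemeasurable).aestronglyMeasurable
  refine Eq.trans (integral_congr_ae ?_) h1
  filter_upwards [Lp.coeFn_add A B] with ω h2
  simp only [Function.comp_apply]
  rw [h2, Pi.add_apply, ← Complex.exp_add, ← add_mul, Complex.ofReal_add]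

variable {E : Type*} [NormedAddCommGroup E] [InnerProductSpace ℝ E] [CompleteSpace E]
  [MeasurableSpace E] [BorelSpace E] [SecondCountableTopology E]

theorem coord_mem_lpMeas {Ω : Type*} {m m0 : MeasurableSpace Ω} {P : Measure Ω} (v : E)
    {X : Lp E 2 P} (hX : X ∈ lpMeas E ℝ m 2 P) : Gauss.coord v X ∈ lpMeas ℝ ℝ m 2 P := by
  rw [mem_lpMeas_iff_aestronglyMeasurable] at hX ⊢
  refine ((innerSL ℝ v).continuous.comp_aestronglyMeasurable hX).congr ?_
  exact ((innerSL ℝ v).coeFn_compLpL X).symm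

/-- A random variable measurable with respect to the remote past is independent of the noise. -/
theorem IsFamily.cf_add_of_mem_lpMeas (hh : 1 / 2 < h) (hh1 : h < 1) (hb : IsFamily h b)
    (hβ : ∀ n t, b n t =ᵐ[P] β n t) (hG : Gauss.IsGaussian (gaussSpan b)) {A : Lp ℝ 2 P}
    (hA : ∀ s, A ∈ lpMeas ℝ ℝ (filt σ β s) 2 P) {w : Lp ℝ 2 P} (hw : w ∈ gaussSpan b) :
    Gauss.cf (w + A) = Gauss.cf w * Gauss.cf A := by
  have hc : IsClosed {w : Lp ℝ 2 P | Gauss.cf (w + A) = Gauss.cf w * Gauss.cf A} :=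
    isClosed_eq (Gauss.continuous_cf.comp (by fun_prop))
      (Gauss.continuous_cf.mul continuous_const)
  have hw' : w ∈ (⨆ k : ℕ, pastOrthogonal b k).topologicalClosure :=
    gaussSpan_le (Submodule.isClosed_topologicalClosure _)
      (hb.mem_closure_pastOrthogonal hh hh1) hw
  refine hc.closure_subset_iff.2 (fun y hy => ?_) hw'
  -- By density `w` may be taken orthogonal to the noise before `-k`. Being jointly Gaussian with
  -- it, `w` is independent of that noise, hence of `A`.
  obtain ⟨k, hk⟩ := (Submodule.mem_iSup_of_directed _ (Monotone.directed_le fun i j hij =>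
    pastOrthogonal_mono (by exact_mod_cast hij))).1 hy
  obtain ⟨hy1, hy2⟩ := mem_pastOrthogonal.1 hk
  have h1 : IndepFun (fun ω (j : ι × Set.Iic (-(k : ℝ))) => β j.1 j.2 ω) y P := by
    refine hG.indepFun (x := fun j : ι × Set.Iic (-(k : ℝ)) => b j.1 j.2) (fun j => hβ _ _)
      (fun j => mem_gaussSpan _ _) (Gauss.mem_vec.2 fun v => ?_) fun j v => ?_
    all_goals
      have e : Gauss.coord v y = v • y := by
        ext
        filter_upwards [Gauss.coeFn_coord v y, Lp.coeFn_smul v y] with ω h1 h2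
        rw [h1, h2, Pi.smul_apply, smul_eq_mul, mul_comm]
        rfl
    · rw [e]
      exact Submodule.smul_mem _ _ hy1
    · rw [e, real_inner_smul_right, hy2 _ _ j.2.2, mul_zero]
  obtain ⟨A', hA', hAA'⟩ := mem_lpMeas_iff_aestronglyMeasurable.1 (hA (-(k : ℝ)))
  have h2 : IndepFun A' y P := by
    rw [IndepFun_iff_Indep] at h1 ⊢
    refine indep_of_indep_of_le_left h1 (le_trans ?_ (filt_le_comap σ β _))
    exact hA'.measurable.comap_le
  have h3 : IndepFun y A P := (h2.congr hAA'.symm (ae_eq_refl _)).symm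
  exact cf_add_of_indepFun h3

/-- A random vector measurable with respect to the remote past is constant. -/
theorem IsFamily.exists_ae_eq_const (hh : 1 / 2 < h) (hh1 : h < 1) (hb : IsFamily h b)
    (hβ : ∀ n t, b n t =ᵐ[P] β n t) (hG : Gauss.IsGaussian (gaussSpan b)) {F : Lp E 2 P}
    (hF : ∀ s, F ∈ lpMeas E ℝ (filt σ β s) 2 P) : ∃ c : E, F =ᵐ[P] fun _ => c := by
  have h1 : IndepFun (fun ω (j : ι × Set.Iic (0 : ℝ)) => β j.1 j.2 ω) F P := by
    refine Gauss.indepFun_of_cf (x := fun j : ι × Set.Iic (0 : ℝ) => b j.1 j.2) (fun j => hβ _ _)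
      fun w hw v => hb.cf_add_of_mem_lpMeas hh hh1 hβ hG (fun s => coord_mem_lpMeas v (hF s)) ?_
    exact Submodule.span_le.2 (Set.range_subset_iff.2 fun j => mem_gaussSpan _ _) hw
  obtain ⟨F', hF', hFF'⟩ := mem_lpMeas_iff_aestronglyMeasurable.1 (hF 0)
  have h2 : IndepFun F' F P := by
    rw [IndepFun_iff_Indep] at h1 ⊢
    refine indep_of_indep_of_le_left h1 (le_trans ?_ (filt_le_comap σ β _))
    exact hF'.measurable.comap_le
  -- `F` is independent of the noise up to time `0` and agrees almost surely with a function of it,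
  -- so it is independent of itself and every `⟪v, F⟫` has variance zero.
  have h3 : IndepFun F F P := h2.congr hFF'.symm (ae_eq_refl _)
  have hint : Integrable F P := (Lp.memLp F).integrable (by norm_num)
  set c := ∫ ω, F ω ∂P
  have key : ∀ v : E, ∀ᵐ ω ∂P, ⟪v, F ω - c⟫ = 0 := by
    intro v
    have hm : Measurable fun x : E => ⟪v, x⟫ := by fun_prop
    have hL : MemLp (fun ω => ⟪v, F ω⟫) 2 P := (Lp.memLp F).const_inner v
    have h4 := (h3.comp hm hm).integral_fun_mul_eq_mul_integral hL.1 hL.1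
    simp only [Function.comp_apply] at h4
    have hc : ∫ ω, ⟪v, F ω⟫ ∂P = ⟪v, c⟫ := integral_inner hint v
    rw [hc] at h4
    have hsq : Integrable (fun ω => ⟪v, F ω⟫ * ⟪v, F ω⟫) P := hL.integrable_mul hL
    have hi : Integrable (fun ω => ⟪v, F ω⟫) P := hL.integrable (by norm_num)
    have e : ∀ ω, ⟪v, F ω - c⟫ ^ 2
        = ⟪v, F ω⟫ * ⟪v, F ω⟫ - (2 * ⟪v, c⟫) * ⟪v, F ω⟫ + ⟪v, c⟫ * ⟪v, c⟫ := fun ω => by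
      rw [inner_sub_right]
      ring
    have hi2 : Integrable (fun ω => ⟪v, F ω⟫ * ⟪v, F ω⟫ - (2 * ⟪v, c⟫) * ⟪v, F ω⟫) P :=
      hsq.sub (hi.const_mul _)
    have h5 : ∫ ω, ⟪v, F ω - c⟫ ^ 2 ∂P = 0 := by
      simp only [e]
      rw [integral_add hi2 (integrable_const _), integral_sub hsq (hi.const_mul _),
        integral_const_mul, h4, hc]
      simp
      ring
    have h6 : Integrable (fun ω => ⟪v, F ω - c⟫ ^ 2) P := by
      simp only [e]
      exact hi2.add (integrable_const _)
    have h7 := (integral_eq_zero_iff_of_nonneg (fun ω => sq_nonneg _) h6).1 h5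
    filter_upwards [h7] with ω hω
    exact pow_eq_zero_iff two_ne_zero |>.1 hω
  refine ⟨c, ?_⟩
  filter_upwards [ae_all_iff.2 fun k => key (TopologicalSpace.denseSeq E k)] with ω hω
  refine sub_eq_zero.1 ((TopologicalSpace.denseRange_denseSeq E).eq_zero_of_inner_right ℝ ?_)
  intro k
  exact hω k

/-- An adapted drift that returns along arbitrarily remote past times is non-random. -/
theorem IsFamily.exists_ae_eq_const_of_isAdapted (hh : 1 / 2 < h) (hh1 : h < 1) (hb : IsFamily h b)
    (hβm : ∀ n t, Measurable (β n t)) (hβ : ∀ n t, b n t =ᵐ[P] β n t)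
    (hG : Gauss.IsGaussian (gaussSpan b)) {f : ℝ → Lp E 2 P} (hf : IsAdapted σ β f) {t : ℝ}
    (hr : ∀ ε l : ℝ, 0 < ε → ∃ τ < -l, dist (f (t + τ)) (f t) < ε) :
    ∃ c : E, f t =ᵐ[P] fun _ => c := by
  refine hb.exists_ae_eq_const hh hh1 hβ hG (σ := σ) fun s => ?_
  have hc := isClosed_lpMeas (E := E) (P := P) (filt_le (σ := σ) hβm s)
  rw [← SetLike.mem_coe, ← hc.closure_eq, Metric.mem_closure_iff]
  intro ε hε
  -- The bound `t - s` gives `t + τ < s`, so that `f (t + τ)` is measurable at time `s`.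
  obtain ⟨τ, hτ, hd⟩ := hr ε (t - s) hε
  refine ⟨f (t + τ), ?_, by rwa [dist_comm]⟩
  exact mem_lpMeas_iff_aestronglyMeasurable.2 ((hf (t + τ)).mono (filt_mono σ β (by linarith)))

end FBM

/-! ## Decorrelation of the increments in the remote past and future -/

/-- A second-order bound from two Bernoulli inequalities: with `y = a / x`, `1 + p * y ≤ (1 + y) ^ p
≤ (1 + y) * (1 + (p - 1) * y)`, and the outer terms differ by `(p - 1) * y ^ 2`. -/
theorem abs_rpow_add_sub_le {p x a : ℝ} (h1 : 1 ≤ p) (h2 : p ≤ 2) (hx : x ≠ 0) (ha : |a| ≤ |x|) :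
    |(|x + a| ^ p - |x| ^ p - p * |x| ^ p * (a / x))| ≤ a ^ 2 * |x| ^ (p - 2) := by
  have hx' : 0 < |x| := abs_pos.2 hx
  have hy : |a / x| ≤ 1 := by rw [abs_div]; exact div_le_one_of_le₀ ha hx'.le
  set y := a / x with hy_def
  have hy1 : -1 ≤ y := (abs_le.1 hy).1
  have hxa : |x + a| = |x| * (1 + y) := by
    rw [← abs_of_nonneg (by linarith : 0 ≤ 1 + y), ← abs_mul, hy_def]
    congr 1
    field_simp
  have e1 := one_add_mul_self_le_rpow_one_add hy1 h1
  have e2 := rpow_one_add_le_one_add_mul_self hy1 (by linarith : 0 ≤ p - 1) (by linarith)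
  have e3 : (1 + y) ^ p ≤ (1 + y) * (1 + (p - 1) * y) := by
    rcases eq_or_lt_of_le (by linarith : 0 ≤ 1 + y) with h0 | h0
    · rw [← h0, Real.zero_rpow (by linarith), zero_mul]
    · calc (1 + y) ^ p = (1 + y) * (1 + y) ^ (p - 1) := by
            rw [← Real.rpow_one_add' h0.le (by linarith)]; congr 1; ring
        _ ≤ _ := mul_le_mul_of_nonneg_left e2 h0.le
  have e4 : a ^ 2 * |x| ^ (p - 2) = |x| ^ p * y ^ 2 := by
    rw [Real.rpow_sub hx', Real.rpow_two, sq_abs, hy_def]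
    field_simp
  have e5 : 0 ≤ |x| ^ p := by positivity
  rw [hxa, Real.mul_rpow hx'.le (by linarith), e4,
    show |x| ^ p * (1 + y) ^ p - |x| ^ p - p * |x| ^ p * y
      = |x| ^ p * ((1 + y) ^ p - (1 + p * y)) by ring, abs_mul, abs_of_nonneg e5]
  refine mul_le_mul_of_nonneg_left (abs_le.2 ⟨?_, ?_⟩) e5
  · nlinarith [sq_nonneg y]
  · nlinarith [sq_nonneg y]

/-- The mixed second differences of `|x| ^ p`, `p < 2`, vanish at infinity. -/
theorem tendsto_second_difference {p a b c d : ℝ} (h1 : 1 ≤ p) (h2 : p < 2) (h : a + d = b + c) :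
    Tendsto (fun x : ℝ => |x + a| ^ p - |x + b| ^ p - |x + c| ^ p + |x + d| ^ p)
      (cocompact ℝ) (𝓝 0) := by
  have hn : Tendsto (fun x : ℝ => |x|) (cocompact ℝ) atTop := tendsto_norm_cocompact_atTop
  have hlim : Tendsto (fun x : ℝ => (a ^ 2 + b ^ 2 + c ^ 2 + d ^ 2) * |x| ^ (p - 2)) (cocompact ℝ)
      (𝓝 0) := by
    have := (tendsto_rpow_neg_atTop (by linarith : 0 < 2 - p)).comp hn
    simpa only [neg_sub, mul_zero, Function.comp_def] using
      this.const_mul (a ^ 2 + b ^ 2 + c ^ 2 + d ^ 2)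
  refine squeeze_zero_norm' ?_ hlim
  filter_upwards [hn.eventually_ge_atTop (|a| + |b| + |c| + |d| + 1)] with x hx
  have hx0 : x ≠ 0 := by
    rintro rfl
    rw [abs_zero] at hx
    linarith [abs_nonneg a, abs_nonneg b, abs_nonneg c, abs_nonneg d]
  have i1 := abs_nonneg a
  have i2 := abs_nonneg b
  have i3 := abs_nonneg c
  have i4 := abs_nonneg d
  have ea := abs_le.1 (abs_rpow_add_sub_le h1 h2.le hx0 (by linarith : |a| ≤ |x|))
  have eb := abs_le.1 (abs_rpow_add_sub_le h1 h2.le hx0 (by linarith : |b| ≤ |x|))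
  have ec := abs_le.1 (abs_rpow_add_sub_le h1 h2.le hx0 (by linarith : |c| ≤ |x|))
  have ed := abs_le.1 (abs_rpow_add_sub_le h1 h2.le hx0 (by linarith : |d| ≤ |x|))
  -- The first-order terms cancel because `a + d = b + c`.
  have key : p * |x| ^ p * (a / x) + p * |x| ^ p * (d / x)
      = p * |x| ^ p * (b / x) + p * |x| ^ p * (c / x) := by
    rw [← mul_add, ← mul_add, ← add_div, ← add_div, h]
  rw [Real.norm_eq_abs]
  exact abs_le.2 ⟨by linarith [ea.1, eb.2, ec.2, ed.1], by linarith [ea.2, eb.1, ec.1, ed.2]⟩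

/-- The vectors along which a family of operators tends to zero. -/
def tendstoZero {𝓛 𝓛' T : Type*} [NormedAddCommGroup 𝓛] [NormedSpace ℝ 𝓛] [NormedAddCommGroup 𝓛']
    [NormedSpace ℝ 𝓛'] (L : T → 𝓛 →L[ℝ] 𝓛') (l : Filter T) : Submodule ℝ 𝓛 where
  carrier := {y | Tendsto (fun τ => L τ y) l (𝓝 0)}
  add_mem' {x y} hx hy := by
    rw [Set.mem_ofPred_eq] at hx hy ⊢
    simpa only [map_add, add_zero] using hx.add hy
  zero_mem' := by simp [tendsto_const_nhds]
  smul_mem' r x hx := by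
    rw [Set.mem_ofPred_eq] at hx ⊢
    simpa only [map_smul, smul_zero] using hx.const_smul r

theorem isClosed_tendstoZero {𝓛 𝓛' T : Type*} [NormedAddCommGroup 𝓛] [NormedSpace ℝ 𝓛]
    [NormedAddCommGroup 𝓛'] [NormedSpace ℝ 𝓛'] {L : T → 𝓛 →L[ℝ] 𝓛'} (l : Filter T)
    (hL : ∀ τ y, ‖L τ y‖ ≤ ‖y‖) : IsClosed (tendstoZero L l : Set 𝓛) := by
  refine isClosed_of_closure_subset fun y hy => ?_
  change Tendsto (fun τ => L τ y) l (𝓝 0)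
  refine Metric.tendsto_nhds.2 fun ε hε => ?_
  obtain ⟨z, hz, hyz⟩ := Metric.mem_closure_iff.1 hy (ε / 2) (half_pos hε)
  have hz' : Tendsto (fun τ => L τ z) l (𝓝 0) := hz
  filter_upwards [Metric.tendsto_nhds.1 hz' (ε / 2) (half_pos hε)] with τ hτ
  have h1 := hL τ (y - z)
  rw [map_sub] at h1
  rw [dist_zero_right] at hτ ⊢
  rw [dist_eq_norm] at hyz
  have h2 := norm_add_le (L τ y - L τ z) (L τ z)
  rw [sub_add_cancel] at h2
  linarith

instance finiteDimensional_span_range {F J : Type*} [NormedAddCommGroup F] [InnerProductSpace ℝ F]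
    [Finite J] (x : J → F) : FiniteDimensional ℝ (Submodule.span ℝ (Set.range x)) :=
  FiniteDimensional.span_of_finite ℝ (Set.finite_range x)

theorem tendsto_starProjection_span {F T J : Type*} [NormedAddCommGroup F] [InnerProductSpace ℝ F]
    [Finite J] {x : J → F} {l : Filter T} {c : T → F}
    (h : ∀ j, Tendsto (fun τ => ⟪x j, c τ⟫) l (𝓝 0)) :
    Tendsto (fun τ => (Submodule.span ℝ (Set.range x)).starProjection (c τ)) l (𝓝 0) := by
  let K := Submodule.span ℝ (Set.range x)
  have h1 : ∀ u ∈ K, Tendsto (fun τ => ⟪u, c τ⟫) l (𝓝 0) := fun u hu => by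
    induction hu using Submodule.span_induction with
    | mem u hu => obtain ⟨j, rfl⟩ := hu; exact h j
    | zero => simp [tendsto_const_nhds]
    | add u v _ _ hu hv => simpa only [inner_add_left, add_zero] using hu.add hv
    | smul r u _ hu => simpa only [real_inner_smul_left, mul_zero] using hu.const_mul r
  let w := stdOrthonormalBasis ℝ K
  have h2 : ∀ y, K.starProjection y = ∑ i, ⟪((w i : K) : F), y⟫ • ((w i : K) : F) := fun y => by
    rw [Submodule.starProjection_apply, w.orthogonalProjectionOnto_apply_eq_sum]
    simp
  refine Tendsto.congr (fun τ => (h2 _).symm) ?_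
  rw [show (0 : F) = ∑ i, (0 : ℝ) • ((w i : K) : F) by simp]
  exact tendsto_finsetSum _ fun i _ => (h1 _ (w i).2).smul_const _

/-! ### Projections of the restarted noise onto finitely many values of the noise. -/

namespace FBM

variable {Ω : Type*} [MeasurableSpace Ω] {P : Measure Ω}
  {E : Type*} [NormedAddCommGroup E] [InnerProductSpace ℝ E] [CompleteSpace E]

/-- The random vectors `∑ x_j v_j` and their limits. -/
noncomputable def tensSpan (E : Type*) [NormedAddCommGroup E] [InnerProductSpace ℝ E] {J : Type*}
    (x : J → Lp ℝ 2 P) : Submodule ℝ (Lp E 2 P) :=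
  (Submodule.span ℝ (Set.range fun q : J × E => tens (x q.1) q.2)).topologicalClosure

instance {J : Type*} (x : J → Lp ℝ 2 P) : CompleteSpace (tensSpan E x) :=
  (Submodule.isClosed_topologicalClosure _).completeSpace_coe

theorem mem_tensSpan_orthogonal {J : Type*} {x : J → Lp ℝ 2 P} {Z : Lp E 2 P} :
    Z ∈ (tensSpan E x)ᗮ ↔ ∀ j v, ⟪tens (x j) v, Z⟫ = 0 := by
  rw [tensSpan, Submodule.orthogonal_closure, Submodule.mem_orthogonal]
  refine ⟨fun h j v => h _ (Submodule.subset_span ⟨(j, v), rfl⟩), fun h u hu => ?_⟩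
  induction hu using Submodule.span_induction with
  | mem u hu => obtain ⟨q, rfl⟩ := hu; exact h q.1 q.2
  | zero => simp
  | add u v _ _ hu hv => rw [inner_add_left, hu, hv, add_zero]
  | smul r u _ hu => rw [real_inner_smul_left, hu, mul_zero]

/-- The part of `c` orthogonal to the `x j` stays orthogonal after tensoring. This reduces the
projection onto `tensSpan`, which is infinite-dimensional in general, to a finite-dimensional scalar
one. -/
theorem norm_starProjection_tens_le {J : Type*} [Finite J] (x : J → Lp ℝ 2 P) (c : Lp ℝ 2 P)
    (v : E) : ‖(tensSpan E x).starProjection (tens c v)‖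
      ≤ ‖(Submodule.span ℝ (Set.range x)).starProjection c‖ * ‖v‖ := by
  let K := Submodule.span ℝ (Set.range x)
  have h1 : tens (c - K.starProjection c) v ∈ (tensSpan E x)ᗮ :=
    mem_tensSpan_orthogonal.2 fun j u => by
      have := K.sub_starProjection_mem_orthogonal c
      rw [inner_tens, (K.mem_orthogonal _).1 this _ (Submodule.subset_span ⟨j, rfl⟩), zero_mul]
  have h2 : (tensSpan E x).starProjection (tens c v)
      = (tensSpan E x).starProjection (tens (K.starProjection c) v) := by
    rw [tens_sub] at h1
    have := (Submodule.starProjection_apply_eq_zero_iff (K := tensSpan E x)).2 h1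
    rwa [map_sub, sub_eq_zero] at this
  rw [h2, ← norm_tens]
  exact Submodule.norm_starProjection_apply_le _ _

variable {ι : Type*} {h : ℝ} {b : ι → ℝ → Lp ℝ 2 P} {B : ℝ → lp (fun _ : ι => E) 2 →L[ℝ] Lp E 2 P}

/-- The covariance with a far increment is a mixed second difference of `|x| ^ (2 * h)`, which
vanishes at infinity since `2 * h < 2`. -/
theorem IsFamily.tendsto_inner_increment (hh : 1 / 2 < h) (hh1 : h < 1) (hb : IsFamily h b)
    (m n : ι) (u s : ℝ) :
    Tendsto (fun τ => ⟪b m u, b n (s + τ) - b n τ⟫) (cocompact ℝ) (𝓝 0) := by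
  by_cases hmn : m = n
  · subst hmn
    have h1 := (tendsto_second_difference (p := 2 * h) (a := s) (b := s - u) (c := 0) (d := -u)
      (by linarith) (by linarith) (by ring)).const_mul (1 / 2)
    rw [mul_zero] at h1
    refine h1.congr fun τ => ?_
    rw [inner_sub_right, hb.self, hb.self, cov, cov, add_zero, abs_sub_comm u (s + τ),
      abs_sub_comm u τ, show τ + s = s + τ by ring, show τ + (s - u) = s + τ - u by ring,
      show τ + -u = τ - u by ring]
    ring
  · simp only [inner_sub_right, hb.ne m n hmn, sub_zero, tendsto_const_nhds]

/-- The shifted noise becomes uncorrelated with any finite set of values of the original one. -/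
theorem IsCylindrical.tendsto_starProjection (hh : 1 / 2 < h) (hh1 : h < 1) (hb : IsFamily h b)
    (hB : IsCylindrical b B) {V : ℝ → Lp E 2 P →L[ℝ] Lp E 2 P}
    (hV : ∀ τ t x, V τ (B t x) = shiftNoise B τ t x) (hV1 : ∀ τ y, ‖V τ y‖ ≤ ‖y‖)
    (J : Finset (ι × ℝ)) {Z : Lp E 2 P} (hZ : Z ∈ noiseSpan B) :
    Tendsto (fun τ => (tensSpan E fun j : J => b j.1.1 j.1.2).starProjection (V τ Z))
      (cocompact ℝ) (𝓝 0) := by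
  classical
  set W := tensSpan E fun j : J => b j.1.1 j.1.2
  have hc : IsClosed (tendstoZero (fun τ => W.starProjection ∘L V τ) (cocompact ℝ) :
      -- The maps are contractions, so the claim is closed under limits and has to be checked only
      -- for `tens (b n s) (x n)`.
      Set (Lp E 2 P)) := isClosed_tendstoZero _ fun τ y =>
    (Submodule.norm_starProjection_apply_le _ _).trans (hV1 τ y)
  refine noiseSpan_le hc (fun s x => hc.mem_of_tendsto (hB s x) (Eventually.of_forall fun A =>
    Submodule.sum_mem _ fun n _ => ?_)) hZ
  change Tendsto (fun τ => W.starProjection (V τ (tens (b n s) (x n)))) _ _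
  have e : ∀ τ, V τ (tens (b n s) (x n)) = tens (b n (s + τ) - b n τ) (x n) := fun τ => by
    rw [← hB.single s n (x n), hV, shiftNoise, sub_apply, hB.single, hB.single, tens_sub]
  simp only [e]
  refine squeeze_zero_norm (fun τ => norm_starProjection_tens_le _ _ _) ?_
  have := (tendsto_starProjection_span (x := fun j : J => b j.1.1 j.1.2) fun j =>
    hb.tendsto_inner_increment hh hh1 j.1.1 n j.1.2 s).norm.mul_const ‖x n‖
  simpa only [norm_zero, zero_mul] using this

end FBM

/-! ## Asymptotic independence of the shifted noise -/

/-- Random variables measurable with respect to the supremum of a directed family of σ-algebras are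
approximated by variables measurable with respect to its members. -/
theorem exists_dist_lt_of_mem_lpMeas_iSup {Ω I : Type*} {m0 : MeasurableSpace Ω} {P : Measure Ω}
    [IsFiniteMeasure P] {E : Type*} [NormedAddCommGroup E] [NormedSpace ℝ E] [CompleteSpace E]
    [Preorder I] [IsDirectedOrder I] [Nonempty I] {m : I → MeasurableSpace Ω} (hmono : Monotone m)
    (hm : ∀ i, m i ≤ m0) {F : Lp E 2 P} (hF : F ∈ lpMeas E ℝ (⨆ i, m i) 2 P) {ε : ℝ} (hε : 0 < ε) :
    ∃ i, ∃ F' ∈ lpMeas E ℝ (m i) 2 P, dist F F' < ε := by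
  have hsup : ⨆ i, m i ≤ m0 := iSup_le hm
  rw [mem_lpMeas_iff_aestronglyMeasurable] at hF
  refine Lp.induction_stronglyMeasurable hsup (by norm_num)
    (fun F => ∀ ε > 0, ∃ i, ∃ F' ∈ lpMeas E ℝ (m i) 2 P, dist F F' < ε) ?_ ?_ ?_ F hF ε hε
  · intro c s hs hμs ε hε
    -- By directedness the union of the σ-algebras is an algebra of sets; it generates their
    -- supremum and is therefore dense in measure.
    let 𝒜 : Set (Set Ω) := {A | ∃ i, MeasurableSet[m i] A}
    have h𝒜 : IsSetAlgebra 𝒜 :=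
      { empty_mem := ⟨Classical.arbitrary I, @MeasurableSet.empty _ (m _)⟩
        compl_mem := fun A ⟨i, hA⟩ => ⟨i, hA.compl⟩
        union_mem := fun A A' ⟨i, hA⟩ ⟨j, hA'⟩ => by
          obtain ⟨k, hik, hjk⟩ := exists_ge_ge i j
          exact ⟨k, (hmono hik _ hA).union (hmono hjk _ hA')⟩ }
    have hgen : (⨆ i, m i) = MeasurableSpace.generateFrom 𝒜 := le_antisymm
      (iSup_le fun i A hA => MeasurableSpace.measurableSet_generateFrom ⟨i, hA⟩)
      (MeasurableSpace.generateFrom_le fun A ⟨i, hA⟩ => le_iSup m i _ hA)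
    have : IsFiniteMeasure (P.trim hsup) := isFiniteMeasure_trim hsup
    have hd := @Measure.MeasureDense.of_generateFrom_isSetAlgebra_finite _ (⨆ i, m i) (P.trim hsup) 𝒜 _ h𝒜 hgen
    obtain ⟨A, ⟨i, hA⟩, hA'⟩ := @Measure.MeasureDense.approx _ (⨆ i, m i) _ _ hd s hs
      (@measure_ne_top _ (⨆ i, m i) _ _ _) ((ε / (‖c‖ + 1)) ^ 2)
      (by positivity)
    have hsA : MeasurableSet[⨆ i, m i] (symmDiff s A) := hs.symmDiff (le_iSup m i _ hA)
    rw [trim_measurableSet_eq hsup hsA] at hA'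
    refine ⟨i, indicatorConstLp 2 (hm i _ hA) (measure_ne_top _ _) c,
      mem_lpMeas_indicatorConstLp (hm i) hA (measure_ne_top _ _), ?_⟩
    rw [Lp.simpleFunc.coe_indicatorConst, dist_indicatorConstLp_eq_norm,
      norm_indicatorConstLp (by norm_num) (by norm_num)]
    have h1 : P.real (symmDiff s A) < (ε / (‖c‖ + 1)) ^ 2 := by
      rw [measureReal_def, ← ENNReal.toReal_ofReal (by positivity : 0 ≤ (ε / (‖c‖ + 1)) ^ 2)]
      exact ENNReal.toReal_strict_mono ENNReal.ofReal_ne_top hA'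
    have h2 : P.real (symmDiff s A) ^ (1 / (2 : ℝ≥0∞).toReal) ≤ ε / (‖c‖ + 1) := by
      rw [ENNReal.toReal_ofNat, ← Real.sqrt_eq_rpow]
      exact Real.sqrt_le_iff.2 ⟨by positivity, h1.le⟩
    calc _ ≤ ‖c‖ * (ε / (‖c‖ + 1)) := mul_le_mul_of_nonneg_left h2 (norm_nonneg c)
      _ < (‖c‖ + 1) * (ε / (‖c‖ + 1)) := mul_lt_mul_of_pos_right (lt_add_one _) (by positivity)
      _ = ε := by field_simp
  · intro f g hf hg _ _ _ h1 h2 ε hε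
    obtain ⟨i, F', hF', hd⟩ := h1 (ε / 2) (half_pos hε)
    obtain ⟨j, G', hG', hd'⟩ := h2 (ε / 2) (half_pos hε)
    obtain ⟨k, hik, hjk⟩ := exists_ge_ge i j
    rw [mem_lpMeas_iff_aestronglyMeasurable] at hF' hG'
    refine ⟨k, F' + G', Submodule.add_mem _ ?_ ?_,
      (dist_add_add_le _ _ _ _).trans_lt (by linarith)⟩
    · exact mem_lpMeas_iff_aestronglyMeasurable.2 (hF'.mono (hmono hik))
    · exact mem_lpMeas_iff_aestronglyMeasurable.2 (hG'.mono (hmono hjk))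
  · refine isClosed_of_closure_subset fun f hf ε hε => ?_
    obtain ⟨g, hg, hfg⟩ := Metric.mem_closure_iff.1 hf (ε / 2) (half_pos hε)
    obtain ⟨i, F', hF', hd⟩ := hg (ε / 2) (half_pos hε)
    exact ⟨i, F', hF', (dist_triangle _ (g : Lp E 2 P) _).trans_lt
      (by linarith [show dist (f : Lp E 2 P) g < ε / 2 from hfg])⟩

/-! ### Laws of sums of independent random vectors. -/

namespace BL

variable {E : Type*} [NormedAddCommGroup E] [InnerProductSpace ℝ E] [MeasurableSpace E]
  [BorelSpace E] [SecondCountableTopology E] {Ω : Type*} [MeasurableSpace Ω] {P : Measure Ω}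
  [IsProbabilityMeasure P]

/-- The sum of independent copies of `X` and `Z`. -/
noncomputable def indepSum (X Z : Lp E 2 P) : Lp E 2 (P.prod P) :=
  Lp.compMeasurePreserving Prod.fst measurePreserving_fst X
    + Lp.compMeasurePreserving Prod.snd measurePreserving_snd Z

theorem dist_indepSum_le (X Z X' Z' : Lp E 2 P) :
    dist (indepSum X Z) (indepSum X' Z') ≤ dist X X' + dist Z Z' :=
  (dist_add_add_le _ _ _ _).trans_eq (by
    rw [(Lp.isometry_compMeasurePreserving _).dist_eq, (Lp.isometry_compMeasurePreserving _).dist_eq])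

theorem meas_law_indepSum (X Z : Lp E 2 P) :
    (law (indepSum X Z)).meas = (P.map X).conv (P.map Z) := by
  have hX := (Lp.stronglyMeasurable X).measurable
  have hZ := (Lp.stronglyMeasurable Z).measurable
  rw [Measure.conv, Measure.map_prod_map _ _ hX hZ, Measure.map_map (by fun_prop) (by fun_prop)]
  refine Measure.map_congr ?_
  filter_upwards [Lp.coeFn_add (Lp.compMeasurePreserving Prod.fst measurePreserving_fst X :
      Lp E 2 (P.prod P)) (Lp.compMeasurePreserving Prod.snd measurePreserving_snd Z),
    Lp.coeFn_compMeasurePreserving X (measurePreserving_fst (μ := P) (ν := P)),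
    Lp.coeFn_compMeasurePreserving Z (measurePreserving_snd (μ := P) (ν := P))] with ω h1 h2 h3
  rw [indepSum, h1, Pi.add_apply, h2, h3]
  rfl

theorem law_add_of_indepFun {X Z : Lp E 2 P} (h : IndepFun X Z P) :
    law (X + Z) = law (indepSum X Z) := by
  refine Prob.ext ?_
  rw [meas_law_indepSum, ← h.map_add_eq_map_conv_map (Lp.stronglyMeasurable X).measurable
    (Lp.stronglyMeasurable Z).measurable]
  exact Measure.map_congr (Lp.coeFn_add X Z)

theorem law_indepSum_congr {X Z Z' : Lp E 2 P} (h : P.map Z = P.map Z') :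
    law (indepSum X Z) = law (indepSum X Z') :=
  Prob.ext (by rw [meas_law_indepSum, meas_law_indepSum, h])

end BL

namespace FBM

variable {Ω : Type*} [MeasurableSpace Ω] {P : Measure Ω} [IsProbabilityMeasure P]
  {E : Type*} [NormedAddCommGroup E] [InnerProductSpace ℝ E] [CompleteSpace E]
  [MeasurableSpace E] [BorelSpace E] [SecondCountableTopology E]
  {ι : Type*} {h : ℝ} {b : ι → ℝ → Lp ℝ 2 P} {β : ι → ℝ → Ω → ℝ} {σ : ι → ℝ}
  {B : ℝ → lp (fun _ : ι => E) 2 →L[ℝ] Lp E 2 P}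

/-- The σ-algebra generated by finitely many values of the noise. -/
@[reducible] def cylinder (β : ι → ℝ → Ω → ℝ) (J : Finset (ι × ℝ)) : MeasurableSpace Ω :=
  MeasurableSpace.comap (fun ω (j : J) => β j.1.1 j.1.2 ω) inferInstance

theorem cylinder_mono (β : ι → ℝ → Ω → ℝ) : Monotone (cylinder β) := fun J J' hJ => by
  rw [cylinder, ← measurable_iff_comap_le]
  have h1 : Measurable fun (x : J' → ℝ) (j : J) => x ⟨j.1, hJ j.2⟩ := by fun_prop
  exact h1.comp (comap_measurable _)

theorem cylinder_le (hβm : ∀ n t, Measurable (β n t)) (J : Finset (ι × ℝ)) :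
    cylinder β J ≤ ‹MeasurableSpace Ω› := by
  rw [cylinder, ← measurable_iff_comap_le]
  exact measurable_pi_lambda _ fun j => hβm _ _

theorem filt_le_iSup_cylinder (σ : ι → ℝ) (β : ι → ℝ → Ω → ℝ) (t : ℝ) :
    filt σ β t ≤ ⨆ J, cylinder β J :=
  iSup_le fun n => iSup_le fun s => iSup_le fun _ => by
    refine le_trans ?_ (le_iSup (cylinder β) {(n, s)})
    rw [← measurable_iff_comap_le]
    have h1 : Measurable fun x : ({(n, s)} : Finset (ι × ℝ)) → ℝ =>
      √(σ n) * x ⟨(n, s), Finset.mem_singleton_self _⟩ := by fun_prop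
    exact h1.comp (comap_measurable _)

/-- Far shifts of the noise are asymptotically independent of the noise. -/
theorem IsCylindrical.tendsto_dist_law (hh : 1 / 2 < h) (hh1 : h < 1) (hb : IsFamily h b)
    (hB : IsCylindrical b B) (hβm : ∀ n t, Measurable (β n t)) (hβ : ∀ n t, b n t =ᵐ[P] β n t)
    (hG : Gauss.IsGaussian (gaussSpan b)) {V : ℝ → Lp E 2 P →L[ℝ] Lp E 2 P}
    (hV : ∀ τ t x, V τ (B t x) = shiftNoise B τ t x) (hV1 : ∀ τ y, ‖V τ y‖ ≤ ‖y‖)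
    {F Z : Lp E 2 P} (hF : F ∈ lpMeas E ℝ (⨆ J, cylinder β J) 2 P) (hZ : Z ∈ noiseSpan B) :
    Tendsto (fun τ => dist (BL.law (F + V τ Z)) (BL.law (BL.indepSum F Z))) (cocompact ℝ)
      (𝓝 0) := by
  refine Metric.tendsto_nhds.2 fun ε hε => ?_
  obtain ⟨J, F', hF', hd⟩ := exists_dist_lt_of_mem_lpMeas_iSup (cylinder_mono β) (cylinder_le hβm)
    hF (ε := ε / 4) (by linarith)
  let W := tensSpan E fun j : J => b j.1.1 j.1.2
  have hvec : noiseSpan B ≤ Gauss.vec E (gaussSpan b) :=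
    hB.noiseSpan_le_vec isClosed_gaussSpan mem_gaussSpan
  have hVZ : ∀ τ, V τ Z ∈ Gauss.vec E (gaussSpan b) := fun τ => by
    refine noiseSpan_le (W := (Gauss.vec E (gaussSpan b)).comap (V τ).toLinearMap)
      ((Gauss.isClosed_vec isClosed_gaussSpan).preimage (V τ).continuous) (fun t x => ?_) hZ
    rw [Submodule.mem_comap, ContinuousLinearMap.coe_coe, hV]
    exact Submodule.sub_mem _ (hvec (mem_noiseSpan _ _ _)) (hvec (mem_noiseSpan _ _ _))
  have hWvec : W ≤ Gauss.vec E (gaussSpan b) :=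
    Submodule.topologicalClosure_minimal _ (Submodule.span_le.2 (Set.range_subset_iff.2 fun q =>
      Gauss.tens_mem_vec (mem_gaussSpan _ _) _)) (Gauss.isClosed_vec isClosed_gaussSpan)
  have hlim := hB.tendsto_starProjection hh hh1 hb hV hV1 J hZ
  filter_upwards [Metric.tendsto_nhds.1 hlim (ε / 4) (by linarith)] with τ hτ
  rw [dist_zero_right] at hτ
  rw [dist_zero_right, Real.norm_of_nonneg dist_nonneg]
  -- Removing the small projection leaves a Gaussian vector uncorrelated with the noise values
  -- indexed by `J`, hence independent of `F'`.
  set Y := V τ Z - W.starProjection (V τ Z) with hY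
  have hdY : dist (V τ Z) Y < ε / 4 := by rw [dist_eq_norm, hY, sub_sub_cancel]; exact hτ
  have hYvec : Y ∈ Gauss.vec E (gaussSpan b) :=
    Submodule.sub_mem _ (hVZ τ) (hWvec (Submodule.starProjection_apply_mem _ _))
  have hYW : Y ∈ Wᗮ := W.sub_starProjection_mem_orthogonal _
  have hind : IndepFun F' Y P := by
    have h1 := hG.indepFun (x := fun j : J => b j.1.1 j.1.2)
      (X := fun j : J => β j.1.1 j.1.2) (fun j => hβ _ _) (fun j => mem_gaussSpan _ _) hYvec
      (fun j v => by rw [Gauss.inner_coord]; exact mem_tensSpan_orthogonal.1 hYW j v)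
    rw [mem_lpMeas_iff_aestronglyMeasurable] at hF'
    obtain ⟨u, hu, hFu⟩ := hF'
    refine IndepFun.congr ?_ hFu.symm (ae_eq_refl _)
    rw [IndepFun_iff_Indep] at h1 ⊢
    exact indep_of_indep_of_le_left h1 hu.measurable.comap_le
  have hmap : P.map ⇑(V τ Z) = P.map ⇑Z :=
    hG.map_eq (hVZ τ) (hvec hZ) fun v => hB.norm_coord_shift hh hb (hV τ) hZ v
  have e1 : dist (BL.law (F + V τ Z)) (BL.law (F' + Y)) < ε / 4 + ε / 4 :=
    (BL.dist_law_le _ _).trans_lt ((dist_add_add_le _ _ _ _).trans_lt (add_lt_add hd hdY))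
  have e2 : dist (BL.law (BL.indepSum F (V τ Z))) (BL.law (BL.indepSum F' Y)) < ε / 4 + ε / 4 :=
    (BL.dist_law_le _ _).trans_lt ((BL.dist_indepSum_le _ _ _ _).trans_lt (add_lt_add hd hdY))
  rw [BL.law_indepSum_congr hmap] at e2
  rw [BL.law_add_of_indepFun hind] at e1
  exact (dist_triangle_right _ _ _).trans_lt (by linarith)

end FBM

/-! ## Lagrange stability -/

/-- A sequence in the closure is shadowed by a sequence in `s` at distance `1 / (k + 1)`, so
subsequential limits need to be found only for sequences in `s`. -/
theorem isCompact_closure_of_subseq_tendsto {X : Type*} [UniformSpace X]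
    [IsCountablyGenerated (uniformity X)] {s : Set X}
    (h : ∀ u : ℕ → X, (∀ k, u k ∈ s) →
      ∃ a, ∃ n : ℕ → ℕ, StrictMono n ∧ Tendsto (u ∘ n) atTop (𝓝 a)) :
    IsCompact (closure s) := by
  let _ : PseudoMetricSpace X := UniformSpace.pseudoMetricSpace X
  refine IsSeqCompact.isCompact fun u hu => ?_
  choose v hv hd using fun k : ℕ =>
    Metric.mem_closure_iff.1 (hu k) (1 / ((k : ℝ) + 1)) Nat.one_div_pos_of_nat
  obtain ⟨a, n, hn, ha⟩ := h v hv
  have h1 : Tendsto (fun k => 1 / (((n k : ℕ) : ℝ) + 1)) atTop (𝓝 0) :=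
    tendsto_one_div_add_atTop_nhds_zero_nat.comp hn.tendsto_atTop
  refine ⟨a, mem_closure_of_tendsto ha (Eventually.of_forall fun k => hv _), n, hn, ?_⟩
  rw [tendsto_iff_dist_tendsto_zero] at ha ⊢
  refine squeeze_zero (fun _ => dist_nonneg) (fun k => ?_) (by simpa only [add_zero] using h1.add ha)
  exact (dist_triangle _ (v (n k)) _).trans (add_le_add (hd _).le le_rfl)

namespace Recur

variable {X : Type*} [PseudoMetricSpace X]

theorem continuous_translate (φ : C(ℝ, X)) : Continuous (translate φ) :=
  (ContinuousMap.curry ⟨fun q : ℝ × ℝ => φ (q.1 + q.2), by fun_prop⟩).continuous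

theorem isLagrangeStable_of_subseq {φ : C(ℝ, X)} (h : ∀ u : ℕ → ℝ, ∃ ψ : C(ℝ, X), ∃ n : ℕ → ℕ,
    StrictMono n ∧ Tendsto (fun k => translate φ (u (n k))) atTop (𝓝 ψ)) :
    IsLagrangeStable φ :=
  isCompact_closure_of_subseq_tendsto fun v hv => by
    choose u hu using hv
    obtain ⟨ψ, n, hn, hψ⟩ := h u
    exact ⟨ψ, n, hn, hψ.congr fun k => hu _⟩

end Recur

namespace FBM

variable {Ω : Type*} [MeasurableSpace Ω] {P : Measure Ω} [IsProbabilityMeasure P]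
  {E : Type*} [NormedAddCommGroup E] [InnerProductSpace ℝ E] [CompleteSpace E]
  [MeasurableSpace E] [BorelSpace E] [SecondCountableTopology E]
  {ι : Type*} {h : ℝ} {b : ι → ℝ → Lp ℝ 2 P} {β : ι → ℝ → Ω → ℝ}
  {B : ℝ → lp (fun _ : ι => E) 2 →L[ℝ] Lp E 2 P} {N α M : ℝ} {S : ℝ → E →L[ℝ] E}

/-- Extract a subsequence along which the translated coefficients converge to some `q`. If the
shifts have a bounded subsequence, continuity of translation suffices. Otherwise they leave every
compact set, and the laws converge to that of the sum of independent copies of `F t`, the drift part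
for `q`, and `Z t`, the noise part for `q`. -/
theorem IsCylindrical.isLagrangeStable (hh : 1 / 2 < h) (hh1 : h < 1) (hb : IsFamily h b)
    (hB : IsCylindrical b B) (hβm : ∀ n t, Measurable (β n t)) (hβ : ∀ n t, b n t =ᵐ[P] β n t)
    (hG : Gauss.IsGaussian (gaussSpan b)) (hS : Evol.IsStable N α S)
    {p : C(ℝ, Lp E 2 P × lp (fun _ : ι => E) 2)} (hM : ∀ s, ‖p s‖ ≤ M)
    (hp : ∀ s, (p s).1 ∈ lpMeas E ℝ (⨆ J, cylinder β J) 2 P) (hL : Recur.IsLagrangeStable p)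
    {Λ : C(ℝ, BL.Prob E)}
    (hΛ : ∀ t, Λ t = BL.law (Evol.sol (Evol.onLp P S) (Evol.onSeq ι S) B p t)) :
    Recur.IsLagrangeStable Λ := by
  have hs := hB.isSystem hh hb hS
  have hclosed : IsClosed (lpMeas E ℝ (⨆ J, cylinder β J) 2 P : Set (Lp E 2 P)) :=
    isClosed_lpMeas (iSup_le (cylinder_le hβm))
  refine Recur.isLagrangeStable_of_subseq fun u => ?_
  obtain ⟨q, -, n, hn, hq⟩ := hL.isSeqCompact fun k => subset_closure ⟨u k, rfl⟩
  by_cases hfreq : ∃ R, ∃ᶠ k in atTop, u (n k) ∈ Metric.closedBall 0 R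
  · obtain ⟨R, hR⟩ := hfreq
    obtain ⟨a, -, m, hm, ha⟩ := tendsto_subseq_of_frequently_bounded Metric.isBounded_closedBall hR
    exact ⟨Recur.translate Λ a, n ∘ m, hn.comp hm,
      ((Recur.continuous_translate Λ).tendsto a).comp ha⟩
  have hu : Tendsto (fun k => u (n k)) atTop (cocompact ℝ) := by
    rw [← Metric.cobounded_eq_cocompact, ← tendsto_norm_atTop_iff_cobounded]
    refine tendsto_atTop.2 fun R => ?_
    have := not_frequently.1 fun h1 => hfreq ⟨R, h1⟩
    filter_upwards [this] with k hk
    rw [mem_closedBall_zero_iff, not_le] at hk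
    exact hk.le
  have hpt : ∀ s, Tendsto (fun k => p (u (n k) + s)) atTop (𝓝 (q s)) := fun s =>
    ((ContinuousEvalConst.continuous_eval_const s).tendsto q).comp hq
  have hqM : ∀ s, ‖q s‖ ≤ M := fun s =>
    le_of_tendsto (hpt s).norm (Eventually.of_forall fun k => hM _)
  have hq1 : ∀ s, (q s).1 ∈ lpMeas E ℝ (⨆ J, cylinder β J) 2 P := fun s =>
    hclosed.mem_of_tendsto ((continuous_fst.tendsto _).comp (hpt s))
      (Eventually.of_forall fun k => hp _)
  have hqM1 : ∀ s, ‖(q s).1‖ ≤ M := fun s => (norm_fst_le _).trans (hqM s)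
  have hqM2 : ∀ s, ‖(q s).2‖ ≤ M := fun s => (norm_snd_le _).trans (hqM s)
  have hqc : Continuous q := map_continuous q
  set F := Evol.sol (Evol.onLp P S) (Evol.onSeq ι S) B fun s => ((q s).1, 0)
  set Z := Evol.sol (Evol.onLp P S) (Evol.onSeq ι S) B fun s => (0, (q s).2)
  have hqM1' : ∀ s, ‖((q s).1, (0 : lp (fun _ : ι => E) 2))‖ ≤ M := fun s => by
    rw [Prod.norm_mk, norm_zero, max_eq_left (norm_nonneg _)]
    exact hqM1 s
  have hqM2' : ∀ s, ‖((0 : Lp E 2 P), (q s).2)‖ ≤ M := fun s => by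
    rw [Prod.norm_mk, norm_zero, max_eq_right (norm_nonneg _)]
    exact hqM2 s
  have hFc : Continuous F := hs.continuous_sol (by fun_prop) hqM1'
  have hZc : Continuous Z := hs.continuous_sol (by fun_prop) hqM2'
  have hFm : ∀ t, F t ∈ lpMeas E ℝ (⨆ J, cylinder β J) 2 P := fun t => by
    refine hs.sol_mem (M := M) (by fun_prop) hqM1' hclosed
      (fun r x hx => onLp_mem_lpMeas S r hx) (fun s _ => hq1 s) fun s _ r _ u => ?_
    rw [map_zero, map_zero]
    exact Submodule.zero_mem _
  have hZm : ∀ t, Z t ∈ noiseSpan B := fun t => hs.sol_mem_noiseSpan hqc.snd hqM2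
  choose V hV hV1 using fun τ => hs.noise.exists_map (hs.shift τ).noise
  have hsol : ∀ τ t, Evol.sol (Evol.onLp P S) (Evol.onSeq ι S) (shiftNoise B τ) q t
      = F t + V τ (Z t) := fun τ t => by
    rw [hs.map_sol (hs.shift τ) hqc.snd hqM2 (hV τ),
      show F t = _ from hs.sol_eq_sol (hs.shift τ) hqc.fst hqM1]
    exact (hs.shift τ).sol_eq_add hqc.fst hqc.snd hqM
  have hsumc : ∀ s t, dist (BL.law (BL.indepSum (F s) (Z s))) (BL.law (BL.indepSum (F t) (Z t)))
      ≤ dist (F s) (F t) + dist (Z s) (Z t) := fun s t =>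
    (BL.dist_law_le _ _).trans (BL.dist_indepSum_le _ _ _ _)
  have hcont : Continuous fun t => BL.law (BL.indepSum (F t) (Z t)) := by
    refine continuous_iff_continuousAt.2 fun t => tendsto_iff_dist_tendsto_zero.2
      (squeeze_zero (fun _ => dist_nonneg) (fun s => hsumc s t) ?_)
    have h1 : Continuous fun s => dist (F s) (F t) + dist (Z s) (Z t) := by fun_prop
    simpa only [dist_self, add_zero] using h1.tendsto t
  refine ⟨⟨_, hcont⟩, n, hn, ?_⟩
  rw [ContinuousMap.tendsto_iff_tendstoLocallyUniformly, Metric.tendstoLocallyUniformly_iff]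
  intro ε hε t₀
  obtain ⟨δ, hδ, K, hK, hwin⟩ := Evol.IsSystem.exists_window (h := h) (Evol.onLp P S)
    (Evol.onSeq ι S) (hS.onLp P) M (ε := ε / 4) (by linarith)
  -- Asymptotic independence is known for one time only. Since `V τ` is a contraction, continuity of
  -- `F` and `Z` at `t₀` carries it to nearby times uniformly in `τ`.
  have hFn := Metric.tendsto_nhds.1 (hFc.tendsto t₀) (ε / 8) (by linarith)
  have hZn := Metric.tendsto_nhds.1 (hZc.tendsto t₀) (ε / 8) (by linarith)
  refine ⟨_, inter_mem (inter_mem hFn hZn) (Metric.closedBall_mem_nhds t₀ one_pos), ?_⟩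
  have hunif := ContinuousMap.tendsto_iff_forall_isCompact_tendstoUniformlyOn.1 hq
    (Set.Icc (t₀ - 1 - K) (t₀ + 1)) isCompact_Icc
  have hmix := (hB.tendsto_dist_law hh hh1 hb hβm hβ hG hV hV1 (hFm t₀) (hZm t₀)).comp hu
  filter_upwards [Metric.tendstoUniformlyOn_iff.1 hunif δ hδ,
    Metric.tendsto_nhds.1 hmix (ε / 4) (by linarith)] with k hk1 hk2
  rintro t ⟨⟨htF, htZ⟩, ht⟩
  rw [Set.mem_ofPred_eq] at htF htZ
  rw [Metric.mem_closedBall, Real.dist_eq, abs_le] at ht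
  simp only [Function.comp_apply] at hk2
  rw [dist_zero_right, Real.norm_of_nonneg dist_nonneg] at hk2
  set τ := u (n k) with hτ
  have e1 : dist (Λ (τ + t)) (BL.law (F t + V τ (Z t))) ≤ ε / 4 := by
    rw [hΛ, ← hsol, add_comm, Evol.sol_shift]
    refine (BL.dist_law_le _ _).trans (hwin _ _ _ (hs.shift τ)
      ((map_continuous p).comp (continuous_id.add_const τ)) hqc (fun s => hM _) hqM t fun s hst => ?_)
    have h1 : dist (q s) (p (τ + s)) < δ :=
      hk1 s ⟨by linarith [hst.1, ht.1], by linarith [hst.2, ht.2]⟩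
    rw [dist_comm, add_comm] at h1
    exact h1.le
  have e2 : dist (BL.law (F t + V τ (Z t))) (BL.law (F t₀ + V τ (Z t₀))) ≤ ε / 8 + ε / 8 := by
    refine (BL.dist_law_le _ _).trans ((dist_add_add_le _ _ _ _).trans (add_le_add htF.le ?_))
    rw [dist_eq_norm, ← map_sub]
    exact (hV1 _ _).trans ((dist_eq_norm _ _).ge.trans htZ.le)
  have e3 := hsumc t t₀
  change dist (BL.law (BL.indepSum (F t) (Z t))) (Λ (τ + t)) < ε
  have e4 := dist_triangle4_right (BL.law (BL.indepSum (F t) (Z t))) (Λ (τ + t))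
    (BL.law (BL.indepSum (F t₀) (Z t₀))) (BL.law (F t₀ + V τ (Z t₀)))
  have e5 := dist_triangle (Λ (τ + t)) (BL.law (F t + V τ (Z t))) (BL.law (F t₀ + V τ (Z t₀)))
  rw [dist_comm] at hk2
  linarith

end FBM

/-! ## The bounded mild solution and its law -/

namespace Recur

variable {X : Type*} [PseudoMetricSpace X]

/-- Going forward by `n j` and back by `n i` with `i` much larger than `j`: going back adds nearly
the phase `θ`, and the forward move together with `θ` nearly returns to the start. -/
theorem IsQuasiPeriodic.returnsInPast {k : ℕ} {ν : Fin k → ℝ} {J : C(ℝ, X)}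
    (hJ : IsQuasiPeriodic ν J) : ReturnsInPast J := by
  obtain ⟨-, Φ, hΦ, hJΦ⟩ := hJ
  obtain ⟨θ, n, hn, h1, h2⟩ := exists_limit (ν := ν) hΦ
  intro t ε l hε
  obtain ⟨j, hj⟩ := (Metric.tendsto_nhds.1 (h2 fun i => ν i * t) (ε / 2) (half_pos hε)).exists
  have h3 := Metric.tendsto_nhds.1 (h1 ((fun i => ν i * t) + fun i => ν i * (n j : ℝ))) (ε / 2)
    (half_pos hε)
  have h4 : Tendsto (fun i => ((n i : ℕ) : ℝ)) atTop atTop :=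
    tendsto_natCast_atTop_atTop.comp hn.tendsto_atTop
  obtain ⟨i, hi, hi'⟩ := (h3.and (h4.eventually_gt_atTop (n j + l))).exists
  refine ⟨n j - n i, by linarith, ?_⟩
  have e : J (t + (n j - n i))
      = Φ (((fun i => ν i * t) + fun i => ν i * (n j : ℝ)) - fun i' => ν i' * (n i : ℝ)) := by
    rw [hJΦ]
    congr 1
    funext i'
    simp only [Pi.add_apply, Pi.sub_apply]
    ring
  rw [e, hJΦ]
  exact (dist_triangle _ _ _).trans_lt ((add_lt_add hi hj).trans_eq (add_halves ε))

end Recur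

namespace FBM

section

variable {Ω : Type*} [MeasurableSpace Ω] {P : Measure Ω} [IsProbabilityMeasure P]
  {E : Type*} [NormedAddCommGroup E] [InnerProductSpace ℝ E]
  {ι U : Type*} [NormedAddCommGroup U] [InnerProductSpace ℝ U] {e : HilbertBasis ι ℝ U} {σ : ι → ℝ}

/-- Boundedness of `g` is a bound on distances between its values, so the norm at time `0` has to be
added. -/
theorem exists_norm_joint_le (f : ℝ →ᵇ Lp E 2 P) (g : ℝ →ᵇ LQ0 e σ E) :
    ∃ M, ∀ s, ‖joint f g s‖ ≤ M := by
  obtain ⟨C, hC⟩ := g.bounded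
  refine ⟨max ‖f‖ (C + ‖(g 0).hs‖), fun s => max_le_max (f.norm_coe_le_norm s) ?_⟩
  have h1 : dist (g s).hs (g 0).hs ≤ C := hC s 0
  rw [dist_eq_norm] at h1
  calc ‖(g s).hs‖ = ‖(g s).hs - (g 0).hs + (g 0).hs‖ := by rw [sub_add_cancel]
    _ ≤ _ := (norm_add_le _ _).trans (add_le_add h1 le_rfl)

end

variable {Ω : Type*} [MeasurableSpace Ω] {P : Measure Ω} [IsProbabilityMeasure P]
  {E : Type*} [NormedAddCommGroup E] [InnerProductSpace ℝ E] [CompleteSpace E]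
  [MeasurableSpace E] [BorelSpace E]
  {ι U : Type*} [NormedAddCommGroup U] [InnerProductSpace ℝ U] {e : HilbertBasis ι ℝ U} {σ : ι → ℝ}
  {h : ℝ} {b : ι → ℝ → Lp ℝ 2 P} {β : ι → ℝ → Ω → ℝ}
  {B : ℝ → lp (fun _ : ι => E) 2 →L[ℝ] Lp E 2 P} {N α M : ℝ} {S : ℝ → E →L[ℝ] E}
  {f : ℝ →ᵇ Lp E 2 P} {g : ℝ →ᵇ LQ0 e σ E}

theorem IsCylindrical.isMildSolution [SecondCountableTopology E] (hh : 1 / 2 < h) (hb : IsFamily h b) (hB : IsCylindrical b B)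
    (hβm : ∀ n t, Measurable (β n t)) (hβ : ∀ n t, b n t =ᵐ[P] β n t) (hS : Evol.IsStable N α S)
    (hf : IsAdapted σ β f) :
    Evol.IsMildSolution h e σ β S f g
      (Evol.sol (Evol.onLp P S) (Evol.onSeq ι S) B (joint f g)) := by
  have hs := hB.isSystem hh hb hS
  obtain ⟨M, hM⟩ := exists_norm_joint_le f g
  have hp := map_continuous (joint f g)
  refine ⟨fun t => ?_, fun a t hat => ⟨_, hB.isStochIntegral hh hb hβ hat
    (hs.cont₂ hp le_rfl) fun n s => rfl, ?_⟩⟩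
  · refine mem_lpMeas_iff_aestronglyMeasurable.1 (hs.sol_mem hp hM
      (isClosed_lpMeas (filt_le hβm t)) (fun r x hx => onLp_mem_lpMeas S r hx) (fun s hst => ?_)
      fun s hst r _ u => hB.mem_lpMeas hβm hβ hst fun n => ⟨S u ((g r).op (e n)), ?_⟩)
    · exact mem_lpMeas_iff_aestronglyMeasurable.2 ((hf s).mono (filt_mono σ β hst))
    · change S u ((g r).op (√(σ n) • e n)) = _
      rw [map_smul, map_smul]
  · rw [hs.sol_eq hp hM hat, Evol.duhamel, ← add_assoc]
    rfl

theorem IsCylindrical.eq_sol_of_isMildSolution (hh : 1 / 2 < h) (hh1 : h < 1) (hb : IsFamily h b)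
    (hB : IsCylindrical b B) (hβ : ∀ n t, b n t =ᵐ[P] β n t) (hS : Evol.IsStable N α S)
    {ψ : ℝ →ᵇ Lp E 2 P} (hψ : Evol.IsMildSolution h e σ β S f g ψ) :
    ⇑ψ = Evol.sol (Evol.onLp P S) (Evol.onSeq ι S) B (joint f g) := by
  have hs := hB.isSystem hh hb hS
  obtain ⟨M, hM⟩ := exists_norm_joint_le f g
  have hp := map_continuous (joint f g)
  refine hs.eq_sol hp hM (fun s => ψ.norm_coe_le_norm s) fun a t hat => ?_
  obtain ⟨y, hy, hψy⟩ := hψ.2 a t hat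
  have hc := hs.cont₂ (a := a) hp (le_refl t)
  have h1 := hB.isStochIntegral (Φ := fun s => (S (t - s)).comp (g s).op) (e := e) (σ := σ) hh hb hβ
    hat hc fun n s => rfl
  rw [hψy, hy.unique hh hh1 hb hβ (fun n =>
    (lp.evalCLM ℝ (fun _ : ι => E) 2 n).continuous.comp_continuousOn hc) h1, Evol.duhamel,
    ← add_assoc]
  rfl

variable [SecondCountableTopology E]

/-- The law at `t + τ` is that of the solution at `t` with translated coefficients and restarted
noise. A non-random drift allows going back to `B`, and then the window estimate compares two
solutions driven by the same noise. -/
theorem IsCylindrical.dominated (hh : 1 / 2 < h) (hb : IsFamily h b) (hB : IsCylindrical b B)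
    (hG : Gauss.IsGaussian (gaussSpan b)) (hS : Evol.IsStable N α S)
    {p : C(ℝ, Lp E 2 P × lp (fun _ : ι => E) 2)} (hM : ∀ s, ‖p s‖ ≤ M)
    (hc : ∀ s, ∃ c : E, (p s).1 =ᵐ[P] fun _ => c) {Λ : C(ℝ, BL.Prob E)}
    (hΛ : ∀ t, Λ t = BL.law (Evol.sol (Evol.onLp P S) (Evol.onSeq ι S) B p t)) :
    Recur.Dominated p Λ := by
  have hs := hB.isSystem hh hb hS
  intro ε hε
  obtain ⟨δ, hδ, K, hK, hwin⟩ := Evol.IsSystem.exists_window (h := h) (Evol.onLp P S)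
    (Evol.onSeq ι S) (hS.onLp P) M hε
  refine ⟨δ, hδ, K, hK, fun t τ hJ => ?_⟩
  have hpτ : Continuous fun s => p (s + τ) := by fun_prop
  rw [hΛ, hΛ, Evol.sol_shift, hB.law_sol_shift hh hb isClosed_gaussSpan mem_gaussSpan hG hS hpτ
    (fun s => hM _) fun s => hc _]
  exact (BL.dist_law_le _ _).trans (hwin B _ _ hs hpτ (map_continuous p) (fun s => hM _) hM t hJ)

/-- The torus function sends a phase `θ` to the law at time `0` of the solution whose coefficients
are read along the line through `θ`. It inherits the periods of `Φ`, and is continuous by the window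
estimate. -/
theorem IsCylindrical.isQuasiPeriodic (hh : 1 / 2 < h) (hb : IsFamily h b) (hB : IsCylindrical b B)
    (hG : Gauss.IsGaussian (gaussSpan b)) (hS : Evol.IsStable N α S)
    {p : C(ℝ, Lp E 2 P × lp (fun _ : ι => E) 2)}
    (hc : ∀ s, ∃ c : E, (p s).1 =ᵐ[P] fun _ => c) {Λ : C(ℝ, BL.Prob E)}
    (hΛ : ∀ t, Λ t = BL.law (Evol.sol (Evol.onLp P S) (Evol.onSeq ι S) B p t))
    {k : ℕ} {ν : Fin k → ℝ} (hp : Recur.IsQuasiPeriodic ν p) : Recur.IsQuasiPeriodic ν Λ := by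
  have hs := hB.isSystem hh hb hS
  obtain ⟨hν, Φ, hΦ, hpΦ⟩ := hp
  refine ⟨hν, ?_⟩
  have : CompleteSpace (lpMeas E ℝ (⊥ : MeasurableSpace Ω) 2 P) :=
    (isClosed_lpMeas (E := E) (P := P) bot_le).completeSpace_coe
  let D := (lpMeas E ℝ (⊥ : MeasurableSpace Ω) 2 P).starProjection
  -- Projecting onto constants changes nothing along the orbit, where the drift is already constant.
  let Ψ : C(Fin k → ℝ, Lp E 2 P × lp (fun _ : ι => E) 2) :=
    ⟨fun θ => (D (Φ θ).1, (Φ θ).2), by fun_prop⟩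
  have hΨ : ∀ (θ : Fin k → ℝ) (i : Fin k), Ψ (θ + Pi.single i (2 * Real.pi)) = Ψ θ := fun θ i => by
    change (D (Φ _).1, (Φ _).2) = (D (Φ _).1, (Φ _).2)
    rw [hΦ]
  have hpΨ : ∀ t, p t = Ψ fun i => ν i * t := fun t => by
    change _ = (D (Φ _).1, (Φ _).2)
    rw [← hpΦ, Submodule.starProjection_eq_self_iff.2 (mem_lpMeas_bot_iff.2 (hc t))]
  obtain ⟨M, hM⟩ : ∃ M, ∀ θ, ‖Ψ θ‖ ≤ M := by
    obtain ⟨M, hM⟩ := (isCompact_Icc (a := (0 : Fin k → ℝ))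
      (b := fun _ => 2 * Real.pi)).exists_bound_of_continuousOn (map_continuous Ψ).continuousOn
    refine ⟨M, fun θ => ?_⟩
    obtain ⟨θ', hθ', h1⟩ := Recur.exists_mem_Icc_apply_eq hΨ θ
    have := h1 0
    rw [zero_add, zero_add] at this
    rw [← this]
    exact hM _ hθ'
  let q : C(Fin k → ℝ, C(ℝ, Lp E 2 P × lp (fun _ : ι => E) 2)) :=
    ContinuousMap.curry ⟨fun x => Ψ (x.1 + fun i => ν i * x.2), by fun_prop⟩
  have hq : ∀ θ s, q θ s = Ψ (θ + fun i => ν i * s) := fun θ s => rfl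
  have hcont : Continuous fun θ =>
      BL.law (Evol.sol (Evol.onLp P S) (Evol.onSeq ι S) B (q θ) 0) := by
    refine continuous_iff_continuousAt.2 fun θ => Metric.tendsto_nhds.2 fun ε hε => ?_
    obtain ⟨δ, hδ, K, hK, hwin⟩ := Evol.IsSystem.exists_window (h := h) (Evol.onLp P S)
      (Evol.onSeq ι S) (hS.onLp P) M (half_pos hε)
    have hunif := ContinuousMap.tendsto_iff_forall_isCompact_tendstoUniformlyOn.1
      ((map_continuous q).tendsto θ) (Set.Icc (0 - K) 0) isCompact_Icc
    filter_upwards [Metric.tendstoUniformlyOn_iff.1 hunif δ hδ] with η hη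
    refine (BL.dist_law_le _ _).trans_lt ((hwin B _ _ hs (map_continuous (q η))
      (map_continuous (q θ)) (fun s => hM _) (fun s => hM _) 0 fun s hsK => ?_).trans_lt
        (half_lt_self hε))
    rw [dist_comm]
    exact (hη s hsK).le
  refine ⟨⟨_, hcont⟩, fun θ i => ?_, fun t => ?_⟩
  · have : q (θ + Pi.single i (2 * Real.pi)) = q θ := by
      ext1 s
      rw [hq, hq, add_right_comm, hΨ]
    simp only [ContinuousMap.coe_mk, this]
  · have e1 : (fun s => p (s + t)) = q fun i => ν i * t := by
      funext s
      rw [hpΨ, hq]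
      congr 1
      funext i
      simp only [Pi.add_apply]
      ring
    have e2 := hB.law_sol_shift hh hb isClosed_gaussSpan mem_gaussSpan hG hS
      (p := fun s => p (s + t)) (by fun_prop) (M := M) (fun s => by rw [hpΨ]; exact hM _)
      (fun s => hc _) t 0
    rw [← Evol.sol_shift, zero_add, e1] at e2
    rw [hΛ]
    exact e2

end FBM

/-! ### The main theorem. -/

theorem mainTheorem4
    {Ω : Type*} [MeasurableSpace Ω] (P : Measure Ω) [IsProbabilityMeasure P]
    {H : Type*} [NormedAddCommGroup H] [InnerProductSpace ℝ H] [CompleteSpace H]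
    [TopologicalSpace.SeparableSpace H] [MeasurableSpace H] [BorelSpace H]
    {U : Type*} [NormedAddCommGroup U] [InnerProductSpace ℝ U] [CompleteSpace U]
    [TopologicalSpace.SeparableSpace U]
    -- the covariance operator, diagonal in an orthonormal basis
    {ι : Type*} [Countable ι] (e : HilbertBasis ι ℝ U)
    (Q : U →L[ℝ] U) (hQ : Q.IsPositive) (σ : ι → ℝ) (hQe : ∀ n, Q (e n) = σ n • e n)
    -- independent fractional Brownian motions with Hurst index `h`
    (h : ℝ) (hh : 1 / 2 < h) (hh1 : h < 1)
    (β : ι → ℝ → Ω → ℝ) (hβ : ∀ n, FBM.IsFBM P h (β n))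
    (hind : iIndepFun (fun n ω => fun t : ℝ => β n t ω) P)
    -- the exponentially stable semigroup generated by `A`
    (A : H →ₗ.[ℝ] H) (S : ℝ → H →L[ℝ] H) (hS : Evol.IsC0Semigroup S)
    (hA : Evol.IsGenerator A S) (hstab : Evol.IsExponentiallyStable S)
    -- the coefficients
    (f : ℝ →ᵇ Lp H 2 P) (hf : FBM.IsAdapted σ β f) (g : ℝ →ᵇ FBM.LQ0 e σ H) :
    ∃ φ : ℝ →ᵇ Lp H 2 P,
      Evol.IsMildSolution h e σ β S f g φ ∧
      (∀ ψ : ℝ →ᵇ Lp H 2 P, Evol.IsMildSolution h e σ β S f g ψ → ψ = φ) ∧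
      -- first part
      (Recur.IsStationary (FBM.joint f g) → Recur.IsStationary (BL.lawCurve φ)) ∧
      (∀ τ : ℝ, Recur.IsPeriodic τ (FBM.joint f g) → Recur.IsPeriodic τ (BL.lawCurve φ)) ∧
      (∀ (k : ℕ) (ν : Fin k → ℝ), Recur.IsQuasiPeriodic ν (FBM.joint f g) →
        Recur.IsQuasiPeriodic ν (BL.lawCurve φ)) ∧
      (Recur.IsBohrAlmostPeriodic (FBM.joint f g) →
        Recur.IsBohrAlmostPeriodic (BL.lawCurve φ)) ∧
      (Recur.IsBohrAlmostAutomorphic (FBM.joint f g) →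
        Recur.IsBohrAlmostAutomorphic (BL.lawCurve φ)) ∧
      (Recur.IsBirkhoffRecurrent (FBM.joint f g) →
        Recur.IsBirkhoffRecurrent (BL.lawCurve φ)) ∧
      (Recur.IsLagrangeStable (FBM.joint f g) → Recur.IsLagrangeStable (BL.lawCurve φ)) ∧
      (Recur.IsLevitanAlmostPeriodic (FBM.joint f g) →
        Recur.IsLevitanAlmostPeriodic (BL.lawCurve φ)) ∧
      (Recur.IsAlmostRecurrent (FBM.joint f g) → Recur.IsAlmostRecurrent (BL.lawCurve φ)) ∧
      (Recur.IsPoissonStable (FBM.joint f g) → Recur.IsPoissonStable (BL.lawCurve φ)) ∧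
      -- second part
      (Recur.IsLagrangeStable (FBM.joint f g) →
        (Recur.IsPseudoPeriodic (FBM.joint f g) → Recur.IsPseudoPeriodic (BL.lawCurve φ)) ∧
        (Recur.IsPseudoRecurrent (FBM.joint f g) → Recur.IsPseudoRecurrent (BL.lawCurve φ)) ∧
        -- the window variant of pseudo-recurrence
        (((∀ t, ∃ c : H, f t =ᵐ[P] fun _ => c) ∨ Recur.IsPoissonStable (FBM.joint f g)) →
          Recur.IsWindowPseudoRecurrent (FBM.joint f g) →
          Recur.IsWindowPseudoRecurrent (BL.lawCurve φ))) := by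
  obtain ⟨N, α, hN, hα, hNα⟩ := hstab
  have hSt : Evol.IsStable N α S :=
    { toIsC0Semigroup := hS, N_pos := hN, α_pos := hα, bound := hNα }
  obtain ⟨b, hbβ, hb⟩ := FBM.exists_isFamily hβ hind
  obtain ⟨B, hB⟩ := hb.exists_isCylindrical (E := H) hh
  have hβm : ∀ n t, Measurable (β n t) := fun n => (hβ n).measurable
  have hG : Gauss.IsGaussian (FBM.gaussSpan b) :=
    (Gauss.isGaussian_span hβ hind hbβ hb).topologicalClosure
  have hs := hB.isSystem hh hb hSt
  obtain ⟨M, hM⟩ := FBM.exists_norm_joint_le f g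
  have hp := map_continuous (FBM.joint f g)
  let φ : ℝ →ᵇ Lp H 2 P := BoundedContinuousFunction.ofNormedAddCommGroup _
    (hs.continuous_sol hp hM) _ (hs.norm_sol_le hp hM)
  have hΛ : ∀ t, BL.lawCurve φ t
      = BL.law (Evol.sol (Evol.onLp P S) (Evol.onSeq ι S) B (FBM.joint f g) t) := fun t => rfl
  have hdom : (∀ t, ∃ c : H, f t =ᵐ[P] fun _ => c) →
      Recur.Dominated (FBM.joint f g) (BL.lawCurve φ) := fun hc =>
    hB.dominated hh hb hG hSt hM hc hΛ
  -- Recurrence into the past forces the adapted drift to be non-random.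
  have hdet : Recur.ReturnsInPast (FBM.joint f g) → ∀ t, ∃ c : H, f t =ᵐ[P] fun _ => c :=
    fun hr t => hb.exists_ae_eq_const_of_isAdapted hh hh1 hβm hbβ hG hf fun ε l hε => by
      obtain ⟨τ, hτ, hd⟩ := hr t ε l hε
      exact ⟨τ, hτ, (le_max_left _ _).trans_lt hd⟩
  have hret := fun hr => hdom (hdet hr)
  have hlag : Recur.IsLagrangeStable (FBM.joint f g) → Recur.IsLagrangeStable (BL.lawCurve φ) :=
    fun hL => hB.isLagrangeStable hh hh1 hb hβm hbβ hG hSt hM (fun s =>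
      mem_lpMeas_iff_aestronglyMeasurable.2
        ((hf s).mono (FBM.filt_le_iSup_cylinder σ β s))) hL hΛ
  have hY : ∀ μ ν : BL.Prob H, dist μ ν = 0 → μ = ν := fun _ _ => BL.eq_of_dist_eq_zero
  refine ⟨φ, hB.isMildSolution hh hb hβm hbβ hSt hf, fun ψ hψ =>
    DFunLike.coe_injective (hB.eq_sol_of_isMildSolution hh hh1 hb hbβ hSt hψ),
    fun hJ => (hret hJ.returnsInPast).isStationary hY hJ, fun τ hJ => ?_,
    fun k ν hJ => hB.isQuasiPeriodic hh hb hG hSt (hdet hJ.returnsInPast) hΛ hJ,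
    fun hJ => (hret hJ.returnsInPast).isBohrAlmostPeriodic hJ,
    fun hJ => ⟨(hret hJ.1.returnsInPast).isLevitanAlmostPeriodic hJ.1, hlag hJ.2⟩,
    fun hJ => ⟨(hret hJ.1.returnsInPast).isAlmostRecurrent hJ.1, hlag hJ.2⟩, hlag,
    fun hJ => (hret hJ.returnsInPast).isLevitanAlmostPeriodic hJ,
    fun hJ => (hret hJ.returnsInPast).isAlmostRecurrent hJ,
    fun hJ => (hret hJ.returnsInPast).isPoissonStable hJ,
    fun _ => ⟨fun hJ => (hret hJ.returnsInPast).isPseudoPeriodic hJ,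
      fun hJ => (hret hJ.returnsInPast).isPseudoRecurrent hJ, fun hc hJ =>
        -- Window pseudo-recurrence does not enter the proof that the drift is non-random; this
        -- comes from the hypothesis, directly or through Poisson stability.
        (hdom (hc.elim id fun hP => hdet hP.returnsInPast)).isWindowPseudoRecurrent hJ⟩⟩
  -- Period `0` carries no information about the past, but the conclusion is then trivial.
  rcases eq_or_ne τ 0 with rfl | hτ
  · exact fun t => by rw [add_zero]
  · exact (hret (hJ.returnsInPast hτ)).isPeriodic hY hJ
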